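/- Let $m,n\ge 2$. The $m\times n$ grid is the graph on $V=\{1,\dots,m\}\times\{1,\dots,n\}$ in which two vertices are adjacent iff their $\ell_1$ distance is $1$; let $c:V\to\mathbb{Q}_{\ge 0}$ be a cost function and $c(L)=\sum_{v\in L}c(v)$. A set $L\subseteq V$ is a *landmark set* if for all distinct $u,v\in V$ some $x\in L$ has $d(x,u)\ne d(x,v)$, where $d$ is the graph distance. A corner is a vertex that lies in row $1$ or $m$ and in column $1$ or $n$. An *orientation* is one of the eight renumberings of the grid by reflecting rows and/or columns and possibly exchanging rows with columns (with the costs carried along). Define three families of sets. - $\mathcal F_2$: the pairs of distinct corners that lie in the same row or in the same column. - $\mathcal F_3$: the sets that in some orientation have the form $\{(1,z),(m,z),(a,b)\}$ with $1<z<n$ and $b\ne z$, or the form $\{(1,z),(m,z'),(1,z'')\}$ with $z<z'<z''$ (where $m,n$ are the dimensions in that orientation). - $\mathcal F_4$: the sets that in some orientation are the vertex set of a *perfect* sequence. Here a *zigzag sequence* is $q_1,\dots,q_{2k}$, $k\ge 2$, $q_i=(s_i,d_i)$, with $s_1=1$, $s_{2k}=m$, such that $d_i=d_{i-1}$ and $s_i>s_{i-1}$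 for even $i$, and $s_i=s_{i-1}$ and $d_i>d_{i-1}$ for odd $i\ge 3$; a sequence $t_1,\dots,t_{2k}$, $t_i=(b_i,c_i)$, *corresponds* to it if $t_1=q_1$, $b_i=s_i$ and $c_i\le d_i$ for even $i$, $c_i=d_i$ and $b_i\le s_i$ for odd $i\ge 3$, and $c_{2k}>c_1$; it is *perfect* if $\sum_i c(t_i)$ is minimum among all sequences corresponding to the same zigzag sequence. (1) For all $m,n\ge 2$ and all $c$: the landmark sets of cardinality $2$ are exactly the members of $\mathcal F_2$; every member of $\mathcal F_3$ is a landmark set of cardinality $3$, and every inclusion-minimal landmark set of cardinality $3$ is in $\mathcal F_3$; every member of $\mathcal F_4$ is a landmark set of cardinality at least $4$, and every landmark set of cardinality at least $4$ that is both inclusion-minimal and of minimum cost among all landmark sets is in $\mathcal F_4$. (2) Consider unit-cost random access machines with two-dimensional arrays whose input is $m$, $n$ and the cost matrix. One step can read an entry of the matrix, copy, add or compare costs (non-negative rationals or $\infty$), or add, subtract or compare array indices. There are programs $P_2,P_3,P_4,P$, independent of $m,n,c$, and a constant $C$, such that for all $m,n\ge2$ and all $c$: each of $P_2,P_3,P_4$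 halts and outputs a minimum-cost member of $\mathcal F_2$, $\mathcal F_3$, $\mathcal F_4$ respectively (or reports, by an empty output, that the family is empty), $P_2$ within $C$ steps and $P_3,P_4$ within $C(m+n)|V|$ steps; and $P$ halts within $C(m+n)|V|$ steps, hence in time $O((m+n)|V|)=O(|V|^2)$, its output is one of the outputs of $P_2,P_3,P_4$, and this output is a landmark set of minimum cost among all landmark sets of the grid. -/

import Mathlib

namespace WeightedGrid

/-! ### Grids, landmark sets, costs

Rows and columns are numbered from `0`, so the vertex in row `i` and column `j`
(counted from `1`) is the pair `(i - 1, j - 1)`. -/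

/-- The vertices of the grid with `m` rows and `n` columns. -/
abbrev Vertex (m n : ℕ) : Type := Fin m × Fin n

/-- The two-dimensional grid: two vertices are adjacent if and only if their `ℓ₁` distance
is `1`. -/
def grid (m n : ℕ) : SimpleGraph (Vertex m n) where
  Adj u v := |(u.1 : ℤ) - (v.1 : ℤ)| + |(u.2 : ℤ) - (v.2 : ℤ)| = 1
  symm := ⟨fun u v h => by
    rw [abs_sub_comm (v.1 : ℤ) (u.1 : ℤ), abs_sub_comm (v.2 : ℤ) (u.2 : ℤ)]; exact h⟩
  loopless := ⟨fun u h => by simp at h⟩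

/-- `L` is a landmark set of `G`: any two distinct vertices have different distances to some
vertex of `L`. -/
def IsLandmarkSet {V : Type*} (G : SimpleGraph V) (L : Finset V) : Prop :=
  ∀ u v : V, u ≠ v → ∃ x ∈ L, G.dist x u ≠ G.dist x v

/-- The cost of a set of vertices. -/
def cost {V : Type*} (c : V → NNRat) (L : Finset V) : NNRat := ∑ v ∈ L, c v

/-- `L` belongs to the family `F` and has minimum cost among the members of `F`. -/
def IsCheapest {V : Type*} (c : V → NNRat) (F : Set (Finset V)) (L : Finset V) : Prop :=
  L ∈ F ∧ ∀ L' ∈ F, cost c L ≤ cost c L'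

/-- All landmark sets of the grid. -/
def landmarkSets (m n : ℕ) : Set (Finset (Vertex m n)) :=
  {L | IsLandmarkSet (grid m n) L}

/-! ### Pairs of adjacent corners -/

/-- Corners of the grid. -/
def IsCorner {m n : ℕ} (u : Vertex m n) : Prop :=
  ((u.1 : ℕ) = 0 ∨ (u.1 : ℕ) + 1 = m) ∧ ((u.2 : ℕ) = 0 ∨ (u.2 : ℕ) + 1 = n)

/-- The sets that consist of two distinct corners in the same row or in the same column. -/
def adjacentCornerPairs (m n : ℕ) : Set (Finset (Vertex m n)) :=
  {L | ∃ u v : Vertex m n, IsCorner u ∧ IsCorner v ∧ u ≠ v ∧ (u.1 = v.1 ∨ u.2 = v.2) ∧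
    L = {u, v}}

/-! ### The eight orientations of a grid -/

/-- Reflect the rows if `r` is true, and the columns if `f` is true. -/
def flip (m n : ℕ) (r f : Bool) : Vertex m n ≃ Vertex m n :=
  Equiv.prodCongr (bif r then Fin.revPerm else Equiv.refl _)
    (bif f then Fin.revPerm else Equiv.refl _)

/-- A class of vertex sets, given for every grid and every cost function on its vertices. -/
abbrev Family : Type := ∀ m n : ℕ, (Vertex m n → NNRat) → Set (Finset (Vertex m n))

/-- The vertex sets that belong to the family `F` after renumbering the grid in one of the
eight possible ways (four reflections, each with or without exchanging rows and columns;
the costs are carried along). -/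
def Family.orientations (F : Family) : Family := fun m n c =>
  {L | ∃ r f : Bool,
    L.map (flip m n r f).toEmbedding ∈ F m n (c ∘ (flip m n r f).symm) ∨
    L.map ((flip m n r f).trans (Equiv.prodComm (Fin m) (Fin n))).toEmbedding ∈
      F n m (c ∘ ((flip m n r f).trans (Equiv.prodComm (Fin m) (Fin n))).symm)}

/-! ### Landmark sets of cardinality three -/

/-- One column that is not the first or the last one, its vertices in the first and in the
last row, and any vertex of another column. -/
def sameColumnTriples : Family := fun m n _ =>
  {L | ∃ u v w : Vertex m n, (u.1 : ℕ) = 0 ∧ (v.1 : ℕ) + 1 = m ∧ u.2 = v.2 ∧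
    0 < (u.2 : ℕ) ∧ (u.2 : ℕ) + 1 < n ∧ w.2 ≠ u.2 ∧ L = {u, v, w}}

/-- Two vertices of the first row and a vertex of the last row whose column is strictly
between their columns. -/
def betweenTriples : Family := fun m n _ =>
  {L | ∃ u v w : Vertex m n, (u.1 : ℕ) = 0 ∧ (v.1 : ℕ) + 1 = m ∧ (w.1 : ℕ) = 0 ∧
    u.2 < v.2 ∧ v.2 < w.2 ∧ L = {u, v, w}}

/-- The two forms of landmark sets of cardinality three, in all orientations. -/
def triples : Family := fun m n c =>
  sameColumnTriples.orientations m n c ∪ betweenTriples.orientations m n c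

/-! ### Zigzag sequences and perfect sequences -/

/-- `q 1, …, q (2 * k)` is a zigzag sequence (values of `q` at other indices play no role). -/
structure IsZigzag {m n : ℕ} (k : ℕ) (q : ℕ → Vertex m n) : Prop where
  two_le : 2 ≤ k
  first_row : ((q 1).1 : ℕ) = 0
  last_row : ((q (2 * k)).1 : ℕ) + 1 = m
  even_step : ∀ i, 1 < i → i ≤ 2 * k → Even i →
    (q i).2 = (q (i - 1)).2 ∧ (q (i - 1)).1 < (q i).1
  odd_step : ∀ i, 1 < i → i ≤ 2 * k → Odd i →
    (q i).1 = (q (i - 1)).1 ∧ (q (i - 1)).2 < (q i).2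

/-- `t 1, …, t (2 * k)` corresponds to the zigzag sequence `q 1, …, q (2 * k)`. -/
structure Corresponds {m n : ℕ} (k : ℕ) (q t : ℕ → Vertex m n) : Prop where
  first : t 1 = q 1
  even_step : ∀ i, 1 < i → i ≤ 2 * k → Even i → (t i).1 = (q i).1 ∧ (t i).2 ≤ (q i).2
  odd_step : ∀ i, 1 < i → i ≤ 2 * k → Odd i → (t i).2 = (q i).2 ∧ (t i).1 ≤ (q i).1
  last_col : (t 1).2 < (t (2 * k)).2

/-- `t` has minimum cost among the sequences that correspond to the zigzag sequence `q`. -/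
def IsPerfect {m n : ℕ} (c : Vertex m n → NNRat) (k : ℕ) (q t : ℕ → Vertex m n) : Prop :=
  Corresponds k q t ∧ ∀ t' : ℕ → Vertex m n, Corresponds k q t' →
    ∑ i ∈ Finset.Icc 1 (2 * k), c (t i) ≤ ∑ i ∈ Finset.Icc 1 (2 * k), c (t' i)

/-- The vertex sets of perfect sequences of zigzag sequences, for one orientation. -/
def perfectSets : Family := fun m n c =>
  {L | ∃ (k : ℕ) (q t : ℕ → Vertex m n), IsZigzag k q ∧ IsPerfect c k q t ∧
    L = (Finset.Icc 1 (2 * k)).image t}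

/-- The vertex sets of perfect sequences of zigzag sequences, in all orientations. -/
def zigzagSets : Family := perfectSets.orientations

/-! ### The machine model

A unit-cost random access machine, programmed by while programs. It has index registers and
two-dimensional index arrays, which hold natural numbers, and cost registers and
two-dimensional cost arrays, which hold non-negative rational numbers or `∞`. The input
consists of the two dimensions and of the cost matrix, and the output is a list of pairs of
indices. Costs can only be read from the input, copied, added and compared; indices can be
added, subtracted (with result `0` if negative) and compared. -/

/-- The input of the machine: the number of rows, the number of columns, and the cost matrix. -/
structure Input where
  rows : ℕ
  cols : ℕ
  entry : ℕ → ℕ → WithTop NNRat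

/-- The input that describes a grid with costs (entries outside of the matrix read as `∞`). -/
def Input.ofGrid (m n : ℕ) (c : Vertex m n → NNRat) : Input where
  rows := m
  cols := n
  entry i j := if h : i < m ∧ j < n then ((c (⟨i, h.1⟩, ⟨j, h.2⟩) : NNRat) : WithTop NNRat) else ⊤

/-- The state of the machine. Registers and arrays are named by natural numbers. -/
structure State where
  ireg : ℕ → ℕ
  iarr : ℕ → ℕ → ℕ → ℕ
  creg : ℕ → WithTop NNRat
  carr : ℕ → ℕ → ℕ → WithTop NNRat
  out : List (ℕ × ℕ)

/-- The initial state: everything is `0`, and the output is empty. -/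
def State.init : State where
  ireg _ := 0
  iarr _ _ _ := 0
  creg _ := 0
  carr _ _ _ := 0
  out := []

/-- Index expressions. -/
inductive IExp : Type
  | lit (a : ℕ)
  | rows
  | cols
  | reg (x : ℕ)
  | arr (A : ℕ) (i j : IExp)
  | add (a b : IExp)
  | sub (a b : IExp)

/-- Cost expressions. -/
inductive CExp : Type
  | zero
  | infty
  | input (i j : IExp)
  | reg (x : ℕ)
  | arr (A : ℕ) (i j : IExp)
  | add (a b : CExp)

/-- Tests. -/
inductive Test : Type
  | ile (a b : IExp)
  | cle (a b : CExp)
  | not (p : Test)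
  | and (p q : Test)

/-- Programs. -/
inductive Program : Type
  | skip
  | setI (x : ℕ) (e : IExp)
  | putI (A : ℕ) (i j e : IExp)
  | setC (x : ℕ) (e : CExp)
  | putC (A : ℕ) (i j : IExp) (e : CExp)
  | emit (i j : IExp)
  | seq (P Q : Program)
  | ite (p : Test) (P Q : Program)
  | while (p : Test) (P : Program)

/-- The value of an index expression. -/
def IExp.eval (I : Input) (σ : State) : IExp → ℕ
  | .lit a => a
  | .rows => I.rows
  | .cols => I.cols
  | .reg x => σ.ireg x
  | .arr A i j => σ.iarr A (i.eval I σ) (j.eval I σ)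
  | .add a b => a.eval I σ + b.eval I σ
  | .sub a b => a.eval I σ - b.eval I σ

/-- The value of a cost expression. -/
def CExp.eval (I : Input) (σ : State) : CExp → WithTop NNRat
  | .zero => 0
  | .infty => ⊤
  | .input i j => I.entry (i.eval I σ) (j.eval I σ)
  | .reg x => σ.creg x
  | .arr A i j => σ.carr A (i.eval I σ) (j.eval I σ)
  | .add a b => a.eval I σ + b.eval I σ

/-- The truth value of a test. -/
def Test.Holds (I : Input) (σ : State) : Test → Prop
  | .ile a b => a.eval I σ ≤ b.eval I σ
  | .cle a b => a.eval I σ ≤ b.eval I σ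
  | .not p => ¬ p.Holds I σ
  | .and p q => p.Holds I σ ∧ q.Holds I σ

/-- Write the entry `(i, j)` of the array `A`. -/
def writeEntry {α : Type} (M : ℕ → ℕ → ℕ → α) (A i j : ℕ) (a : α) : ℕ → ℕ → ℕ → α :=
  fun A' i' j' => if A' = A ∧ i' = i ∧ j' = j then a else M A' i' j'

/-- `Exec I P σ t σ'`: with input `I`, the program `P`, started in the state `σ`, halts in the
state `σ'` after exactly `t` steps. Every assignment, every output and every evaluation of the
test of a conditional or of a loop is one step. (The sizes of the expressions of a program are
bounded by a constant that depends on the program only.) -/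
inductive Exec (I : Input) : Program → State → ℕ → State → Prop
  | skip (σ : State) : Exec I .skip σ 1 σ
  | setI (x : ℕ) (e : IExp) (σ : State) :
      Exec I (.setI x e) σ 1 { σ with ireg := Function.update σ.ireg x (e.eval I σ) }
  | putI (A : ℕ) (i j e : IExp) (σ : State) :
      Exec I (.putI A i j e) σ 1
        { σ with iarr := writeEntry σ.iarr A (i.eval I σ) (j.eval I σ) (e.eval I σ) }
  | setC (x : ℕ) (e : CExp) (σ : State) :
      Exec I (.setC x e) σ 1 { σ with creg := Function.update σ.creg x (e.eval I σ) }
  | putC (A : ℕ) (i j : IExp) (e : CExp) (σ : State) :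
      Exec I (.putC A i j e) σ 1
        { σ with carr := writeEntry σ.carr A (i.eval I σ) (j.eval I σ) (e.eval I σ) }
  | emit (i j : IExp) (σ : State) :
      Exec I (.emit i j) σ 1 { σ with out := σ.out ++ [(i.eval I σ, j.eval I σ)] }
  | seq {P Q : Program} {σ σ' σ'' : State} {t t' : ℕ} :
      Exec I P σ t σ' → Exec I Q σ' t' σ'' → Exec I (.seq P Q) σ (t + t') σ''
  | ite_true {p : Test} {P Q : Program} {σ σ' : State} {t : ℕ} :
      p.Holds I σ → Exec I P σ t σ' → Exec I (.ite p P Q) σ (t + 1) σ'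
  | ite_false {p : Test} {P Q : Program} {σ σ' : State} {t : ℕ} :
      ¬ p.Holds I σ → Exec I Q σ t σ' → Exec I (.ite p P Q) σ (t + 1) σ'
  | while_true {p : Test} {P : Program} {σ σ' σ'' : State} {t t' : ℕ} :
      p.Holds I σ → Exec I P σ t σ' → Exec I (.while p P) σ' t' σ'' →
        Exec I (.while p P) σ (t + t' + 1) σ''
  | while_false {p : Test} {P : Program} {σ : State} :
      ¬ p.Holds I σ → Exec I (.while p P) σ 1 σ

/-- The machine is deterministic. -/
theorem Exec.deterministic {I : Input} {P : Program} {σ σ₁ σ₂ : State} {t₁ t₂ : ℕ}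
    (h₁ : Exec I P σ t₁ σ₁) (h₂ : Exec I P σ t₂ σ₂) : t₁ = t₂ ∧ σ₁ = σ₂ := by
  induction h₁ generalizing t₂ σ₂ with
  | skip | setI | putI | setC | putC | emit => cases h₂; exact ⟨rfl, rfl⟩
  | seq _ _ ih ih' =>
    cases h₂ with
    | seq a b => obtain ⟨rfl, rfl⟩ := ih a; obtain ⟨rfl, rfl⟩ := ih' b; exact ⟨rfl, rfl⟩
  | ite_true hp _ ih =>
    cases h₂ with
    | ite_true _ a => obtain ⟨rfl, rfl⟩ := ih a; exact ⟨rfl, rfl⟩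
    | ite_false hq _ => exact absurd hp hq
  | ite_false hp _ ih =>
    cases h₂ with
    | ite_true hq _ => exact absurd hq hp
    | ite_false _ a => obtain ⟨rfl, rfl⟩ := ih a; exact ⟨rfl, rfl⟩
  | while_true hp _ _ ih ih' =>
    cases h₂ with
    | while_true _ a b => obtain ⟨rfl, rfl⟩ := ih a; obtain ⟨rfl, rfl⟩ := ih' b; exact ⟨rfl, rfl⟩
    | while_false hq => exact absurd hp hq
  | while_false hp =>
    cases h₂ with
    | while_true hq _ _ => exact absurd hq hp
    | while_false _ => exact ⟨rfl, rfl⟩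

/-- On the grid with costs `c`, the program `P` halts after exactly `t` steps with the
output `o`. -/
def Runs {m n : ℕ} (P : Program) (c : Vertex m n → NNRat) (t : ℕ) (o : List (ℕ × ℕ)) : Prop :=
  ∃ σ : State, Exec (Input.ofGrid m n c) P State.init t σ ∧ σ.out = o

/-- The output `o` lists the elements of the set `L`. -/
def Lists {m n : ℕ} (o : List (ℕ × ℕ)) (L : Finset (Vertex m n)) : Prop :=
  o.toFinset = L.image fun v => ((v.1 : ℕ), (v.2 : ℕ))

/-- The output `o` lists a member of minimum cost of the family `F`, or it is empty and `F`
has no member. -/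
def Finds {m n : ℕ} (c : Vertex m n → NNRat) (F : Set (Finset (Vertex m n)))
    (o : List (ℕ × ℕ)) : Prop :=
  (∃ L, IsCheapest c F L ∧ Lists o L) ∨ (F = ∅ ∧ o = [])

end WeightedGrid

/-!
The distance in the grid is the `ℓ₁` distance, so the vertices that are equidistant from two given
vertices lie in two opposite quadrants of some cross that cuts the grid between two rows and between
two columns, or in a single inner row or column. Hence a set is a landmark set if and only if it
meets both unions of opposite quadrants of every cross and is not contained in a single inner row or
column (`isLandmarkSet_iff`). All statements about landmark sets are derived from this criterion.

A sequence that corresponds to a zigzag sequence is the same thing as a *stair*, a sequence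
`p 0, r 0, p 1, r 1, …, p k, r k` in which every `r j` is in a new lowest row and not to the right
of `p j`, and every `p (j + 1)` is in a new rightmost column and not below `r j` (`IsFullStair`).
A stair from the first to the last row whose end is to the right of its beginning is a landmark set:
its ends hit one pair of quadrants, and its steps cannot jump over the other pair. Conversely,
every landmark set contains a pair, a triple or a stair (`exists_subset_mem_families`). It meets
two opposite sides, say the first and the last row. If its columns in these two rows coincide
somewhere or interlace, there is a pair or a triple; otherwise, a stair that starts at the last of
its vertices in the first row can be prolonged, by the criterion, until it reaches the last row.
Therefore the inclusion-minimal landmark sets are pairs, triples or stairs, and the cheapest stairs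
are perfect.

For the algorithms, a `Solver` first computes the optimum and then prints an optimal set. A program
can be run on disjoint registers and on a reoriented grid (`View.exec_prog`), so it is enough to
solve each problem in one orientation, starting from the initial state, and to combine solvers by
taking the better of two results (`Solver.Yields.select`). Apart from the trivial one for corners,
the basic solvers consist of tables of minima, with the places where these are attained
(`reaches_fillRow`). A cheapest triple is found by fixing one column, that of the two vertices in
the same column or that of the vertex between the other two, since the best choices for the rest can
then be read off from tables. The cheapest stairs are found by dynamic programming over positions
`(s, d)`, the row of the last `r j` and the column of the last `p j` (`IsTable`), where each entry
is a minimum over one row or one column. The condition that the end is to the right of the beginning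
seems to require that the first column is remembered, but a stair can be left at the first `p j`
that is not to the left of the end `r k`, so that it suffices to compare the column of the end with
that of the preceding `p (j - 1)` (`IsTable.exists_le_cost`).
-/

namespace WeightedGrid

/-! ### Distances in the grid -/

theorem abs_sub_le_length {m n : ℕ} {u v : Vertex m n} (p : (grid m n).Walk u v) :
    |(u.1 : ℤ) - v.1| + |(u.2 : ℤ) - v.2| ≤ p.length := by
  induction p with
  | nil => simp
  | @cons u w v h p ih =>
    have h' : |(u.1 : ℤ) - w.1| + |(u.2 : ℤ) - w.2| = 1 := h
    have h₁ := abs_sub_le (u.1 : ℤ) w.1 v.1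
    have h₂ := abs_sub_le (u.2 : ℤ) w.2 v.2
    rw [SimpleGraph.Walk.length_cons]
    push_cast
    linarith

theorem exists_walk_of_abs_sub {m n : ℕ} (k : ℕ) (u v : Vertex m n)
    (h : |(u.1 : ℤ) - v.1| + |(u.2 : ℤ) - v.2| = k) :
    ∃ p : (grid m n).Walk u v, p.length = k := by
  induction k generalizing u with
  | zero =>
    obtain rfl : u = v := by
      simp only [Int.abs_eq_natAbs] at h
      ext <;> omega
    exact ⟨.nil, rfl⟩
  | succ k ih =>
    obtain ⟨w, hw, hwv⟩ : ∃ w : Vertex m n, (grid m n).Adj u w ∧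
        |(w.1 : ℤ) - v.1| + |(w.2 : ℤ) - v.2| = k := by
      have := u.1.2
      have := u.2.2
      have := v.1.2
      have := v.2.2
      simp only [Int.abs_eq_natAbs] at h ⊢
      rcases lt_trichotomy (u.1 : ℕ) v.1 with h₁ | h₁ | h₁
      · refine ⟨(⟨u.1 + 1, by omega⟩, u.2), ?_, ?_⟩ <;> simp only [grid, Int.abs_eq_natAbs] <;> omega
      · rcases lt_trichotomy (u.2 : ℕ) v.2 with h₂ | h₂ | h₂
        · refine ⟨(u.1, ⟨u.2 + 1, by omega⟩), ?_, ?_⟩ <;> simp only [grid, Int.abs_eq_natAbs] <;> omega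
        · omega
        · refine ⟨(u.1, ⟨u.2 - 1, by omega⟩), ?_, ?_⟩ <;> simp only [grid, Int.abs_eq_natAbs] <;> omega
      · refine ⟨(⟨u.1 - 1, by omega⟩, u.2), ?_, ?_⟩ <;> simp only [grid, Int.abs_eq_natAbs] <;> omega
    obtain ⟨p, hp⟩ := ih w hwv
    exact ⟨.cons hw p, by simp [hp]⟩

theorem dist_grid {m n : ℕ} (u v : Vertex m n) :
    ((grid m n).dist u v : ℤ) = |(u.1 : ℤ) - v.1| + |(u.2 : ℤ) - v.2| := by
  obtain ⟨k, hk⟩ : ∃ k : ℕ, |(u.1 : ℤ) - v.1| + |(u.2 : ℤ) - v.2| = k :=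
    ⟨_, (Int.toNat_of_nonneg (by positivity)).symm⟩
  obtain ⟨p, hp⟩ := exists_walk_of_abs_sub k u v hk
  obtain ⟨q, hq⟩ := SimpleGraph.Reachable.exists_walk_length_eq_dist ⟨p⟩
  have h₁ := SimpleGraph.dist_le p
  have h₂ := abs_sub_le_length q
  omega

/-! ### Landmark sets in terms of crosses

The cut below row `i` and to the right of column `j` divides the grid into four quadrants. -/

/-- `L` meets the union of the upper left and the lower right quadrant of every cross. -/
def HitsMain {m n : ℕ} (L : Finset (Vertex m n)) : Prop :=
  ∀ i j : ℕ, i + 1 < m → j + 1 < n → ∃ x ∈ L,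
    ((x.1 : ℕ) ≤ i ∧ (x.2 : ℕ) ≤ j) ∨ (i < (x.1 : ℕ) ∧ j < (x.2 : ℕ))

/-- `L` meets the union of the upper right and the lower left quadrant of every cross. -/
def HitsAnti {m n : ℕ} (L : Finset (Vertex m n)) : Prop :=
  ∀ i j : ℕ, i + 1 < m → j + 1 < n → ∃ x ∈ L,
    ((x.1 : ℕ) ≤ i ∧ j < (x.2 : ℕ)) ∨ (i < (x.1 : ℕ) ∧ (x.2 : ℕ) ≤ j)

/-- `L` is not contained in a single row or column, unless that is a side of the grid. -/
structure NotInLine {m n : ℕ} (L : Finset (Vertex m n)) : Prop where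
  row : ∀ p : ℕ, 0 < p → p + 1 < m → ∃ x ∈ L, (x.1 : ℕ) ≠ p
  col : ∀ p : ℕ, 0 < p → p + 1 < n → ∃ x ∈ L, (x.2 : ℕ) ≠ p

theorem exists_dist_ne_iff {m n : ℕ} (L : Finset (Vertex m n)) (u v : Vertex m n) :
    (∃ x ∈ L, (grid m n).dist x u ≠ (grid m n).dist x v) ↔
      ∃ x ∈ L, |(x.1 : ℤ) - u.1| + |(x.2 : ℤ) - u.2| ≠ |(x.1 : ℤ) - v.1| + |(x.2 : ℤ) - v.2| := by
  refine exists_congr fun x => and_congr_right fun _ => ?_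
  rw [← dist_grid, ← dist_grid]
  exact_mod_cast Iff.rfl

/-- The vertices at equal distance from two vertices of different rows and columns lie in two
opposite quadrants of some cross; those at equal distance from two vertices of the same row
(or column) lie in a single column (or row) strictly between them. -/
theorem isLandmarkSet_iff {m n : ℕ} (hm : 2 ≤ m) (hn : 2 ≤ n) (L : Finset (Vertex m n)) :
    IsLandmarkSet (grid m n) L ↔ HitsMain L ∧ HitsAnti L ∧ NotInLine L := by
  simp only [IsLandmarkSet, exists_dist_ne_iff]
  constructor
  · intro h
    refine ⟨fun i j hi hj => ?_, fun i j hi hj => ?_, ⟨fun p hp hp' => ?_, fun p hp hp' => ?_⟩⟩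
    · obtain ⟨x, hx, hd⟩ := h (⟨i, by omega⟩, ⟨j, by omega⟩) (⟨i + 1, hi⟩, ⟨j + 1, hj⟩)
        (by simp)
      exact ⟨x, hx, by simp only [Int.abs_eq_natAbs] at hd; omega⟩
    · obtain ⟨x, hx, hd⟩ := h (⟨i, by omega⟩, ⟨j + 1, by omega⟩) (⟨i + 1, hi⟩, ⟨j, by omega⟩)
        (by simp)
      exact ⟨x, hx, by simp only [Int.abs_eq_natAbs] at hd; omega⟩
    · obtain ⟨x, hx, hd⟩ := h (⟨p - 1, by omega⟩, ⟨0, by omega⟩) (⟨p + 1, hp'⟩, ⟨0, by omega⟩)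
        (by simp)
      exact ⟨x, hx, by simp only [Int.abs_eq_natAbs] at hd; omega⟩
    · obtain ⟨x, hx, hd⟩ := h (⟨0, by omega⟩, ⟨p - 1, by omega⟩) (⟨0, by omega⟩, ⟨p + 1, hp'⟩)
        (by simp)
      exact ⟨x, hx, by simp only [Int.abs_eq_natAbs] at hd; omega⟩
  · rintro ⟨hM, hA, hL⟩
    obtain ⟨x₀, hx₀, -⟩ := hM 0 0 (by omega) (by omega)
    -- By symmetry, the first vertex may be assumed to lie in the upper row.
    suffices key : ∀ u v : Vertex m n, u ≠ v → (u.1 : ℕ) ≤ v.1 →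
        ∃ x ∈ L, |(x.1 : ℤ) - u.1| + |(x.2 : ℤ) - u.2| ≠
          |(x.1 : ℤ) - v.1| + |(x.2 : ℤ) - v.2| by
      intro u v huv
      rcases le_total (u.1 : ℕ) v.1 with h | h
      · exact key u v huv h
      · obtain ⟨x, hx, hd⟩ := key v u huv.symm h
        exact ⟨x, hx, hd.symm⟩
    intro u v huv hrow
    by_contra! hall
    have hu₁ := u.1.2
    have hu₂ := u.2.2
    have hv₁ := v.1.2
    have hv₂ := v.2.2
    have hne : (u.1 : ℕ) ≠ v.1 ∨ (u.2 : ℕ) ≠ v.2 := by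
      by_contra! hc
      exact huv (Prod.ext (Fin.ext hc.1) (Fin.ext hc.2))
    simp only [Int.abs_eq_natAbs] at hall
    have h₀ := hall x₀ hx₀
    rcases hrow.lt_or_eq with h₁ | h₁
    · rcases lt_trichotomy (u.2 : ℕ) v.2 with h₂ | h₂ | h₂
      · rcases le_total ((v.1 : ℕ) - u.1) (v.2 - u.2) with h₃ | h₃
        · obtain ⟨x, hx, hq⟩ := hM u.1 ((u.2 + (v.2 + v.1 - u.1)) / 2 - 1)
            (by omega) (by omega)
          have := hall x hx
          omega
        · obtain ⟨x, hx, hq⟩ := hM ((u.1 + (v.1 + v.2 - u.2)) / 2 - 1) u.2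
            (by omega) (by omega)
          have := hall x hx
          omega
      · obtain ⟨x, hx, hq⟩ := hL.row ((u.1 + v.1) / 2) (by omega) (by omega)
        have := hall x hx
        omega
      · rcases le_total ((v.1 : ℕ) - u.1) (u.2 - v.2) with h₃ | h₃
        · obtain ⟨x, hx, hq⟩ := hA u.1 ((u.2 + v.2 - (v.1 - u.1)) / 2)
            (by omega) (by omega)
          have := hall x hx
          omega
        · obtain ⟨x, hx, hq⟩ := hA ((u.1 + (v.1 + u.2 - v.2)) / 2 - 1) (u.2 - 1)
            (by omega) (by omega)
          have := hall x hx
          omega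
    · obtain ⟨x, hx, hq⟩ := hL.col ((u.2 + v.2) / 2) (by omega) (by omega)
      have := hall x hx
      grind

/-! ### Orientations preserve distances -/

theorem isLandmarkSet_map {V W : Type*} {G : SimpleGraph V} {H : SimpleGraph W} (e : V ≃ W)
    (he : ∀ u v, H.dist (e u) (e v) = G.dist u v) (L : Finset V) :
    IsLandmarkSet H (L.map e.toEmbedding) ↔ IsLandmarkSet G L := by
  constructor
  · intro h u v huv
    obtain ⟨x, hx, hd⟩ := h (e u) (e v) (e.injective.ne huv)
    rw [Finset.mem_map_equiv] at hx
    refine ⟨_, hx, ?_⟩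
    rwa [← he, ← he, e.apply_symm_apply]
  · intro h u v huv
    obtain ⟨x, hx, hd⟩ := h (e.symm u) (e.symm v) (e.symm.injective.ne huv)
    refine ⟨e x, by simpa using hx, ?_⟩
    rwa [← he, ← he, e.apply_symm_apply, e.apply_symm_apply] at hd

theorem cost_map {V W : Type*} (c : V → NNRat) (e : V ≃ W) (L : Finset V) :
    cost (c ∘ e.symm) (L.map e.toEmbedding) = cost c L := by
  simp [cost]

theorem flip_apply (m n : ℕ) (r f : Bool) (v : Vertex m n) :
    flip m n r f v = (bif r then v.1.rev else v.1, bif f then v.2.rev else v.2) := by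
  cases r <;> cases f <;> rfl

theorem flip_flip (m n : ℕ) (r f : Bool) (v : Vertex m n) :
    flip m n r f (flip m n r f v) = v := by
  cases r <;> cases f <;> simp [flip_apply]

theorem flip_symm (m n : ℕ) (r f : Bool) : (flip m n r f).symm = flip m n r f := by
  ext1 v
  rw [Equiv.symm_apply_eq, flip_flip]

theorem map_flip_false {m n : ℕ} (L : Finset (Vertex m n)) :
    L.map (flip m n false false).toEmbedding = L := by
  ext x
  simp [flip]

theorem dist_flip (m n : ℕ) (r f : Bool) (u v : Vertex m n) :
    (grid m n).dist (flip m n r f u) (flip m n r f v) = (grid m n).dist u v := by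
  zify
  rw [dist_grid, dist_grid]
  simp only [Int.abs_eq_natAbs]
  have := u.1.2
  have := u.2.2
  have := v.1.2
  have := v.2.2
  cases r <;> cases f <;> simp only [flip_apply, cond_true, cond_false, Fin.val_rev] <;> omega

theorem dist_prodComm (m n : ℕ) (u v : Vertex m n) :
    (grid n m).dist (Equiv.prodComm _ _ u) (Equiv.prodComm _ _ v) = (grid m n).dist u v := by
  zify
  rw [dist_grid, dist_grid]
  simp [add_comm]

/-- A member of `F.orientations` is carried to a member of `F` by an isometry of grids. -/
theorem Family.exists_equiv_of_mem_orientations {F : Family} {m n : ℕ} (hm : 2 ≤ m) (hn : 2 ≤ n)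
    {c : Vertex m n → NNRat} {L : Finset (Vertex m n)} (h : L ∈ F.orientations m n c) :
    ∃ (m' n' : ℕ) (e : Vertex m n ≃ Vertex m' n'), 2 ≤ m' ∧ 2 ≤ n' ∧
      (∀ u v, (grid m' n').dist (e u) (e v) = (grid m n).dist u v) ∧
      L.map e.toEmbedding ∈ F m' n' (c ∘ e.symm) := by
  obtain ⟨r, f, h | h⟩ := h
  · exact ⟨m, n, _, hm, hn, dist_flip m n r f, h⟩
  · exact ⟨n, m, _, hn, hm, fun u v =>
      (dist_prodComm m n (flip m n r f u) (flip m n r f v)).trans (dist_flip m n r f u v), h⟩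

theorem Family.isLandmarkSet_of_mem_orientations {F : Family} {P : ℕ → Prop}
    (hF : ∀ m n : ℕ, 2 ≤ m → 2 ≤ n → ∀ c : Vertex m n → NNRat, ∀ L ∈ F m n c,
      IsLandmarkSet (grid m n) L ∧ P L.card)
    {m n : ℕ} (hm : 2 ≤ m) (hn : 2 ≤ n) (c : Vertex m n → NNRat) :
    ∀ L ∈ F.orientations m n c, IsLandmarkSet (grid m n) L ∧ P L.card := by
  intro L hL
  obtain ⟨m', n', e, hm', hn', he, h⟩ := exists_equiv_of_mem_orientations hm hn hL
  have := hF m' n' hm' hn' _ _ h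
  rwa [isLandmarkSet_map e he, Finset.card_map] at this

/-! ### Pairs and triples are landmark sets -/

theorem isLandmarkSet_adjacentCornerPairs {m n : ℕ} (hm : 2 ≤ m) (hn : 2 ≤ n) :
    ∀ L ∈ adjacentCornerPairs m n, IsLandmarkSet (grid m n) L ∧ L.card = 2 := by
  rintro _ ⟨u, v, ⟨hu₁, hu₂⟩, ⟨hv₁, hv₂⟩, huv, hline, rfl⟩
  refine ⟨?_, Finset.card_pair huv⟩
  have hne : (u.1 : ℕ) ≠ v.1 ∨ (u.2 : ℕ) ≠ v.2 := by
    by_contra! hc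
    exact huv (Prod.ext (Fin.ext hc.1) (Fin.ext hc.2))
  simp only [Fin.ext_iff] at hline
  rw [isLandmarkSet_iff hm hn]
  refine ⟨fun i j hi hj => ?_, fun i j hi hj => ?_, ⟨fun p hp hp' => ?_, fun p hp hp' => ?_⟩⟩ <;>
    simp only [Finset.mem_insert, Finset.mem_singleton, exists_eq_or_imp, exists_eq_left] <;>
    omega

theorem isLandmarkSet_sameColumnTriples (m n : ℕ) (hm : 2 ≤ m) (hn : 2 ≤ n)
    (c : Vertex m n → NNRat) :
    ∀ L ∈ sameColumnTriples m n c, IsLandmarkSet (grid m n) L ∧ L.card = 3 := by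
  rintro _ ⟨u, v, w, hu, hv, huv, h₀, h₁, hw, rfl⟩
  simp only [ne_eq, Fin.ext_iff] at huv hw
  constructor
  · rw [isLandmarkSet_iff hm hn]
    refine ⟨fun i j hi hj => ?_, fun i j hi hj => ?_,
      ⟨fun p hp hp' => ?_, fun p hp hp' => ?_⟩⟩ <;>
      simp only [Finset.mem_insert, Finset.mem_singleton, exists_eq_or_imp, exists_eq_left] <;>
      omega
  · rw [Finset.card_eq_three]
    exact ⟨u, v, w, by rintro rfl; omega, by rintro rfl; omega, by rintro rfl; omega, rfl⟩

theorem isLandmarkSet_betweenTriples (m n : ℕ) (hm : 2 ≤ m) (hn : 2 ≤ n)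
    (c : Vertex m n → NNRat) :
    ∀ L ∈ betweenTriples m n c, IsLandmarkSet (grid m n) L ∧ L.card = 3 := by
  rintro _ ⟨u, v, w, hu, hv, hw, huv, hvw, rfl⟩
  simp only [Fin.lt_def] at huv hvw
  constructor
  · rw [isLandmarkSet_iff hm hn]
    refine ⟨fun i j hi hj => ?_, fun i j hi hj => ?_,
      ⟨fun p hp hp' => ?_, fun p hp hp' => ?_⟩⟩ <;>
      simp only [Finset.mem_insert, Finset.mem_singleton, exists_eq_or_imp, exists_eq_left] <;>
      omega
  · rw [Finset.card_eq_three]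
    exact ⟨u, v, w, by rintro rfl; omega, by rintro rfl; omega, by rintro rfl; omega, rfl⟩

theorem isLandmarkSet_triples {m n : ℕ} (hm : 2 ≤ m) (hn : 2 ≤ n) (c : Vertex m n → NNRat) :
    ∀ L ∈ triples m n c, IsLandmarkSet (grid m n) L ∧ L.card = 3 := by
  rintro L (hL | hL)
  · exact Family.isLandmarkSet_of_mem_orientations (P := (· = 3))
      isLandmarkSet_sameColumnTriples hm hn c L hL
  · exact Family.isLandmarkSet_of_mem_orientations (P := (· = 3))
      isLandmarkSet_betweenTriples hm hn c L hL

/-! ### Stairs -/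

/-- A stair: an intrinsic description of the sequences `t` that correspond to some zigzag
sequence, with the odd terms `p j = t (2 * j + 1)` and the even terms `r j = t (2 * j + 2)`,
for `j ≤ k`. The conditions on the last row and on the last column are not included. -/
structure IsStair {m n : ℕ} (k : ℕ) (p r : ℕ → Vertex m n) : Prop where
  first_row : ((p 0).1 : ℕ) = 0
  pos : 0 < ((r 0).1 : ℕ)
  left : ∀ j ≤ k, ((r j).2 : ℕ) ≤ (p j).2
  down : ∀ j < k, ((r j).1 : ℕ) < (r (j + 1)).1
  up : ∀ j < k, ((p (j + 1)).1 : ℕ) ≤ (r j).1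
  right : ∀ j < k, ((p j).2 : ℕ) < (p (j + 1)).2

/-- A stair that leads from the first to the last row, and ends to the right of its first
vertex. -/
structure IsFullStair {m n : ℕ} (k : ℕ) (p r : ℕ → Vertex m n) : Prop extends IsStair k p r where
  last_row : ((r k).1 : ℕ) + 1 = m
  last_col : ((p 0).2 : ℕ) < (r k).2

/-- The vertices `p 0, …, p k, r 0, …, r k`. -/
def stairVertices {m n : ℕ} (k : ℕ) (p r : ℕ → Vertex m n) : Finset (Vertex m n) :=
  (Finset.range (k + 1)).image p ∪ (Finset.range (k + 1)).image r

/-- The vertex sets of the stairs that lead from the first to the last row. -/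
def stairSets : Family := fun m n _ =>
  {L | ∃ (k : ℕ) (p r : ℕ → Vertex m n), IsFullStair k p r ∧ L = stairVertices k p r}

theorem mem_stairVertices {m n k : ℕ} {p r : ℕ → Vertex m n} {x : Vertex m n} :
    x ∈ stairVertices k p r ↔ ∃ j ≤ k, x = p j ∨ x = r j := by
  simp only [stairVertices, Finset.mem_union, Finset.mem_image, Finset.mem_range, Nat.lt_succ_iff]
  constructor
  · rintro (⟨j, hj, rfl⟩ | ⟨j, hj, rfl⟩)
    exacts [⟨j, hj, .inl rfl⟩, ⟨j, hj, .inr rfl⟩]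
  · rintro ⟨j, hj, rfl | rfl⟩
    exacts [.inl ⟨j, hj, rfl⟩, .inr ⟨j, hj, rfl⟩]

theorem IsStair.r_lt {m n k : ℕ} {p r : ℕ → Vertex m n} (h : IsStair k p r) {i j : ℕ}
    (hij : i < j) (hj : j ≤ k) : ((r i).1 : ℕ) < (r j).1 := by
  induction j, hij using Nat.le_induction with
  | base => exact h.down i (by omega)
  | succ j _ ih => exact (ih (by omega)).trans (h.down j (by omega))

theorem IsStair.p_lt {m n k : ℕ} {p r : ℕ → Vertex m n} (h : IsStair k p r) {i j : ℕ}
    (hij : i < j) (hj : j ≤ k) : ((p i).2 : ℕ) < (p j).2 := by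
  induction j, hij using Nat.le_induction with
  | base => exact h.right i (by omega)
  | succ j _ ih => exact (ih (by omega)).trans (h.right j (by omega))

theorem IsStair.p_row_lt {m n k : ℕ} {p r : ℕ → Vertex m n} (h : IsStair k p r) {i : ℕ}
    (hi : i ≤ k) : ((p i).1 : ℕ) < (r i).1 := by
  cases i with
  | zero => rw [h.first_row]; exact h.pos
  | succ i => exact (h.up i (by omega)).trans_lt (h.down i (by omega))

theorem IsStair.p_ne_r {m n k : ℕ} {p r : ℕ → Vertex m n} (h : IsStair k p r) {i j : ℕ}
    (hi : i ≤ k) (hj : j ≤ k) : p i ≠ r j := by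
  intro he
  rcases lt_trichotomy i j with hij | rfl | hij
  · have := h.p_row_lt hi
    have := h.r_lt hij hj
    rw [he] at *
    omega
  · have := h.p_row_lt hi
    rw [he] at this
    omega
  · have := h.left j hj
    have := h.p_lt hij hi
    rw [he] at *
    omega

theorem IsStair.p_injOn {m n k : ℕ} {p r : ℕ → Vertex m n} (h : IsStair k p r) :
    Set.InjOn p (Finset.range (k + 1)) := by
  intro i hi j hj hij
  simp only [Finset.coe_range, Set.mem_Iio] at hi hj
  by_contra hne
  rcases lt_or_gt_of_ne hne with h' | h'
  · have := h.p_lt h' (by omega)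
    rw [hij] at this
    omega
  · have := h.p_lt h' (by omega)
    rw [hij] at this
    omega

theorem IsStair.r_injOn {m n k : ℕ} {p r : ℕ → Vertex m n} (h : IsStair k p r) :
    Set.InjOn r (Finset.range (k + 1)) := by
  intro i hi j hj hij
  simp only [Finset.coe_range, Set.mem_Iio] at hi hj
  by_contra hne
  rcases lt_or_gt_of_ne hne with h' | h'
  · have := h.r_lt h' (by omega)
    rw [hij] at this
    omega
  · have := h.r_lt h' (by omega)
    rw [hij] at this
    omega

theorem IsStair.disjoint {m n k : ℕ} {p r : ℕ → Vertex m n} (h : IsStair k p r) :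
    Disjoint ((Finset.range (k + 1)).image p) ((Finset.range (k + 1)).image r) := by
  rw [Finset.disjoint_left]
  intro x hx hx'
  simp only [Finset.mem_image, Finset.mem_range] at hx hx'
  obtain ⟨i, hi, rfl⟩ := hx
  obtain ⟨j, hj, hij⟩ := hx'
  exact h.p_ne_r (by omega) (by omega) hij.symm

theorem IsStair.sum_stairVertices {M : Type*} [AddCommMonoid M] {m n k : ℕ}
    {p r : ℕ → Vertex m n} (h : IsStair k p r) (g : Vertex m n → M) :
    ∑ v ∈ stairVertices k p r, g v = ∑ j ∈ Finset.range (k + 1), (g (p j) + g (r j)) := by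
  rw [stairVertices, Finset.sum_union h.disjoint, Finset.sum_image h.p_injOn,
    Finset.sum_image h.r_injOn, Finset.sum_add_distrib]

theorem IsStair.card_stairVertices {m n k : ℕ} {p r : ℕ → Vertex m n} (h : IsStair k p r) :
    (stairVertices k p r).card = 2 * (k + 1) := by
  rw [Finset.card_eq_sum_ones, h.sum_stairVertices]
  simp [mul_comm]

theorem IsFullStair.pos_length {m n k : ℕ} {p r : ℕ → Vertex m n} (h : IsFullStair k p r) :
    1 ≤ k := by
  by_contra hk
  obtain rfl : k = 0 := by omega
  have := h.left 0 le_rfl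
  have := h.last_col
  omega

/-- The first and the last vertex of a stair deal with the upper left and the lower right
quadrants. If neither the upper right nor the lower left quadrant of a cross met the stair, then
neither the columns of the `p j` nor the rows of the `r j` could ever cross it. -/
theorem IsFullStair.isLandmarkSet {m n k : ℕ} {p r : ℕ → Vertex m n} (hm : 2 ≤ m) (hn : 2 ≤ n)
    (h : IsFullStair k p r) : IsLandmarkSet (grid m n) (stairVertices k p r) := by
  have hp : ∀ j ≤ k, p j ∈ stairVertices k p r := fun j hj => mem_stairVertices.2 ⟨j, hj, .inl rfl⟩
  have hr : ∀ j ≤ k, r j ∈ stairVertices k p r := fun j hj => mem_stairVertices.2 ⟨j, hj, .inr rfl⟩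
  have h₁ := h.first_row
  have h₂ := h.last_row
  have h₃ := h.last_col
  rw [isLandmarkSet_iff hm hn]
  refine ⟨fun i j hi hj => ?_, fun i j hi hj => ?_, ⟨fun l hl hl' => ?_, fun l hl hl' => ?_⟩⟩
  · rcases le_or_gt ((p 0).2 : ℕ) j with hc | hc
    · exact ⟨p 0, hp 0 (by omega), by omega⟩
    · exact ⟨r k, hr k le_rfl, by omega⟩
  · by_contra! hno
    have key : ∀ l ≤ k, ((p l).2 : ℕ) ≤ j ∧ ((r l).1 : ℕ) ≤ i := by
      intro l
      induction l with
      | zero =>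
        intro hl
        have := hno (p 0) (hp 0 hl)
        have := hno (r 0) (hr 0 hl)
        have := h.left 0 hl
        omega
      | succ l ih =>
        intro hl
        have := ih (by omega)
        have := hno (p (l + 1)) (hp _ hl)
        have := hno (r (l + 1)) (hr _ hl)
        have := h.left (l + 1) hl
        have := h.up l (by omega)
        omega
    have := key k le_rfl
    omega
  · exact ⟨p 0, hp 0 (by omega), by omega⟩
  · by_cases hc : ((p 0).2 : ℕ) = l
    · exact ⟨r k, hr k le_rfl, by omega⟩
    · exact ⟨p 0, hp 0 (by omega), hc⟩

theorem isLandmarkSet_stairSets (m n : ℕ) (hm : 2 ≤ m) (hn : 2 ≤ n) (c : Vertex m n → NNRat) :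
    ∀ L ∈ stairSets m n c, IsLandmarkSet (grid m n) L ∧ 4 ≤ L.card := by
  rintro _ ⟨k, p, r, h, rfl⟩
  have := h.pos_length
  exact ⟨h.isLandmarkSet hm hn, by rw [h.card_stairVertices]; omega⟩

/-! ### Stairs and zigzag sequences -/

theorem sum_Icc_pairs {M : Type*} [AddCommMonoid M] (g : ℕ → M) (k : ℕ) :
    ∑ i ∈ Finset.Icc 1 (2 * k), g i =
      ∑ j ∈ Finset.range k, (g (2 * j + 1) + g (2 * j + 2)) := by
  induction k with
  | zero => simp
  | succ k ih =>
    rw [show 2 * (k + 1) = 2 * k + 1 + 1 by ring, Finset.sum_Icc_succ_top (by omega),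
      Finset.sum_Icc_succ_top (by omega), ih, Finset.sum_range_succ, add_assoc]

theorem image_Icc_pairs {m n k : ℕ} (t : ℕ → Vertex m n) :
    (Finset.Icc 1 (2 * (k + 1))).image t =
      stairVertices k (fun j => t (2 * j + 1)) (fun j => t (2 * j + 2)) := by
  ext x
  simp only [mem_stairVertices, Finset.mem_image, Finset.mem_Icc]
  constructor
  · rintro ⟨i, hi, rfl⟩
    rcases Nat.even_or_odd' i with ⟨j, rfl | rfl⟩
    · exact ⟨j - 1, by omega, .inr (by congr 1; omega)⟩
    · exact ⟨j, by omega, .inl rfl⟩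
  · rintro ⟨j, hj, rfl | rfl⟩
    exacts [⟨2 * j + 1, by omega, rfl⟩, ⟨2 * j + 2, by omega, rfl⟩]

theorem isFullStair_of_corresponds {m n k : ℕ} {q t : ℕ → Vertex m n} (hq : IsZigzag (k + 1) q)
    (ht : Corresponds (k + 1) q t) :
    IsFullStair k (fun j => t (2 * j + 1)) (fun j => t (2 * j + 2)) := by
  have hk := hq.two_le
  have even : ∀ j ≤ k, Even (2 * j + 2) := fun j _ => ⟨j + 1, by ring⟩
  have odd : ∀ j, Odd (2 * (j + 1) + 1) := fun j => ⟨j + 1, by ring⟩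
  -- The rows of the even terms and the columns of the odd terms are those of `q`.
  have he : ∀ j ≤ k, (t (2 * j + 2)).1 = (q (2 * j + 2)).1 ∧ (t (2 * j + 2)).2 ≤ (q (2 * j + 2)).2 ∧
      (q (2 * j + 2)).2 = (q (2 * j + 1)).2 ∧ (q (2 * j + 1)).1 < (q (2 * j + 2)).1 := by
    intro j hj
    have h₁ := ht.even_step (2 * j + 2) (by omega) (by omega) (even j hj)
    have h₂ := hq.even_step (2 * j + 2) (by omega) (by omega) (even j hj)
    exact ⟨h₁.1, h₁.2, h₂.1, h₂.2⟩
  have ho : ∀ j < k, (t (2 * (j + 1) + 1)).2 = (q (2 * (j + 1) + 1)).2 ∧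
      (t (2 * (j + 1) + 1)).1 ≤ (q (2 * (j + 1) + 1)).1 ∧
      (q (2 * (j + 1) + 1)).1 = (q (2 * j + 2)).1 ∧
      (q (2 * j + 2)).2 < (q (2 * (j + 1) + 1)).2 := by
    intro j hj
    have h₁ := ht.odd_step (2 * (j + 1) + 1) (by omega) (by omega) (odd j)
    have h₂ := hq.odd_step (2 * (j + 1) + 1) (by omega) (by omega) (odd j)
    exact ⟨h₁.1, h₁.2, h₂.1, h₂.2⟩
  have hcol : ∀ j ≤ k, (t (2 * j + 1)).2 = (q (2 * j + 1)).2 := by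
    intro j hj
    cases j with
    | zero => rw [ht.first]
    | succ j => exact (ho j (by omega)).1
  simp only [Fin.ext_iff, Fin.lt_def, Fin.le_def] at he ho hcol
  refine ⟨⟨?_, ?_, ?_, ?_, ?_, ?_⟩, ?_, ?_⟩
  · exact (congrArg (fun v : Vertex m n => (v.1 : ℕ)) ht.first).trans hq.first_row
  · have := he 0 (by omega)
    omega
  · intro j hj
    have := he j hj
    have := hcol j hj
    omega
  · intro j hj
    have := he j (by omega)
    have := he (j + 1) (by omega)
    have := ho j (by omega)
    omega
  · intro j hj
    have := he j (by omega)
    have := ho j (by omega)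
    omega
  · intro j hj
    have := he j (by omega)
    have := ho j (by omega)
    have := hcol j (by omega)
    omega
  · have := he k le_rfl
    have h := hq.last_row
    rw [show 2 * (k + 1) = 2 * k + 2 by ring] at h
    omega
  · exact ht.last_col

theorem exists_corresponds_of_isFullStair {m n k : ℕ} {p r : ℕ → Vertex m n}
    (h : IsFullStair k p r) : ∃ q t : ℕ → Vertex m n, IsZigzag (k + 1) q ∧
      Corresponds (k + 1) q t ∧ (∀ j, t (2 * j + 1) = p j) ∧ ∀ j, t (2 * j + 2) = r j := by
  have hk := h.pos_length
  -- Row and column of a term of `q` are those of the neighbouring terms of `t`.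
  let q : ℕ → Vertex m n := fun i => if i = 1 then p 0 else
    if Even i then ((r (i / 2 - 1)).1, (p (i / 2 - 1)).2)
    else ((r (i / 2 - 1)).1, (p (i / 2)).2)
  let t : ℕ → Vertex m n := fun i => if Even i then r (i / 2 - 1) else p (i / 2)
  have q_one : q 1 = p 0 := by simp [q]
  have q_even : ∀ j, q (2 * j + 2) = ((r j).1, (p j).2) := by
    intro j
    have h₁ : Even (2 * j + 2) := ⟨j + 1, by ring⟩
    have h₂ : (2 * j + 2) / 2 - 1 = j := by omega
    simp only [q, h₁, h₂, if_true, show 2 * j + 2 ≠ 1 by omega, if_false]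
  have q_odd : ∀ j, q (2 * j + 3) = ((r j).1, (p (j + 1)).2) := by
    intro j
    have h₁ : ¬ Even (2 * j + 3) := by rw [Nat.not_even_iff_odd]; exact ⟨j + 1, by ring⟩
    have h₂ : (2 * j + 3) / 2 = j + 1 := by omega
    simp only [q, h₁, h₂, show 2 * j + 3 ≠ 1 by omega, if_false, Nat.add_sub_cancel]
  have q_col : ∀ j, (q (2 * j + 1)).2 = (p j).2 := by
    intro j
    cases j with
    | zero => rw [mul_zero, zero_add, q_one]
    | succ j => rw [show 2 * (j + 1) + 1 = 2 * j + 3 by ring, q_odd]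
  have t_even : ∀ j, t (2 * j + 2) = r j := by
    intro j
    have h₁ : Even (2 * j + 2) := ⟨j + 1, by ring⟩
    have h₂ : (2 * j + 2) / 2 - 1 = j := by omega
    simp only [t, h₁, h₂, if_true]
  have t_odd : ∀ j, t (2 * j + 1) = p j := by
    intro j
    have h₁ : ¬ Even (2 * j + 1) := by rw [Nat.not_even_iff_odd]; exact ⟨j, by ring⟩
    have h₂ : (2 * j + 1) / 2 = j := by omega
    simp only [t, h₁, h₂, if_false]
  have of_even : ∀ i, 1 < i → i ≤ 2 * (k + 1) → Even i → ∃ j ≤ k, i = 2 * j + 2 := by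
    rintro i h₁ h₂ ⟨j, rfl⟩
    exact ⟨j - 1, by omega, by omega⟩
  have of_odd : ∀ i, 1 < i → i ≤ 2 * (k + 1) → Odd i → ∃ j < k, i = 2 * j + 3 := by
    rintro i h₁ h₂ ⟨j, rfl⟩
    exact ⟨j - 1, by omega, by omega⟩
  refine ⟨q, t, ⟨by omega, ?_, ?_, ?_, ?_⟩, ⟨?_, ?_, ?_, ?_⟩, t_odd, t_even⟩
  · rw [q_one]
    exact h.first_row
  · rw [show 2 * (k + 1) = 2 * k + 2 by ring, q_even]
    exact h.last_row
  · intro i h₁ h₂ hi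
    obtain ⟨j, hj, rfl⟩ := of_even i h₁ h₂ hi
    rw [q_even, show 2 * j + 2 - 1 = 2 * j + 1 by omega, q_col]
    refine ⟨rfl, ?_⟩
    cases j with
    | zero =>
      rw [mul_zero, zero_add, q_one, Fin.lt_def, h.first_row]
      exact h.pos
    | succ j =>
      rw [show 2 * (j + 1) + 1 = 2 * j + 3 by ring, q_odd]
      exact h.down j (by omega)
  · intro i h₁ h₂ hi
    obtain ⟨j, hj, rfl⟩ := of_odd i h₁ h₂ hi
    rw [q_odd, show 2 * j + 3 - 1 = 2 * j + 2 by omega, q_even]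
    exact ⟨rfl, h.right j hj⟩
  · rw [q_one]
    exact t_odd 0
  · intro i h₁ h₂ hi
    obtain ⟨j, hj, rfl⟩ := of_even i h₁ h₂ hi
    rw [q_even, t_even]
    exact ⟨rfl, h.left j hj⟩
  · intro i h₁ h₂ hi
    obtain ⟨j, hj, rfl⟩ := of_odd i h₁ h₂ hi
    rw [q_odd, show 2 * j + 3 = 2 * (j + 1) + 1 by ring, t_odd]
    exact ⟨rfl, h.up j hj⟩
  · rw [show 2 * (k + 1) = 2 * k + 2 by ring, t_even, show t 1 = p 0 from t_odd 0]
    exact h.last_col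

theorem mem_stairSets_of_mem_perfectSets {m n : ℕ} {c : Vertex m n → NNRat}
    {L : Finset (Vertex m n)} (h : L ∈ perfectSets m n c) : L ∈ stairSets m n c := by
  obtain ⟨k, q, t, hq, ht, rfl⟩ := h
  obtain ⟨k, rfl⟩ : ∃ l, k = l + 1 := ⟨k - 1, by have := hq.two_le; omega⟩
  exact ⟨k, _, _, isFullStair_of_corresponds hq ht.1, image_Icc_pairs t⟩

theorem mem_perfectSets_of_isCheapest {m n : ℕ} {c : Vertex m n → NNRat}
    {L : Finset (Vertex m n)} (h : IsCheapest c (stairSets m n c) L) : L ∈ perfectSets m n c := by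
  obtain ⟨⟨k, p, r, hs, rfl⟩, hmin⟩ := h
  obtain ⟨q, t, hq, ht, h₁, h₂⟩ := exists_corresponds_of_isFullStair hs
  refine ⟨k + 1, q, t, hq, ⟨ht, fun t' ht' => ?_⟩, ?_⟩
  · have hs' := isFullStair_of_corresponds hq ht'
    have := hmin _ ⟨k, _, _, hs', rfl⟩
    rw [cost, cost, hs.sum_stairVertices, hs'.sum_stairVertices] at this
    rw [sum_Icc_pairs, sum_Icc_pairs]
    simpa only [h₁, h₂] using this
  · rw [image_Icc_pairs]
    simp only [h₁, h₂]

theorem isLandmarkSet_zigzagSets {m n : ℕ} (hm : 2 ≤ m) (hn : 2 ≤ n) (c : Vertex m n → NNRat) :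
    ∀ L ∈ zigzagSets m n c, IsLandmarkSet (grid m n) L ∧ 4 ≤ L.card :=
  Family.isLandmarkSet_of_mem_orientations (P := (4 ≤ ·))
    (fun m n hm hn c L hL =>
      isLandmarkSet_stairSets m n hm hn c L (mem_stairSets_of_mem_perfectSets hL)) hm hn c

/-! ### Every landmark set contains a pair, a triple or a stair -/

theorem IsStair.extend {m n k : ℕ} {p r : ℕ → Vertex m n} (h : IsStair k p r) {a b : Vertex m n}
    (hba : (b.2 : ℕ) ≤ a.2) (hb : ((r k).1 : ℕ) < b.1) (ha : (a.1 : ℕ) ≤ (r k).1)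
    (ha' : ((p k).2 : ℕ) < a.2) :
    IsStair (k + 1) (Function.update p (k + 1) a) (Function.update r (k + 1) b) := by
  have hp : ∀ j ≤ k, Function.update p (k + 1) a j = p j := fun j hj =>
    Function.update_of_ne (by omega) _ _
  have hr : ∀ j ≤ k, Function.update r (k + 1) b j = r j := fun j hj =>
    Function.update_of_ne (by omega) _ _
  refine ⟨?_, ?_, fun j hj => ?_, fun j hj => ?_, fun j hj => ?_, fun j hj => ?_⟩
  · rw [hp 0 (by omega), h.first_row]
  · rw [hr 0 (by omega)]
    exact h.pos
  · rcases hj.lt_or_eq with hj | rfl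
    · rw [hp j (by omega), hr j (by omega)]
      exact h.left j (by omega)
    · simpa using hba
  · rcases (Nat.lt_succ_iff.1 hj).lt_or_eq with hj | rfl
    · rw [hr j (by omega), hr (j + 1) (by omega)]
      exact h.down j (by omega)
    · rw [hr j (by omega)]
      simpa using hb
  · rcases (Nat.lt_succ_iff.1 hj).lt_or_eq with hj | rfl
    · rw [hp (j + 1) (by omega), hr j (by omega)]
      exact h.up j (by omega)
    · rw [hr j (by omega)]
      simpa using ha
  · rcases (Nat.lt_succ_iff.1 hj).lt_or_eq with hj | rfl
    · rw [hp (j + 1) (by omega), hp j (by omega)]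
      exact h.right j (by omega)
    · rw [hp j (by omega)]
      simpa using ha'

theorem IsStair.replace_last {m n k : ℕ} {p r : ℕ → Vertex m n} (h : IsStair k p r)
    {b : Vertex m n} (hb : (b.2 : ℕ) ≤ (p k).2) (hb' : ((r k).1 : ℕ) < b.1) :
    IsStair k p (Function.update r k b) := by
  have hr : ∀ j < k, Function.update r k b j = r j := fun j hj =>
    Function.update_of_ne (by omega) _ _
  refine ⟨h.first_row, ?_, fun j hj => ?_, fun j hj => ?_, fun j hj => ?_, h.right⟩
  · rcases Nat.eq_zero_or_pos k with rfl | hk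
    · simpa using (Nat.zero_le _).trans_lt hb'
    · rw [hr 0 hk]
      exact h.pos
  · rcases hj.lt_or_eq with hj | rfl
    · rw [hr j hj]
      exact h.left j (by omega)
    · simpa using hb
  · rw [hr j hj]
    rcases Nat.lt_or_ge (j + 1) k with hj' | hj'
    · rw [hr (j + 1) hj']
      exact h.down j hj
    · obtain rfl : j + 1 = k := by omega
      simpa using (h.down j hj).trans hb'
  · rw [hr j hj]
    exact h.up j hj

theorem stairVertices_subset {m n k : ℕ} {p r : ℕ → Vertex m n} {L : Finset (Vertex m n)}
    (hp : ∀ j ≤ k, p j ∈ L) (hr : ∀ j ≤ k, r j ∈ L) : stairVertices k p r ⊆ L := by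
  intro x hx
  obtain ⟨j, hj, rfl | rfl⟩ := mem_stairVertices.1 hx
  exacts [hp j hj, hr j hj]

/-- A stair that stops above the last row is not maximal: the cross at its lower right end is met
in the upper right quadrant, which allows a new column, or in the lower left one, which allows a
lower row. If the last column is reached, a vertex of the last row ends the stair. -/
theorem exists_isFullStair {m n : ℕ} (hm : 2 ≤ m) {L : Finset (Vertex m n)}
    (hL : HitsAnti L) {a b : Vertex m n} (ha : a ∈ L) (ha₀ : (a.1 : ℕ) = 0)
    (hamax : ∀ x ∈ L, (x.1 : ℕ) = 0 → (x.2 : ℕ) ≤ a.2) (hb : b ∈ L)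
    (hlast : ∀ x ∈ L, (x.1 : ℕ) + 1 = m → (a.2 : ℕ) < x.2) (hb₀ : (b.1 : ℕ) + 1 = m) :
    ∃ S ⊆ L, ∃ k p r, IsFullStair (m := m) (n := n) k p r ∧ S = stairVertices k p r := by
  suffices key : ∀ N k p r, IsStair (m := m) (n := n) k p r → p 0 = a → (∀ j ≤ k, p j ∈ L) →
      (∀ j ≤ k, r j ∈ L) → m - (r k).1 = N →
      ∃ k p r, IsFullStair (m := m) (n := n) k p r ∧ (∀ j ≤ k, p j ∈ L) ∧ ∀ j ≤ k, r j ∈ L by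
    have hab := hlast b hb hb₀
    obtain ⟨x, hx, hq⟩ := hL 0 a.2 (by omega) (by have := b.2.2; omega)
    obtain ⟨k, p, r, h, hp, hr⟩ := key _ 0 (fun _ => a) (fun _ => x)
      ⟨ha₀, by have := hamax x hx; omega, fun _ _ => by have := hamax x hx; omega,
        fun _ hj => by omega, fun _ hj => by omega, fun _ hj => by omega⟩ rfl
      (fun _ _ => ha) (fun _ _ => hx) rfl
    exact ⟨_, stairVertices_subset hp hr, k, p, r, h, rfl⟩
  intro N
  induction N using Nat.strong_induction_on with
  | _ N ih =>
    rintro k p r h h₀ hp hr rfl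
    have hrow := (r k).1.2
    by_cases hend : ((r k).1 : ℕ) + 1 = m
    · exact ⟨k, p, r, ⟨h, hend, by rw [h₀]; exact hlast _ (hr k le_rfl) hend⟩, hp, hr⟩
    have replace : ∀ x ∈ L, (x.2 : ℕ) ≤ (p k).2 → ((r k).1 : ℕ) < x.1 →
        ∃ k p r, IsFullStair (m := m) (n := n) k p r ∧ (∀ j ≤ k, p j ∈ L) ∧ ∀ j ≤ k, r j ∈ L := by
      intro x hx hx₂ hx₁
      refine ih (m - x.1) (by omega) k p _ (h.replace_last hx₂ hx₁) h₀ hp (fun j hj => ?_)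
        (by simp)
      rcases hj.lt_or_eq with hj | rfl
      · rw [Function.update_of_ne (by omega)]
        exact hr j hj.le
      · simpa using hx
    have extend : ∀ x ∈ L, ∀ y ∈ L, (y.2 : ℕ) ≤ x.2 → ((r k).1 : ℕ) < y.1 →
        (x.1 : ℕ) ≤ (r k).1 → ((p k).2 : ℕ) < x.2 →
        ∃ k p r, IsFullStair (m := m) (n := n) k p r ∧ (∀ j ≤ k, p j ∈ L) ∧ ∀ j ≤ k, r j ∈ L := by
      intro x hx y hy h₁ h₂ h₃ h₄
      refine ih (m - y.1) (by omega) (k + 1) _ _ (h.extend h₁ h₂ h₃ h₄) ?_ (fun j hj => ?_)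
        (fun j hj => ?_) (by simp)
      · rw [Function.update_of_ne (by omega), h₀]
      · rcases hj.lt_or_eq with hj | rfl
        · rw [Function.update_of_ne (by omega)]
          exact hp j (by omega)
        · simpa using hx
      · rcases hj.lt_or_eq with hj | rfl
        · rw [Function.update_of_ne (by omega)]
          exact hr j (by omega)
        · simpa using hy
    have hcol := (p k).2.2
    rcases Nat.lt_or_ge ((p k).2 + 1) n with hd | hd
    · obtain ⟨x, hx, hq⟩ := hL (r k).1 (p k).2 (by omega) hd
      rcases hq with ⟨hx₁, hx₂⟩ | ⟨hx₁, hx₂⟩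
      · -- The rightmost vertex among those that are not below the end of the stair.
        obtain ⟨y, hy, hymax⟩ := Finset.exists_max_image
          (L.filter fun y => (y.1 : ℕ) ≤ (r k).1) (fun y => (y.2 : ℕ))
          ⟨x, Finset.mem_filter.2 ⟨hx, hx₁⟩⟩
        rw [Finset.mem_filter] at hy
        have hxy := hymax x (Finset.mem_filter.2 ⟨hx, hx₁⟩)
        have hyn := y.2.2
        rcases Nat.lt_or_ge (y.2 + 1) n with hy' | hy'
        · obtain ⟨z, hz, hq⟩ := hL (r k).1 y.2 (by omega) hy'
          have hz' : (z.1 : ℕ) ≤ (r k).1 → (z.2 : ℕ) ≤ y.2 := fun h =>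
            hymax z (Finset.mem_filter.2 ⟨hz, h⟩)
          exact extend y hy.1 z hz (by omega) (by omega) hy.2 (by omega)
        · exact extend y hy.1 b hb (by have := b.2.2; omega) (by omega) hy.2 (by omega)
      · exact replace x hx hx₂ hx₁
    · exact replace b hb (by have := b.2.2; omega) (by omega)

/-- The pairs, triples and stairs in which the first and the last row play a special
role, up to reflections. -/
def IsBasic {m n : ℕ} (S : Finset (Vertex m n)) : Prop :=
  S ∈ adjacentCornerPairs m n ∨ S ∈ sameColumnTriples m n 0 ∨
    (∃ r f, S.map (flip m n r f).toEmbedding ∈ betweenTriples m n 0) ∨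
    ∃ r f, S.map (flip m n r f).toEmbedding ∈ stairSets m n 0

/-- A column with vertices of `L` in both the first and the last row gives a pair or a triple.
Otherwise, either the columns of these vertices interlace, which gives a triple, or those in one of
the two rows are all to the left of those in the other one, and a stair joins them. -/
theorem exists_isBasic {m n : ℕ} (hm : 2 ≤ m) (hn : 2 ≤ n) {L : Finset (Vertex m n)}
    (hL : IsLandmarkSet (grid m n) L) {a b : Vertex m n} (ha : a ∈ L) (ha₀ : (a.1 : ℕ) = 0)
    (hb : b ∈ L) (hb₀ : (b.1 : ℕ) + 1 = m) : ∃ S ⊆ L, IsBasic S := by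
  obtain ⟨-, hA, hline⟩ := (isLandmarkSet_iff hm hn L).1 hL
  by_cases hcommon : ∃ x ∈ L, ∃ y ∈ L, (x.1 : ℕ) = 0 ∧ (y.1 : ℕ) + 1 = m ∧ (x.2 : ℕ) = y.2
  · obtain ⟨x, hx, y, hy, hx₀, hy₀, hxy⟩ := hcommon
    by_cases hz : 0 < (x.2 : ℕ) ∧ (x.2 : ℕ) + 1 < n
    · obtain ⟨w, hw, hwx⟩ := hline.col x.2 hz.1 hz.2
      refine ⟨{x, y, w}, by simp [Finset.insert_subset_iff, hx, hy, hw], .inr (.inl ?_)⟩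
      exact ⟨x, y, w, hx₀, hy₀, Fin.ext hxy, hz.1, hz.2, fun h => hwx (congrArg _ h), rfl⟩
    · refine ⟨{x, y}, by simp [Finset.insert_subset_iff, hx, hy], .inl ?_⟩
      have := x.2.2
      exact ⟨x, y, ⟨by omega, by omega⟩, ⟨by omega, by omega⟩, by rintro rfl; omega,
        .inr (Fin.ext hxy), rfl⟩
  push Not at hcommon
  have hTne : (L.filter fun x => (x.1 : ℕ) = 0).Nonempty := ⟨a, Finset.mem_filter.2 ⟨ha, ha₀⟩⟩
  have hBne : (L.filter fun x => (x.1 : ℕ) + 1 = m).Nonempty :=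
    ⟨b, Finset.mem_filter.2 ⟨hb, hb₀⟩⟩
  -- The rightmost and the leftmost vertices of `L` in the first row, and in the last row.
  obtain ⟨t, ht, htmax⟩ := Finset.exists_max_image _ (fun x => (x.2 : ℕ)) hTne
  obtain ⟨t', ht', htmin⟩ := Finset.exists_min_image _ (fun x => (x.2 : ℕ)) hTne
  obtain ⟨s, hs, hsmax⟩ := Finset.exists_max_image _ (fun x => (x.2 : ℕ)) hBne
  obtain ⟨s', hs', hsmin⟩ := Finset.exists_min_image _ (fun x => (x.2 : ℕ)) hBne
  simp only [Finset.mem_filter, and_imp] at ht ht' hs hs' htmax htmin hsmax hsmin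
  by_cases h₁ : (t.2 : ℕ) < s'.2
  · obtain ⟨S, hS, h⟩ := exists_isFullStair hm hA ht.1 ht.2 htmax hs'.1
      (fun x hx hx' => h₁.trans_le (hsmin x hx hx')) hs'.2
    refine ⟨S, hS, .inr (.inr (.inr ⟨false, false, ?_⟩))⟩
    rw [map_flip_false]
    exact h
  by_cases h₂ : (s.2 : ℕ) < t'.2
  · let e := flip m n false true
    have hLe : IsLandmarkSet (grid m n) (L.map e.toEmbedding) :=
      (isLandmarkSet_map e (dist_flip m n false true) L).2 hL
    have hmem : ∀ x, x ∈ L.map e.toEmbedding ↔ e x ∈ L := by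
      intro x
      rw [Finset.mem_map_equiv, flip_symm]
    have hrow : ∀ x, ((e x).1 : ℕ) = x.1 := fun x => rfl
    have hcol : ∀ x, ((e x).2 : ℕ) = n - (x.2 + 1) := fun x => Fin.val_rev _
    obtain ⟨-, hA', -⟩ := (isLandmarkSet_iff hm hn _).1 hLe
    have hinv : ∀ x, e (e x) = x := flip_flip m n false true
    obtain ⟨S, hS, h⟩ := exists_isFullStair (a := e t') (b := e s) hm hA'
      (by rw [hmem, hinv]; exact ht'.1) ht'.2
      (fun x hx hx₀ => by
        have := htmin _ ((hmem x).1 hx) hx₀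
        rw [hcol] at this ⊢
        have := x.2.2
        omega)
      (by rw [hmem, hinv]; exact hs.1)
      (fun x hx hx₀ => by
        have := hsmax _ ((hmem x).1 hx) hx₀
        rw [hcol] at this ⊢
        have := x.2.2
        omega) hs.2
    refine ⟨S.map e.symm.toEmbedding, fun x hx => ?_, .inr (.inr (.inr ⟨false, true, ?_⟩))⟩
    · rw [Finset.mem_map_equiv, Equiv.symm_symm] at hx
      have := (hmem _).1 (hS hx)
      rwa [hinv] at this
    · have hS' : (S.map e.symm.toEmbedding).map e.toEmbedding = S := by
        ext x
        simp only [Finset.mem_map_equiv, Equiv.symm_symm, Equiv.apply_symm_apply]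
      rw [show flip m n false true = e from rfl, hS']
      exact h
  have h₃ := hcommon t ht.1 s' hs'.1 ht.2 hs'.2
  have h₄ := hcommon t' ht'.1 s hs.1 ht'.2 hs.2
  by_cases h₅ : (t'.2 : ℕ) < s'.2
  · refine ⟨{t', s', t}, by simp [Finset.insert_subset_iff, *], .inr (.inr (.inl
      ⟨false, false, t', s', t, ht'.2, hs'.2, ht.2, h₅, by rw [Fin.lt_def]; omega, ?_⟩))⟩
    ext x
    simp [flip]
  · have h₆ := hcommon t' ht'.1 s' hs'.1 ht'.2 hs'.2
    refine ⟨{s', t', s}, by simp [Finset.insert_subset_iff, *], .inr (.inr (.inl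
      ⟨true, false, flip m n true false s', flip m n true false t', flip m n true false s,
        ?_, ?_, ?_, ?_, ?_, ?_⟩))⟩
    · simp only [flip_apply, cond_true, Fin.val_rev]
      omega
    · simp only [flip_apply, cond_true, Fin.val_rev]
      omega
    · simp only [flip_apply, cond_true, Fin.val_rev]
      omega
    · simp only [flip_apply, cond_false, Fin.lt_def]
      omega
    · simp only [flip_apply, cond_false, Fin.lt_def]
      omega
    · simp [Finset.map_insert]

theorem IsBasic.mem_families {m n : ℕ} {S : Finset (Vertex m n)} (h : IsBasic S)
    (c : Vertex m n → NNRat) :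
    S ∈ adjacentCornerPairs m n ∨ S ∈ triples m n c ∨ S ∈ stairSets.orientations m n c := by
  rcases h with h | h | ⟨r, f, h⟩ | ⟨r, f, h⟩
  · exact .inl h
  · refine .inr (.inl (.inl ⟨false, false, .inl ?_⟩))
    rw [map_flip_false]
    exact h
  · exact .inr (.inl (.inr ⟨r, f, .inl h⟩))
  · exact .inr (.inr ⟨r, f, .inl h⟩)

theorem swap_mem_orientations {F : Family} {m n : ℕ} {c : Vertex m n → NNRat}
    {S : Finset (Vertex n m)} {r f : Bool} (hF : ∀ m n c c', F m n c = F m n c')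
    (h : S.map (flip n m r f).toEmbedding ∈ F n m 0) :
    S.map (Equiv.prodComm _ _).toEmbedding ∈ F.orientations m n c := by
  refine ⟨f, r, .inr ?_⟩
  rw [hF n m _ 0]
  convert h using 1
  ext x
  simp only [Finset.mem_map_equiv, Equiv.symm_trans_apply, flip_symm, Equiv.prodComm_symm,
    Equiv.prodComm_apply, flip_apply, Prod.fst_swap, Prod.snd_swap, Prod.swap_prod_mk]

theorem exists_subset_mem_families {m n : ℕ} (hm : 2 ≤ m) (hn : 2 ≤ n) (c : Vertex m n → NNRat)
    {L : Finset (Vertex m n)} (hL : IsLandmarkSet (grid m n) L) :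
    ∃ S ⊆ L, S ∈ adjacentCornerPairs m n ∨ S ∈ triples m n c ∨
      S ∈ stairSets.orientations m n c := by
  obtain ⟨hM, hA, -⟩ := (isLandmarkSet_iff hm hn L).1 hL
  by_cases hrow : (∃ a ∈ L, (a.1 : ℕ) = 0) ∧ ∃ b ∈ L, (b.1 : ℕ) + 1 = m
  · obtain ⟨⟨a, ha, ha₀⟩, b, hb, hb₀⟩ := hrow
    obtain ⟨S, hS, h⟩ := exists_isBasic hm hn hL ha ha₀ hb hb₀
    exact ⟨S, hS, h.mem_families c⟩
  -- The crosses at two opposite corners show that, if `L` does not meet both the first and the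
  -- last row, then it meets the first and the last column.
  obtain ⟨⟨a, ha, ha₀⟩, b, hb, hb₀⟩ : (∃ a ∈ L, (a.2 : ℕ) = 0) ∧ ∃ b ∈ L, (b.2 : ℕ) + 1 = n := by
    obtain ⟨x, hx, hx'⟩ := hA 0 0 (by omega) (by omega)
    obtain ⟨y, hy, hy'⟩ := hA (m - 2) (n - 2) (by omega) (by omega)
    obtain ⟨z, hz, hz'⟩ := hM (m - 2) 0 (by omega) (by omega)
    obtain ⟨w, hw, hw'⟩ := hM 0 (n - 2) (by omega) (by omega)
    have := x.1.2
    have := x.2.2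
    have := y.1.2
    have := y.2.2
    have := z.1.2
    have := z.2.2
    have := w.1.2
    have := w.2.2
    by_cases h₀ : ∃ a ∈ L, (a.1 : ℕ) = 0
    · have h₁ : ¬ ∃ b ∈ L, (b.1 : ℕ) + 1 = m := fun h₁ => hrow ⟨h₀, h₁⟩
      push Not at h₁
      have := h₁ y hy
      have := h₁ z hz
      exact ⟨⟨z, hz, by omega⟩, y, hy, by omega⟩
    · push Not at h₀
      have := h₀ x hx
      have := h₀ w hw
      exact ⟨⟨x, hx, by omega⟩, w, hw, by omega⟩
  let e := Equiv.prodComm (Fin m) (Fin n)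
  have hLe := (isLandmarkSet_map e (dist_prodComm m n) L).2 hL
  obtain ⟨S, hS, h⟩ := exists_isBasic (a := e a) (b := e b) hn hm hLe (by simpa using ha) ha₀
    (by simpa using hb) hb₀
  refine ⟨S.map (Equiv.prodComm _ _).toEmbedding, fun x hx => ?_, ?_⟩
  · rw [Finset.mem_map_equiv] at hx
    have := hS hx
    rw [Finset.mem_map_equiv] at this
    simpa [e] using this
  · rcases h with ⟨u, v, hu, hv, huv, hline, rfl⟩ | h | ⟨r, f, h⟩ | ⟨r, f, h⟩
    · refine .inl ⟨u.swap, v.swap, ⟨hu.2, hu.1⟩, ⟨hv.2, hv.1⟩, ?_, hline.symm, ?_⟩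
      · simpa using huv
      · simp [Finset.map_insert]
    · refine .inr (.inl (.inl (swap_mem_orientations (r := false) (f := false)
        (fun _ _ _ _ => rfl) ?_)))
      rw [map_flip_false]
      exact h
    · exact .inr (.inl (.inr (swap_mem_orientations (fun _ _ _ _ => rfl) h)))
    · exact .inr (.inr (swap_mem_orientations (fun _ _ _ _ => rfl) h))

/-! ### Renaming registers and reorienting the input of a program -/

/-- A way to embed a program into another one: `name` renames registers and arrays, and the
program sees the grid with reflected rows, with reflected columns, and with rows and columns
exchanged, according to the three Boolean values. -/
structure View where
  name : ℕ → ℕ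
  r : Bool
  f : Bool
  s : Bool

/-- The index `i`, or its mirror image among `0, …, M - 1`. -/
def reflect (b : Bool) (M i : ℕ) : ℕ := bif b then M - 1 - i else i

namespace View

/-- The coordinates in the original grid of the vertex with the coordinates `a` in the view. -/
def place (v : View) (I : Input) (a : ℕ × ℕ) : ℕ × ℕ :=
  (reflect v.r I.rows (bif v.s then a.2 else a.1), reflect v.f I.cols (bif v.s then a.1 else a.2))

/-- The input as it is seen in the view. -/
def input (v : View) (I : Input) : Input where
  rows := bif v.s then I.cols else I.rows
  cols := bif v.s then I.rows else I.cols
  entry i j := I.entry (v.place I (i, j)).1 (v.place I (i, j)).2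

/-- The expression for `reflect`. -/
def reflectExp (b : Bool) (M e : IExp) : IExp := bif b then .sub (.sub M (.lit 1)) e else e

/-- The expression for the row of `View.place`. -/
def rowExp (v : View) (i j : IExp) : IExp := reflectExp v.r .rows (bif v.s then j else i)

/-- The expression for the column of `View.place`. -/
def colExp (v : View) (i j : IExp) : IExp := reflectExp v.f .cols (bif v.s then i else j)

/-- Translation of index expressions. -/
def iexp (v : View) : IExp → IExp
  | .lit a => .lit a
  | .rows => bif v.s then .cols else .rows
  | .cols => bif v.s then .rows else .cols
  | .reg x => .reg (v.name x)
  | .arr A i j => .arr (v.name A) (v.iexp i) (v.iexp j)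
  | .add a b => .add (v.iexp a) (v.iexp b)
  | .sub a b => .sub (v.iexp a) (v.iexp b)

/-- Translation of cost expressions. -/
def cexp (v : View) : CExp → CExp
  | .zero => .zero
  | .infty => .infty
  | .input i j => .input (v.rowExp (v.iexp i) (v.iexp j)) (v.colExp (v.iexp i) (v.iexp j))
  | .reg x => .reg (v.name x)
  | .arr A i j => .arr (v.name A) (v.iexp i) (v.iexp j)
  | .add a b => .add (v.cexp a) (v.cexp b)

/-- Translation of tests. -/
def test (v : View) : Test → Test
  | .ile a b => .ile (v.iexp a) (v.iexp b)
  | .cle a b => .cle (v.cexp a) (v.cexp b)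
  | .not p => .not (v.test p)
  | .and p q => .and (v.test p) (v.test q)

/-- Translation of programs. -/
def prog (v : View) : Program → Program
  | .skip => .skip
  | .setI x e => .setI (v.name x) (v.iexp e)
  | .putI A i j e => .putI (v.name A) (v.iexp i) (v.iexp j) (v.iexp e)
  | .setC x e => .setC (v.name x) (v.cexp e)
  | .putC A i j e => .putC (v.name A) (v.iexp i) (v.iexp j) (v.cexp e)
  | .emit i j => .emit (v.rowExp (v.iexp i) (v.iexp j)) (v.colExp (v.iexp i) (v.iexp j))
  | .seq P Q => .seq (v.prog P) (v.prog Q)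
  | .ite p P Q => .ite (v.test p) (v.prog P) (v.prog Q)
  | .while p P => .while (v.test p) (v.prog P)

/-- The state `τ` of the translated program represents the state `σ` of the program, where `o`
is the output of other programs before its start. -/
structure Sim (v : View) (I : Input) (o : List (ℕ × ℕ)) (σ τ : State) : Prop where
  ireg : ∀ x, τ.ireg (v.name x) = σ.ireg x
  iarr : ∀ A i j, τ.iarr (v.name A) i j = σ.iarr A i j
  creg : ∀ x, τ.creg (v.name x) = σ.creg x
  carr : ∀ A i j, τ.carr (v.name A) i j = σ.carr A i j
  out : τ.out = o ++ σ.out.map (v.place I)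

/-- Registers and arrays that do not belong to the view are equal in `τ` and `τ'`. -/
structure Frame (v : View) (τ τ' : State) : Prop where
  ireg : ∀ y, (∀ x, v.name x ≠ y) → τ'.ireg y = τ.ireg y
  iarr : ∀ B i j, (∀ x, v.name x ≠ B) → τ'.iarr B i j = τ.iarr B i j
  creg : ∀ y, (∀ x, v.name x ≠ y) → τ'.creg y = τ.creg y
  carr : ∀ B i j, (∀ x, v.name x ≠ B) → τ'.carr B i j = τ.carr B i j

theorem Frame.refl (v : View) (τ : State) : v.Frame τ τ :=
  ⟨fun _ _ => rfl, fun _ _ _ _ => rfl, fun _ _ => rfl, fun _ _ _ _ => rfl⟩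

theorem Frame.trans {v : View} {τ τ' τ'' : State} (h : v.Frame τ τ') (h' : v.Frame τ' τ'') :
    v.Frame τ τ'' :=
  ⟨fun y hy => (h'.ireg y hy).trans (h.ireg y hy),
    fun B i j hB => (h'.iarr B i j hB).trans (h.iarr B i j hB),
    fun y hy => (h'.creg y hy).trans (h.creg y hy),
    fun B i j hB => (h'.carr B i j hB).trans (h.carr B i j hB)⟩

variable {v : View} {I : Input} {o : List (ℕ × ℕ)} {σ τ : State}

theorem eval_rowExp (i j : IExp) :
    (v.rowExp i j).eval I τ = (v.place I (i.eval I τ, j.eval I τ)).1 := by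
  simp only [rowExp, reflectExp, place, reflect]
  cases v.r <;> cases v.s <;> rfl

theorem eval_colExp (i j : IExp) :
    (v.colExp i j).eval I τ = (v.place I (i.eval I τ, j.eval I τ)).2 := by
  simp only [colExp, reflectExp, place, reflect]
  cases v.f <;> cases v.s <;> rfl

theorem Sim.eval_iexp (h : v.Sim I o σ τ) (e : IExp) :
    (v.iexp e).eval I τ = e.eval (v.input I) σ := by
  induction e with
  | lit a => rfl
  | rows =>
    simp only [iexp, IExp.eval, input]
    cases v.s <;> rfl
  | cols =>
    simp only [iexp, IExp.eval, input]
    cases v.s <;> rfl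
  | reg x => exact h.ireg x
  | arr A i j hi hj => simp only [iexp, IExp.eval, h.iarr, hi, hj]
  | add a b ha hb => simp only [iexp, IExp.eval, ha, hb]
  | sub a b ha hb => simp only [iexp, IExp.eval, ha, hb]

theorem Sim.eval_cexp (h : v.Sim I o σ τ) (e : CExp) :
    (v.cexp e).eval I τ = e.eval (v.input I) σ := by
  induction e with
  | zero => rfl
  | infty => rfl
  | input i j => simp only [cexp, CExp.eval, eval_rowExp, eval_colExp, h.eval_iexp, input]
  | reg x => exact h.creg x
  | arr A i j => simp only [cexp, CExp.eval, h.carr, h.eval_iexp]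
  | add a b ha hb => simp only [cexp, CExp.eval, ha, hb]

theorem Sim.holds_test (h : v.Sim I o σ τ) (p : Test) :
    (v.test p).Holds I τ ↔ p.Holds (v.input I) σ := by
  induction p with
  | ile a b => simp only [test, Test.Holds, h.eval_iexp]
  | cle a b => simp only [test, Test.Holds, h.eval_cexp]
  | not p hp => simp only [test, Test.Holds, hp]
  | and p q hp hq => simp only [test, Test.Holds, hp, hq]

/-- The translated program simulates the program on the input that is seen in the view, in the
same number of steps, and leaves all other registers and arrays alone. -/
theorem exec_prog (hv : Function.Injective v.name) {P : Program} {t : ℕ} {σ' : State}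
    (h : Exec (v.input I) P σ t σ') (o : List (ℕ × ℕ)) (τ : State) (hs : v.Sim I o σ τ) :
    ∃ τ', Exec I (v.prog P) τ t τ' ∧ v.Sim I o σ' τ' ∧ v.Frame τ τ' := by
  induction h generalizing τ with
  | skip σ => exact ⟨τ, .skip τ, hs, .refl v τ⟩
  | setI x e σ =>
    refine ⟨_, .setI _ _ τ, ⟨fun y => ?_, hs.iarr, hs.creg, hs.carr, hs.out⟩,
      ⟨fun y hy => Function.update_of_ne (hy x).symm _ _, fun _ _ _ _ => rfl, fun _ _ => rfl,
        fun _ _ _ _ => rfl⟩⟩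
    simp only [Function.update_apply, hv.eq_iff, hs.ireg, hs.eval_iexp]
  | putI A i j e σ =>
    refine ⟨_, .putI _ _ _ _ τ, ⟨hs.ireg, fun B k l => ?_, hs.creg, hs.carr, hs.out⟩,
      ⟨fun _ _ => rfl, fun B k l hB => ?_, fun _ _ => rfl, fun _ _ _ _ => rfl⟩⟩
    · simp only [writeEntry, hv.eq_iff, hs.iarr, hs.eval_iexp]
    · simp only [writeEntry, (hB A).symm, false_and, if_false]
  | setC x e σ =>
    refine ⟨_, .setC _ _ τ, ⟨hs.ireg, hs.iarr, fun y => ?_, hs.carr, hs.out⟩,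
      ⟨fun _ _ => rfl, fun _ _ _ _ => rfl, fun y hy => Function.update_of_ne (hy x).symm _ _,
        fun _ _ _ _ => rfl⟩⟩
    simp only [Function.update_apply, hv.eq_iff, hs.creg, hs.eval_cexp]
  | putC A i j e σ =>
    refine ⟨_, .putC _ _ _ _ τ, ⟨hs.ireg, hs.iarr, hs.creg, fun B k l => ?_, hs.out⟩,
      ⟨fun _ _ => rfl, fun _ _ _ _ => rfl, fun _ _ => rfl, fun B k l hB => ?_⟩⟩
    · simp only [writeEntry, hv.eq_iff, hs.carr, hs.eval_iexp, hs.eval_cexp]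
    · simp only [writeEntry, (hB A).symm, false_and, if_false]
  | emit i j σ =>
    refine ⟨_, .emit _ _ τ, ⟨hs.ireg, hs.iarr, hs.creg, hs.carr, ?_⟩,
      ⟨fun _ _ => rfl, fun _ _ _ _ => rfl, fun _ _ => rfl, fun _ _ _ _ => rfl⟩⟩
    simp only [hs.out, eval_rowExp, eval_colExp, hs.eval_iexp, List.map_append, List.map_cons,
      List.map_nil, List.append_assoc, Prod.mk.eta]
  | seq _ _ ih ih' =>
    obtain ⟨τ', h₁, hs₁, hf₁⟩ := ih τ hs
    obtain ⟨τ'', h₂, hs₂, hf₂⟩ := ih' τ' hs₁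
    exact ⟨τ'', .seq h₁ h₂, hs₂, hf₁.trans hf₂⟩
  | ite_true hp _ ih =>
    obtain ⟨τ', h₁, hs₁, hf₁⟩ := ih τ hs
    exact ⟨τ', .ite_true ((hs.holds_test _).2 hp) h₁, hs₁, hf₁⟩
  | ite_false hp _ ih =>
    obtain ⟨τ', h₁, hs₁, hf₁⟩ := ih τ hs
    exact ⟨τ', .ite_false (mt (hs.holds_test _).1 hp) h₁, hs₁, hf₁⟩
  | while_true hp _ _ ih ih' =>
    obtain ⟨τ', h₁, hs₁, hf₁⟩ := ih τ hs
    obtain ⟨τ'', h₂, hs₂, hf₂⟩ := ih' τ' hs₁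
    exact ⟨τ'', .while_true ((hs.holds_test _).2 hp) h₁ h₂, hs₂, hf₁.trans hf₂⟩
  | while_false hp => exact ⟨τ, .while_false (mt (hs.holds_test _).1 hp), hs, .refl v τ⟩

theorem Sim.of_frame {v' : View} {τ' : State}
    (hs : v.Sim I o σ τ) (hf : v'.Frame τ τ') (ho : τ'.out = τ.out)
    (hne : ∀ x y, v'.name y ≠ v.name x) : v.Sim I o σ τ' :=
  ⟨fun x => (hf.ireg _ (hne x)).trans (hs.ireg x),
    fun A i j => (hf.iarr _ i j (hne A)).trans (hs.iarr A i j),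
    fun x => (hf.creg _ (hne x)).trans (hs.creg x),
    fun A i j => (hf.carr _ i j (hne A)).trans (hs.carr A i j), ho.trans hs.out⟩

theorem Sim.setC (hs : v.Sim I o σ τ) {x : ℕ} (hx : ∀ y, v.name y ≠ x) (w : WithTop NNRat) :
    v.Sim I o σ { τ with creg := Function.update τ.creg x w } :=
  ⟨hs.ireg, hs.iarr, fun y => (Function.update_of_ne (hx y) _ _).trans (hs.creg y), hs.carr,
    hs.out⟩

end View

/-! ### Solvers -/

/-- A program in two parts: `find` computes the optimum in the cost register `0` (where `∞` means
that there is no feasible set) and `print`, started in the resulting state, writes an optimal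
set. In this way only the set that turns out to be the best of several candidates is printed. -/
structure Solver where
  find : Program
  print : Program

namespace Solver

/-- The program of a solver. -/
def program (a : Solver) : Program := .seq a.find a.print

/-- On the input `I`, the solver finds the optimum `w` and prints the list `o`, in at most `T`
steps. -/
def Yields (a : Solver) (I : Input) (T : ℕ) (w : WithTop NNRat) (o : List (ℕ × ℕ)) : Prop :=
  ∃ t t' σ σ', t + t' ≤ T ∧ Exec I a.find .init t σ ∧ σ.creg 0 = w ∧ σ.out = [] ∧
    Exec I a.print σ t' σ' ∧ σ'.out = o

/-- The solver in another orientation. -/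
def orient (a : Solver) (r f s : Bool) : Solver where
  find := (View.mk id r f s).prog a.find
  print := (View.mk id r f s).prog a.print

theorem Yields.orient {a : Solver} {I : Input} {T : ℕ} {w : WithTop NNRat} {o : List (ℕ × ℕ)}
    {r f s : Bool} (h : a.Yields ((View.mk id r f s).input I) T w o) :
    (a.orient r f s).Yields I T w (o.map ((View.mk id r f s).place I)) := by
  obtain ⟨t, t', σ, σ', hT, h₁, hw, ho, h₂, ho'⟩ := h
  obtain ⟨τ, hτ, hs, -⟩ := View.exec_prog Function.injective_id h₁ [] .init
    ⟨fun _ => rfl, fun _ _ _ => rfl, fun _ => rfl, fun _ _ _ => rfl, rfl⟩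
  obtain ⟨τ', hτ', hs', -⟩ := View.exec_prog Function.injective_id h₂ [] τ hs
  exact ⟨t, t', τ, τ', hT, hτ, (hs.creg 0).trans hw, by simpa [ho] using hs.out, hτ',
    by simpa [ho'] using hs'.out⟩

/-- The registers of the first solver in a selection. -/
def leftView : View := ⟨fun x => 3 * x + 1, false, false, false⟩

/-- The registers of the second solver in a selection. -/
def rightView : View := ⟨fun x => 3 * x + 2, false, false, false⟩

/-- Run two solvers, and print the better one of their results. -/
def select (a b : Solver) : Solver where
  find := .seq (leftView.prog a.find) <| .seq (rightView.prog b.find) <|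
    .ite (.cle (.reg 1) (.reg 2)) (.setC 0 (.reg 1)) (.setC 0 (.reg 2))
  print := .ite (.cle (.reg 1) (.reg 2)) (leftView.prog a.print) (rightView.prog b.print)

theorem leftView_input (I : Input) : leftView.input I = I := rfl

theorem rightView_input (I : Input) : rightView.input I = I := rfl

theorem leftView_injective : Function.Injective leftView.name := fun x y h => by
  simp only [leftView] at h
  omega

theorem rightView_injective : Function.Injective rightView.name := fun x y h => by
  simp only [rightView] at h
  omega

theorem leftView_ne_rightView (x y : ℕ) : leftView.name x ≠ rightView.name y := by
  simp only [leftView, rightView]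
  omega

theorem Yields.select {a b : Solver} {I : Input} {T T' : ℕ} {w w' : WithTop NNRat}
    {o o' : List (ℕ × ℕ)} (h : a.Yields I T w o) (h' : b.Yields I T' w' o') :
    (a.select b).Yields I (T + T' + 3) (min w w') (if w ≤ w' then o else o') := by
  obtain ⟨t₁, t₂, σ₁, σ₂, hT, h₁, hw, ho, h₂, ho₂⟩ := h
  obtain ⟨t₁', t₂', σ₁', σ₂', hT', h₁', hw', ho', h₂', ho₂'⟩ := h'
  obtain ⟨τ, hτ, hs, hf⟩ := View.exec_prog leftView_injective
    (by rw [leftView_input]; exact h₁) [] .init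
    ⟨fun _ => rfl, fun _ _ _ => rfl, fun _ => rfl, fun _ _ _ => rfl, rfl⟩
  have hτo : τ.out = [] := by simpa [ho] using hs.out
  have hstart : rightView.Sim I [] .init τ :=
    ⟨fun x => hf.ireg _ fun y => leftView_ne_rightView y x,
      fun x i j => hf.iarr _ i j fun y => leftView_ne_rightView y x,
      fun x => hf.creg _ fun y => leftView_ne_rightView y x,
      fun x i j => hf.carr _ i j fun y => leftView_ne_rightView y x, hτo⟩
  obtain ⟨τ', hτ', hs', hf'⟩ := View.exec_prog rightView_injective
    (by rw [rightView_input]; exact h₁') [] τ hstart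
  have hτo' : τ'.out = [] := by simpa [ho'] using hs'.out
  have hs₁ := View.Sim.of_frame hs hf' (hτo'.trans hτo.symm)
    fun x y => (leftView_ne_rightView x y).symm
  have hc₁ : τ'.creg 1 = w := (hs₁.creg 0).trans hw
  have hc₂ : τ'.creg 2 = w' := (hs'.creg 0).trans hw'
  have hl : ∀ y, leftView.name y ≠ 0 := fun y => by simp [leftView]
  have hr : ∀ y, rightView.name y ≠ 0 := fun y => by simp [rightView]
  by_cases hle : w ≤ w'
  · have htest : (Test.cle (.reg 1) (.reg 2)).Holds I τ' := by
      simpa only [Test.Holds, CExp.eval, hc₁, hc₂] using hle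
    have hsl := View.Sim.setC hs₁ hl w
    obtain ⟨ρ, hρ, hρs, -⟩ := View.exec_prog leftView_injective
      (by rw [leftView_input]; exact h₂) [] _ hsl
    have hset := Exec.setC (I := I) 0 (.reg 1) τ'
    rw [CExp.eval, hc₁] at hset
    refine ⟨_, _, _, ρ, ?_, .seq hτ (.seq hτ' (.ite_true htest hset)), ?_, hτo',
      .ite_true (by
        simpa [Test.Holds, CExp.eval, hc₁, hc₂] using hle) hρ, ?_⟩
    · omega
    · simp [hle]
    · rw [if_pos hle, hρs.out, ho₂]
      exact (List.map_congr_left fun x _ => rfl).trans (List.map_id _)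
  · have htest : ¬ (Test.cle (.reg 1) (.reg 2)).Holds I τ' := by
      simpa only [Test.Holds, CExp.eval, hc₁, hc₂] using hle
    have hsr := View.Sim.setC hs' hr w'
    obtain ⟨ρ, hρ, hρs, -⟩ := View.exec_prog rightView_injective
      (by rw [rightView_input]; exact h₂') [] _ hsr
    have hset := Exec.setC (I := I) 0 (.reg 2) τ'
    rw [CExp.eval, hc₂] at hset
    refine ⟨_, _, _, ρ, ?_, .seq hτ (.seq hτ' (.ite_false htest hset)), ?_, hτo',
      .ite_false (by
        simpa [Test.Holds, CExp.eval, hc₁, hc₂] using hle) hρ, ?_⟩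
    · omega
    · simp [(not_le.1 hle).le]
    · rw [if_neg hle, hρs.out, ho₂']
      exact (List.map_congr_left fun x _ => rfl).trans (List.map_id _)

end Solver

/-! ### Solvers for families of vertex sets -/

/-- The input `I` describes the grid with the costs `c`; its entries outside of the matrix are
arbitrary. -/
structure Describes (I : Input) (m n : ℕ) (c : Vertex m n → NNRat) : Prop where
  rows : I.rows = m
  cols : I.cols = n
  entry : ∀ v : Vertex m n, I.entry v.1 v.2 = (c v : NNRat)

theorem describes_ofGrid (m n : ℕ) (c : Vertex m n → NNRat) :
    Describes (Input.ofGrid m n c) m n c :=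
  ⟨rfl, rfl, fun v => by simp [Input.ofGrid]⟩

/-- The output `o` lists a member of minimum cost of `F`, whose cost is `w`, or it is empty, `F` has
no member, and `w = ∞`. -/
def FindsCost {m n : ℕ} (c : Vertex m n → NNRat) (F : Set (Finset (Vertex m n)))
    (w : WithTop NNRat) (o : List (ℕ × ℕ)) : Prop :=
  (∃ L, IsCheapest c F L ∧ Lists o L ∧ w = (cost c L : NNRat)) ∨ (F = ∅ ∧ o = [] ∧ w = ⊤)

theorem FindsCost.finds {m n : ℕ} {c : Vertex m n → NNRat} {F : Set (Finset (Vertex m n))}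
    {w : WithTop NNRat} {o : List (ℕ × ℕ)} (h : FindsCost c F w o) : Finds c F o := by
  rcases h with ⟨L, h₁, h₂, -⟩ | ⟨h₁, h₂, -⟩
  exacts [.inl ⟨L, h₁, h₂⟩, .inr ⟨h₁, h₂⟩]

theorem FindsCost.select {m n : ℕ} {c : Vertex m n → NNRat} {F G : Set (Finset (Vertex m n))}
    {w w' : WithTop NNRat} {o o' : List (ℕ × ℕ)} (h : FindsCost c F w o)
    (h' : FindsCost c G w' o') :
    FindsCost c (F ∪ G) (min w w') (if w ≤ w' then o else o') := by
  rcases h with ⟨L, ⟨hL, hmin⟩, ho, rfl⟩ | ⟨rfl, rfl, rfl⟩ <;>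
    rcases h' with ⟨L', ⟨hL', hmin'⟩, ho', rfl⟩ | ⟨rfl, rfl, rfl⟩
  · by_cases hle : cost c L ≤ cost c L'
    · refine .inl ⟨L, ⟨.inl hL, ?_⟩, by simpa [hle] using ho, by simp [hle]⟩
      rintro S (hS | hS)
      exacts [hmin S hS, hle.trans (hmin' S hS)]
    · refine .inl ⟨L', ⟨.inr hL', ?_⟩, by simpa [hle] using ho', by simp [(not_le.1 hle).le]⟩
      rintro S (hS | hS)
      exacts [(not_le.1 hle).le.trans (hmin S hS), hmin' S hS]
  · exact .inl ⟨L, ⟨.inl hL, by simpa using hmin⟩, by simpa using ho, by simp⟩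
  · exact .inl ⟨L', ⟨.inr hL', by simpa using hmin'⟩, by simpa using ho', by simp⟩
  · exact .inr ⟨by simp, by simp, by simp⟩

/-- An isomorphism of grids carries a cheapest set to a cheapest set. -/
theorem FindsCost.map {m n m' n' : ℕ} {c : Vertex m n → NNRat} (e : Vertex m n ≃ Vertex m' n')
    (g : ℕ × ℕ → ℕ × ℕ)
    (hg : ∀ v : Vertex m' n', g (v.1, v.2) = (((e.symm v).1 : ℕ), ((e.symm v).2 : ℕ)))
    {F : Set (Finset (Vertex m' n'))} {w : WithTop NNRat} {o : List (ℕ × ℕ)}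
    (h : FindsCost (c ∘ e.symm) F w o) :
    FindsCost c {L | L.map e.toEmbedding ∈ F} w (o.map g) := by
  have hmap : ∀ L : Finset (Vertex m' n'), (L.map e.symm.toEmbedding).map e.toEmbedding = L := by
    intro L
    ext x
    simp only [Finset.mem_map_equiv, Equiv.symm_symm, Equiv.apply_symm_apply]
  rcases h with ⟨L, ⟨hL, hmin⟩, ho, rfl⟩ | ⟨rfl, rfl, rfl⟩
  · refine .inl ⟨L.map e.symm.toEmbedding, ⟨by rw [Set.mem_ofPred_eq, hmap]; exact hL,
      fun S hS => ?_⟩, ?_, ?_⟩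
    · rw [← cost_map c e, ← cost_map c e S, hmap]
      exact hmin _ hS
    · rw [Lists] at ho ⊢
      have : (o.map g).toFinset = o.toFinset.image g := by
        ext x
        simp
      rw [this, ho, Finset.image_image, Finset.map_eq_image, Finset.image_image]
      exact Finset.image_congr fun v _ => hg v
    · rw [← cost_map c e, hmap]
  · exact .inr ⟨by simp, rfl, rfl⟩

theorem describes_flip {m n : ℕ} {c : Vertex m n → NNRat} {I : Input} (h : Describes I m n c)
    (r f : Bool) :
    Describes ((View.mk id r f false).input I) m n (c ∘ (flip m n r f).symm) := by
  refine ⟨h.rows, h.cols, fun v => ?_⟩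
  rw [Function.comp_apply, ← h.entry, flip_symm, flip_apply]
  cases r <;> cases f <;>
    simp [View.input, View.place, reflect, h.rows, h.cols, Fin.val_rev, Nat.sub_sub, add_comm]

theorem place_flip {m n : ℕ} {c : Vertex m n → NNRat} {I : Input} (h : Describes I m n c)
    (r f : Bool) (v : Vertex m n) :
    (View.mk id r f false).place I (v.1, v.2) =
      ((((flip m n r f).symm v).1 : ℕ), (((flip m n r f).symm v).2 : ℕ)) := by
  rw [flip_symm, flip_apply]
  cases r <;> cases f <;>
    simp [View.place, reflect, h.rows, h.cols, Fin.val_rev, Nat.sub_sub, add_comm]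

theorem describes_swap {m n : ℕ} {c : Vertex m n → NNRat} {I : Input} (h : Describes I m n c)
    (r f : Bool) :
    Describes ((View.mk id r f true).input I) n m
      (c ∘ ((flip m n r f).trans (Equiv.prodComm (Fin m) (Fin n))).symm) := by
  refine ⟨h.cols, h.rows, fun v => ?_⟩
  rw [Function.comp_apply, ← h.entry, Equiv.symm_trans_apply, flip_symm, flip_apply]
  cases r <;> cases f <;>
    simp [View.input, View.place, reflect, h.rows, h.cols, Fin.val_rev, Nat.sub_sub, add_comm]

theorem place_swap {m n : ℕ} {c : Vertex m n → NNRat} {I : Input} (h : Describes I m n c)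
    (r f : Bool) (v : Vertex n m) :
    (View.mk id r f true).place I (v.1, v.2) =
      (((((flip m n r f).trans (Equiv.prodComm (Fin m) (Fin n))).symm v).1 : ℕ),
        ((((flip m n r f).trans (Equiv.prodComm (Fin m) (Fin n))).symm v).2 : ℕ)) := by
  rw [Equiv.symm_trans_apply, flip_symm, flip_apply]
  cases r <;> cases f <;>
    simp [View.place, reflect, h.rows, h.cols, Fin.val_rev, Nat.sub_sub, add_comm]

namespace Solver

/-- On the input `I`, the solver finds a cheapest member of `F` in at most `T` steps. -/
def SolvesAt {m n : ℕ} (a : Solver) (I : Input) (c : Vertex m n → NNRat)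
    (F : Set (Finset (Vertex m n))) (T : ℕ) : Prop :=
  ∃ w o, a.Yields I T w o ∧ FindsCost c F w o

/-- The solver finds a cheapest member of the family `F` in every grid. -/
def Solves (a : Solver) (F : Family) (T : ℕ → ℕ → ℕ) : Prop :=
  ∀ m n : ℕ, 2 ≤ m → 2 ≤ n → ∀ (c : Vertex m n → NNRat) (I : Input), Describes I m n c →
    a.SolvesAt I c (F m n c) (T m n)

theorem SolvesAt.select {m n : ℕ} {a b : Solver} {I : Input} {c : Vertex m n → NNRat}
    {F G : Set (Finset (Vertex m n))} {T T' : ℕ} (h : a.SolvesAt I c F T)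
    (h' : b.SolvesAt I c G T') : (a.select b).SolvesAt I c (F ∪ G) (T + T' + 3) := by
  obtain ⟨w, o, h₁, h₂⟩ := h
  obtain ⟨w', o', h₁', h₂'⟩ := h'
  exact ⟨_, _, h₁.select h₁', h₂.select h₂'⟩

/-- The best result of a solver in the four orientations with `s` as given. -/
def allFlips (a : Solver) (s : Bool) : Solver :=
  ((a.orient false false s).select (a.orient false true s)).select
    ((a.orient true false s).select (a.orient true true s))

/-- The best result of a solver in the eight orientations. -/
def allOrientations (a : Solver) : Solver := (a.allFlips false).select (a.allFlips true)

theorem Solves.allOrientations {a : Solver} {F : Family} {T : ℕ → ℕ → ℕ} (h : a.Solves F T)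
    (hT : ∀ m n, T n m = T m n) :
    a.allOrientations.Solves F.orientations fun m n => 8 * T m n + 21 := by
  intro m n hm hn c I hI
  have h₁ : ∀ r f, (a.orient r f false).SolvesAt I c
      {L | L.map (flip m n r f).toEmbedding ∈ F m n (c ∘ (flip m n r f).symm)} (T m n) := by
    intro r f
    obtain ⟨w, o, hy, hf⟩ := h m n hm hn _ _ (describes_flip hI r f)
    exact ⟨w, _, hy.orient, hf.map _ _ (place_flip hI r f)⟩
  have h₂ : ∀ r f, (a.orient r f true).SolvesAt I c
      {L | L.map ((flip m n r f).trans (Equiv.prodComm (Fin m) (Fin n))).toEmbedding ∈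
        F n m (c ∘ ((flip m n r f).trans (Equiv.prodComm (Fin m) (Fin n))).symm)} (T m n) := by
    intro r f
    obtain ⟨w, o, hy, hf⟩ := h n m hn hm _ _ (describes_swap hI r f)
    rw [hT] at hy
    exact ⟨w, _, hy.orient, hf.map _ _ (place_swap hI r f)⟩
  have key := (((h₁ false false).select (h₁ false true)).select
    ((h₁ true false).select (h₁ true true))).select
    (((h₂ false false).select (h₂ false true)).select ((h₂ true false).select (h₂ true true)))
  convert key using 1
  · rfl
  · ext L
    simp only [Family.orientations, Bool.exists_bool, Set.mem_union, Set.mem_ofPred_eq]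
    tauto
  · change 8 * T m n + 21 = _
    ring

theorem Yields.runs {m n : ℕ} {a : Solver} {c : Vertex m n → NNRat} {T : ℕ} {w : WithTop NNRat}
    {o : List (ℕ × ℕ)} (h : a.Yields (Input.ofGrid m n c) T w o) :
    ∃ t ≤ T, Runs a.program c t o := by
  obtain ⟨t, t', σ, σ', hT, h₁, -, -, h₂, ho⟩ := h
  exact ⟨t + t', hT, σ', .seq h₁ h₂, ho⟩

end Solver

/-! ### Total correctness with a bound on the number of steps -/

/-- Started in the state `σ`, the program halts after at most `T` steps in a state in `Q`. -/
def Reaches (I : Input) (P : Program) (σ : State) (T : ℕ) (Q : State → Prop) : Prop :=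
  ∃ t σ', t ≤ T ∧ Exec I P σ t σ' ∧ Q σ'

section Rules

variable {I : Input} {P P' : Program} {σ : State} {T T' : ℕ} {Q R : State → Prop}

theorem Reaches.mono (h : Reaches I P σ T R) (hT : T ≤ T') (hQ : ∀ τ, R τ → Q τ) :
    Reaches I P σ T' Q := by
  obtain ⟨t, τ, ht, he, hR⟩ := h
  exact ⟨t, τ, ht.trans hT, he, hQ τ hR⟩

theorem Reaches.seq (h : Reaches I P σ T R) (h' : ∀ τ, R τ → Reaches I P' τ T' Q) :
    Reaches I (.seq P P') σ (T + T') Q := by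
  obtain ⟨t, τ, ht, he, hR⟩ := h
  obtain ⟨t', τ', ht', he', hQ⟩ := h' τ hR
  exact ⟨t + t', τ', by omega, .seq he he', hQ⟩

theorem Reaches.skip (h : Q σ) : Reaches I .skip σ 1 Q := ⟨1, σ, le_rfl, .skip σ, h⟩

theorem Reaches.setI {x : ℕ} {e : IExp}
    (h : Q { σ with ireg := Function.update σ.ireg x (e.eval I σ) }) :
    Reaches I (.setI x e) σ 1 Q := ⟨1, _, le_rfl, .setI x e σ, h⟩

theorem Reaches.setC {x : ℕ} {e : CExp}
    (h : Q { σ with creg := Function.update σ.creg x (e.eval I σ) }) :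
    Reaches I (.setC x e) σ 1 Q := ⟨1, _, le_rfl, .setC x e σ, h⟩

theorem Reaches.putI {A : ℕ} {i j e : IExp}
    (h : Q { σ with iarr := writeEntry σ.iarr A (i.eval I σ) (j.eval I σ) (e.eval I σ) }) :
    Reaches I (.putI A i j e) σ 1 Q := ⟨1, _, le_rfl, .putI A i j e σ, h⟩

theorem Reaches.putC {A : ℕ} {i j : IExp} {e : CExp}
    (h : Q { σ with carr := writeEntry σ.carr A (i.eval I σ) (j.eval I σ) (e.eval I σ) }) :
    Reaches I (.putC A i j e) σ 1 Q := ⟨1, _, le_rfl, .putC A i j e σ, h⟩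

theorem Reaches.emit {i j : IExp}
    (h : Q { σ with out := σ.out ++ [(i.eval I σ, j.eval I σ)] }) :
    Reaches I (.emit i j) σ 1 Q := ⟨1, _, le_rfl, .emit i j σ, h⟩

theorem Reaches.ite {p : Test} (h : p.Holds I σ → Reaches I P σ T Q)
    (h' : ¬ p.Holds I σ → Reaches I P' σ T Q) : Reaches I (.ite p P P') σ (T + 1) Q := by
  by_cases hp : p.Holds I σ
  · obtain ⟨t, τ, ht, he, hQ⟩ := h hp
    exact ⟨t + 1, τ, by omega, .ite_true hp he, hQ⟩
  · obtain ⟨t, τ, ht, he, hQ⟩ := h' hp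
    exact ⟨t + 1, τ, by omega, .ite_false hp he, hQ⟩

theorem Reaches.while_true {p : Test} (hp : p.Holds I σ) (h : Reaches I P σ T R)
    (h' : ∀ τ, R τ → Reaches I (.while p P) τ T' Q) :
    Reaches I (.while p P) σ (T + T' + 1) Q := by
  obtain ⟨t, τ, ht, he, hR⟩ := h
  obtain ⟨t', τ', ht', he', hQ⟩ := h' τ hR
  exact ⟨t + t' + 1, τ', by omega, .while_true hp he he', hQ⟩

theorem Reaches.while_false {p : Test} (hp : ¬ p.Holds I σ) (h : Q σ) :
    Reaches I (.while p P) σ 1 Q := ⟨1, σ, le_rfl, .while_false hp, h⟩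

end Rules

/-- While the register `x` is less than `hi`, execute `P` and increase `x`. -/
def loop (x : ℕ) (hi : IExp) (P : Program) : Program :=
  .while (.not (.ile hi (.reg x))) (.seq P (.setI x (.add (.reg x) (.lit 1))))

theorem Reaches.loop {I : Input} {P : Program} {x : ℕ} {hi : IExp} (Inv : ℕ → State → Prop)
    {N B : ℕ} (hreg : ∀ k τ, Inv k τ → τ.ireg x = k ∧ hi.eval I τ = N)
    (hbody : ∀ k τ, k < N → Inv k τ → Reaches I P τ B fun τ' => τ'.ireg x = k ∧
      Inv (k + 1) { τ' with ireg := Function.update τ'.ireg x (k + 1) })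
    {k : ℕ} (hk : k ≤ N) {σ : State} (h : Inv k σ) :
    Reaches I (loop x hi P) σ ((N - k) * (B + 2) + 1) (Inv N) := by
  induction hk using Nat.decreasingInduction generalizing σ with
  | self =>
    obtain ⟨h₁, h₂⟩ := hreg N σ h
    refine (Reaches.while_false ?_ h).mono (by omega) fun _ h => h
    simp [Test.Holds, IExp.eval, h₁, h₂]
  | of_succ k hk ih =>
    obtain ⟨h₁, h₂⟩ := hreg k σ h
    refine (Reaches.while_true ?_ ((hbody k σ hk h).seq fun τ hτ => Reaches.setI
      (Q := Inv (k + 1)) ?_) fun τ hτ => ih hτ).mono ?_ fun _ h => h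
    · simp only [Test.Holds, IExp.eval, h₁, h₂]
      omega
    · simp only [IExp.eval, hτ.1]
      exact hτ.2
    · rw [show N - k = N - (k + 1) + 1 by omega, add_mul]
      omega

/-! ### Tables of minima -/

/-- `v` is the minimum of `f` on `lo, …, hi - 1` (or `∞`), and it is attained at `a`. -/
structure IsMin (lo hi : ℕ) (f : ℕ → WithTop NNRat) (v : WithTop NNRat) (a : ℕ) : Prop where
  le : ∀ i, lo ≤ i → i < hi → v ≤ f i
  attained : v ≠ ⊤ → lo ≤ a ∧ a < hi ∧ f a = v

/-- Compute in the cost register `1` the minimum of `e`, an expression in the index register `2`,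
for the values of this register from `lo` to `hi - 1`, and in the index register `3` a place where
it is attained. -/
def argmin (lo hi : IExp) (e : CExp) : Program :=
  .seq (.setI 2 lo) <| .seq (.setC 1 .infty) <| loop 2 hi <|
    .ite (.cle (.reg 1) e) .skip (.seq (.setC 1 e) (.setI 3 (.reg 2)))

/-- The state `σ` with new values of the registers that are used by `argmin`. -/
def State.scratch (σ : State) (i a : ℕ) (v : WithTop NNRat) : State :=
  { σ with
    ireg := Function.update (Function.update σ.ireg 3 a) 2 i
    creg := Function.update σ.creg 1 v }

theorem reaches_argmin {I : Input} {σ : State} {lo hi : IExp} {e : CExp} {l N : ℕ}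
    {f : ℕ → WithTop NNRat} (hlo : lo.eval I σ = l) (hlN : l ≤ N)
    (hhi : ∀ i a v, hi.eval I (σ.scratch i a v) = N)
    (he : ∀ i a v, e.eval I (σ.scratch i a v) = f i) :
    Reaches I (argmin lo hi e) σ (5 * N + 3) fun τ =>
      ∃ v a, τ = σ.scratch N a v ∧ IsMin l N f v a := by
  have h₀ : ∃ v a, { σ with
      ireg := Function.update σ.ireg 2 l
      creg := Function.update σ.creg 1 ⊤ } = σ.scratch l a v ∧ IsMin l l f v a :=
    ⟨⊤, σ.ireg 3, by simp [State.scratch], fun i _ _ => by omega, fun h => absurd rfl h⟩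
  have hbest : ∀ i a v, (σ.scratch i a v).creg 1 = v := fun i a v => by simp [State.scratch]
  refine ((Reaches.setI rfl).seq (T' := 1 + ((N - l) * 5 + 1)) fun τ hτ => ?_).mono (by omega)
    fun τ hτ => hτ
  refine (Reaches.setC rfl).seq fun τ' hτ' => ?_
  subst hτ hτ'
  rw [hlo]
  refine (Reaches.loop (B := 3) (fun k τ => l ≤ k ∧ ∃ v a, τ = σ.scratch k a v ∧
    IsMin l k f v a) ?_ ?_ hlN ⟨le_rfl, h₀⟩).mono le_rfl fun τ hτ => hτ.2
  · rintro k _ ⟨-, v, a, rfl, -⟩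
    exact ⟨by simp [State.scratch], hhi _ _ _⟩
  · rintro k _ hk ⟨hlk, v, a, rfl, hmin⟩
    refine Reaches.ite (T := 2) (fun hp => ?_) fun hp => ?_
    · refine (Reaches.skip ⟨by simp [State.scratch], by omega, v, a, by simp [State.scratch],
        fun i hi hi' => ?_, fun hv => ?_⟩).mono (by omega) fun _ h => h
      · rcases (Nat.lt_succ_iff.1 hi').lt_or_eq with h | rfl
        · exact hmin.le i hi h
        · simpa [Test.Holds, CExp.eval, he, hbest] using hp
      · obtain ⟨h₁, h₂, h₃⟩ := hmin.attained hv
        exact ⟨h₁, by omega, h₃⟩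
    · have hlt : f k < v := by
        simpa [Test.Holds, CExp.eval, he, hbest] using hp
      refine (Reaches.setC rfl).seq fun τ hτ => Reaches.setI ?_
      subst hτ
      refine ⟨by simp [State.scratch], by omega, f k, k, ?_, fun i hi hi' => ?_, fun _ =>
        ⟨hlk, by omega, rfl⟩⟩
      · rw [he]
        simp only [State.scratch, IExp.eval, State.mk.injEq, Function.update_idem, and_true,
          Function.update_self]
        ext y
        simp only [Function.update_apply]
        split_ifs <;> omega
      · rcases (Nat.lt_succ_iff.1 hi').lt_or_eq with h | rfl
        · exact hlt.le.trans (hmin.le i hi h)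
        · exact le_rfl

/-- Fill the entries `0, …, len - 1` of the row of the array `A` that is given by the index
register `0` with minima and with places where they are attained; the number of the entry is in
the index register `1`. -/
def fillRow (A : ℕ) (len lo hi : IExp) (e : CExp) : Program :=
  .seq (.setI 1 (.lit 0)) <| loop 1 len <| .seq (argmin lo hi e) <|
    .seq (.putC A (.reg 0) (.reg 1) (.reg 1)) (.putI A (.reg 0) (.reg 1) (.reg 3))

/-- The states `σ` and `τ` agree, except for row `s` of the array `A` and some registers. -/
structure AgreeOff (A s : ℕ) (σ τ : State) : Prop where
  ireg : τ.ireg 0 = σ.ireg 0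
  iarr : ∀ B i j, ¬ (B = A ∧ i = s) → τ.iarr B i j = σ.iarr B i j
  carr : ∀ B i j, ¬ (B = A ∧ i = s) → τ.carr B i j = σ.carr B i j
  out : τ.out = σ.out

theorem reaches_fillRow {I : Input} {σ : State} {A : ℕ} {len lo hi : IExp} {e : CExp}
    {s N H : ℕ} {l h : ℕ → ℕ} {f : ℕ → ℕ → WithTop NNRat} (hs : σ.ireg 0 = s) (hlh : ∀ d < N, l d ≤ h d ∧ h d ≤ H)
    (hlen : ∀ τ, AgreeOff A s σ τ → len.eval I τ = N)
    (hexp : ∀ τ, AgreeOff A s σ τ → τ.ireg 1 < N → lo.eval I τ = l (τ.ireg 1) ∧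
      hi.eval I τ = h (τ.ireg 1) ∧ e.eval I τ = f (τ.ireg 1) (τ.ireg 2)) :
    Reaches I (fillRow A len lo hi e) σ (N * (5 * H + 7) + 2) fun τ =>
      AgreeOff A s σ τ ∧ ∀ d < N,
        IsMin (l d) (h d) (f d) (τ.carr A s d) (τ.iarr A s d) := by
  subst hs
  refine ((Reaches.setI rfl).seq (T' := (N - 0) * ((5 * H + 5) + 2) + 1) fun τ hτ => ?_).mono
    (by rw [Nat.sub_zero, show 5 * H + 5 + 2 = 5 * H + 7 by ring]; omega) fun τ hτ => hτ
  subst hτ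
  refine (Reaches.loop (B := 5 * H + 5) (N := N) (fun k τ => τ.ireg 1 = k ∧ AgreeOff A (σ.ireg 0) σ τ ∧
    ∀ d < k, IsMin (l d) (h d) (f d) (τ.carr A (σ.ireg 0) d) (τ.iarr A (σ.ireg 0) d)) ?_ ?_
    (Nat.zero_le N) ?_).mono le_rfl fun τ hτ => hτ.2
  · rintro k τ ⟨h₁, h₂, -⟩
    exact ⟨h₁, hlen τ h₂⟩
  · rintro k τ hk ⟨h₁, h₂, h₃⟩
    have hs : ∀ i a v, AgreeOff A (σ.ireg 0) σ (τ.scratch i a v) := fun i a v =>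
      ⟨by simpa [State.scratch] using h₂.ireg, h₂.iarr, h₂.carr, h₂.out⟩
    have hs₁ : ∀ i a v, (τ.scratch i a v).ireg 1 = k := fun i a v => by
      simpa [State.scratch] using h₁
    have hs₂ : ∀ i a v, (τ.scratch i a v).ireg 2 = i := fun i a v => by simp [State.scratch]
    have hlk := hlh k hk
    refine ((reaches_argmin (l := l k) (N := h k) (f := f k) ?_ hlk.1 (fun i a v => ?_)
      fun i a v => ?_).seq (T' := 2) fun τ' hτ' => ?_).mono (by omega) fun τ h => h
    · rw [← h₁]
      exact (hexp τ h₂ (by omega)).1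
    · rw [(hexp _ (hs i a v) (by rw [hs₁]; exact hk)).2.1, hs₁]
    · rw [(hexp _ (hs i a v) (by rw [hs₁]; exact hk)).2.2, hs₁, hs₂]
    · obtain ⟨v, a, rfl, hmin⟩ := hτ'
      refine (Reaches.putC rfl).seq fun τ' hτ' => Reaches.putI ?_
      subst hτ'
      have h₀ : (τ.scratch (h k) a v).ireg 0 = σ.ireg 0 := (hs _ _ _).ireg
      refine ⟨hs₁ (h k) a v, by simp, ⟨?_, ?_, ?_, ?_⟩, fun d hd => ?_⟩
      · simpa using h₀
      · intro B i j hB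
        have : ¬ (B = A ∧ i = σ.ireg 0 ∧ j = k) := fun h => hB ⟨h.1, h.2.1⟩
        simp only [writeEntry, IExp.eval, h₀, hs₁, this, if_false]
        exact h₂.iarr B i j hB
      · intro B i j hB
        have : ¬ (B = A ∧ i = σ.ireg 0 ∧ j = k) := fun h => hB ⟨h.1, h.2.1⟩
        simp only [writeEntry, IExp.eval, h₀, hs₁, this, if_false]
        exact h₂.carr B i j hB
      · exact h₂.out
      · simp only [writeEntry, IExp.eval, h₀, hs₁, true_and, CExp.eval]
        rcases (Nat.lt_succ_iff.1 hd).lt_or_eq with hd | rfl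
        · simp only [hd.ne, if_false]
          exact h₃ d hd
        · simpa [State.scratch] using hmin
  · refine ⟨rfl, ⟨rfl, fun _ _ _ _ => rfl, fun _ _ _ _ => rfl, rfl⟩, fun d hd => by omega⟩

/-! ### Solvers for pairs and triples -/

theorem FindsCost.intro {m n : ℕ} {c : Vertex m n → NNRat} {F : Set (Finset (Vertex m n))}
    {w : WithTop NNRat} {o : List (ℕ × ℕ)}
    (hmem : w ≠ ⊤ → ∃ L ∈ F, Lists o L ∧ w = (cost c L : NNRat))
    (hle : ∀ L ∈ F, w ≤ (cost c L : NNRat)) (ho : w = ⊤ → o = []) : FindsCost c F w o := by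
  by_cases hw : w = ⊤
  · refine .inr ⟨Set.eq_empty_of_forall_notMem fun L hL => ?_, ho hw, hw⟩
    have := hle L hL
    rw [hw, top_le_iff] at this
    exact WithTop.coe_ne_top this
  · obtain ⟨L, hL, hLo, rfl⟩ := hmem hw
    exact .inl ⟨L, ⟨hL, fun L' hL' => by simpa using hle L' hL'⟩, hLo, rfl⟩

theorem Solver.SolvesAt.of_reaches {m n : ℕ} {a : Solver} {I : Input} {c : Vertex m n → NNRat}
    {F : Set (Finset (Vertex m n))} {T T' : ℕ}
    (h : Reaches I a.find .init T fun σ => σ.out = [] ∧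
      Reaches I a.print σ T' fun σ' => FindsCost c F (σ.creg 0) σ'.out) :
    a.SolvesAt I c F (T + T') := by
  obtain ⟨t, σ, ht, he, ho, t', σ', ht', he', hf⟩ := h
  exact ⟨_, _, ⟨t, t', σ, σ', by omega, he, rfl, ho, he', rfl⟩, hf⟩

theorem Solver.SolvesAt.mono {m n : ℕ} {a : Solver} {I : Input} {c : Vertex m n → NNRat}
    {F : Set (Finset (Vertex m n))} {T T' : ℕ} (h : a.SolvesAt I c F T) (hT : T ≤ T') :
    a.SolvesAt I c F T' := by
  obtain ⟨w, o, ⟨t, t', σ, σ', ht, hy⟩, hf⟩ := h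
  exact ⟨w, o, ⟨t, t', σ, σ', ht.trans hT, hy⟩, hf⟩

theorem cost_pair {V : Type*} [DecidableEq V] (c : V → NNRat) {u v : V} (h : u ≠ v) :
    cost c {u, v} = c u + c v := Finset.sum_pair h

theorem cost_triple {V : Type*} [DecidableEq V] (c : V → NNRat) {u v w : V} (huv : u ≠ v)
    (huw : u ≠ w) (hvw : v ≠ w) : cost c {u, v, w} = c u + c v + c w := by
  rw [cost, Finset.sum_insert (by simp [huv, huw]), Finset.sum_pair hvw, add_assoc]

theorem map_pair {V W : Type*} [DecidableEq V] [DecidableEq W] (e : V ≃ W) (u v : V) :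
    ({u, v} : Finset V).map e.toEmbedding = {e u, e v} := by
  simp [Finset.map_insert]

theorem map_eq_pair_iff {V W : Type*} [DecidableEq V] [DecidableEq W] (e : V ≃ W) (L : Finset V)
    (u v : W) : L.map e.toEmbedding = {u, v} ↔ L = {e.symm u, e.symm v} := by
  rw [← Finset.map_inj (f := e.toEmbedding) (s₂ := {e.symm u, e.symm v})]
  simp [Finset.map_insert]

/-- The two corners in the first row. -/
def topCornerPair : Family := fun m n _ =>
  {L | ∃ u v : Vertex m n, (u.1 : ℕ) = 0 ∧ (u.2 : ℕ) = 0 ∧ (v.1 : ℕ) = 0 ∧ (v.2 : ℕ) + 1 = n ∧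
    L = {u, v}}

theorem orientations_topCornerPair {m n : ℕ} (hm : 2 ≤ m) (hn : 2 ≤ n) (c : Vertex m n → NNRat) :
    topCornerPair.orientations m n c = adjacentCornerPairs m n := by
  ext L
  constructor
  · rintro ⟨r, f, ⟨u, v, hu₁, hu₂, hv₁, hv₂, h⟩ | ⟨u, v, hu₁, hu₂, hv₁, hv₂, h⟩⟩
    · rw [map_eq_pair_iff] at h
      refine ⟨_, _, ?_, ?_, ?_, .inl ?_, h⟩
      · rw [flip_symm, flip_apply]
        cases r <;> cases f <;> simp [IsCorner, Fin.val_rev] <;> omega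
      · rw [flip_symm, flip_apply]
        cases r <;> cases f <;> simp [IsCorner, Fin.val_rev] <;> omega
      · exact (Equiv.injective _).ne (by rintro rfl; omega)
      · have : u.1 = v.1 := Fin.ext (by omega)
        simp only [flip_symm, flip_apply, this]
    · rw [map_eq_pair_iff] at h
      refine ⟨_, _, ?_, ?_, ?_, .inr ?_, h⟩
      · rw [Equiv.symm_trans_apply, flip_symm, flip_apply]
        cases r <;> cases f <;> simp [IsCorner, Fin.val_rev] <;> omega
      · rw [Equiv.symm_trans_apply, flip_symm, flip_apply]
        cases r <;> cases f <;> simp [IsCorner, Fin.val_rev] <;> omega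
      · exact (Equiv.injective _).ne (by rintro rfl; omega)
      · have : u.1 = v.1 := Fin.ext (by omega)
        simp only [Equiv.symm_trans_apply, flip_symm, flip_apply, Equiv.prodComm_symm,
          Equiv.prodComm_apply, Prod.snd_swap, this]
  · -- The corner in the first column, or else in the first row, comes first.
    suffices key : ∀ u v : Vertex m n, IsCorner u → IsCorner v →
        (u.1 = v.1 ∧ (u.2 : ℕ) = 0 ∧ (v.2 : ℕ) + 1 = n ∨
          u.2 = v.2 ∧ (u.1 : ℕ) = 0 ∧ (v.1 : ℕ) + 1 = m) →
        ({u, v} : Finset (Vertex m n)) ∈ topCornerPair.orientations m n c by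
      rintro ⟨u, v, hu, hv, huv, hline, rfl⟩
      have hne : (u.1 : ℕ) ≠ v.1 ∨ (u.2 : ℕ) ≠ v.2 := by
        by_contra! hc
        exact huv (Prod.ext (Fin.ext hc.1) (Fin.ext hc.2))
      have hcu := hu
      have hcv := hv
      simp only [IsCorner] at hcu hcv
      have hcases : (u.1 = v.1 ∧ (u.2 : ℕ) = 0 ∧ (v.2 : ℕ) + 1 = n ∨
          u.2 = v.2 ∧ (u.1 : ℕ) = 0 ∧ (v.1 : ℕ) + 1 = m) ∨
          (v.1 = u.1 ∧ (v.2 : ℕ) = 0 ∧ (u.2 : ℕ) + 1 = n ∨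
          v.2 = u.2 ∧ (v.1 : ℕ) = 0 ∧ (u.1 : ℕ) + 1 = m) := by
        simp only [Fin.ext_iff] at hline ⊢
        omega
      rcases hcases with h | h
      · exact key u v hu hv h
      · rw [Finset.pair_comm]
        exact key v u hv hu h
    rintro u v hu hv (⟨h, hu₂, hv₂⟩ | ⟨h, hu₁, hv₁⟩)
    · rw [← Fin.val_inj] at h
      rcases hu.1 with h₀ | h₀
      · refine ⟨false, false, .inl ⟨_, _, ?_, ?_, ?_, ?_, map_pair _ u v⟩⟩ <;>
          simp [flip_apply] <;> omega
      · refine ⟨true, false, .inl ⟨_, _, ?_, ?_, ?_, ?_, map_pair _ u v⟩⟩ <;>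
          simp [flip_apply, Fin.val_rev] <;> omega
    · rw [← Fin.val_inj] at h
      rcases hu.2 with h₀ | h₀
      · refine ⟨false, false, .inr ⟨_, _, ?_, ?_, ?_, ?_, map_pair _ u v⟩⟩ <;>
          simp [flip_apply] <;> omega
      · refine ⟨false, true, .inr ⟨_, _, ?_, ?_, ?_, ?_, map_pair _ u v⟩⟩ <;>
          simp [flip_apply, Fin.val_rev] <;> omega

/-- The last row, as an index expression. -/
def lastRow : IExp := .sub .rows (.lit 1)

/-- The last column, as an index expression. -/
def lastCol : IExp := .sub .cols (.lit 1)

/-- The solver for the pair of corners in the first row. -/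
def pairSolver : Solver where
  find := .setC 0 (.add (.input (.lit 0) (.lit 0)) (.input (.lit 0) lastCol))
  print := .seq (.emit (.lit 0) (.lit 0)) (.emit (.lit 0) lastCol)

theorem solves_pairSolver : pairSolver.Solves topCornerPair fun _ _ => 3 := by
  intro m n hm hn c I hI
  let a : Vertex m n := (⟨0, by omega⟩, ⟨0, by omega⟩)
  let b : Vertex m n := (⟨0, by omega⟩, ⟨n - 1, by omega⟩)
  have hab : a ≠ b := fun h => by
    have : 0 = n - 1 := congrArg (fun v : Vertex m n => (v.2 : ℕ)) h
    omega
  have ha : I.entry 0 0 = c a := hI.entry a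
  have hb : I.entry 0 (n - 1) = c b := hI.entry b
  refine Solver.SolvesAt.of_reaches (T := 1) (T' := 2) (.setC ⟨rfl, ?_⟩)
  refine (Reaches.emit rfl).seq fun σ hσ => Reaches.emit ?_
  subst hσ
  refine .intro (fun _ => ⟨{a, b}, ⟨a, b, rfl, rfl, rfl, by change n - 1 + 1 = n; omega, rfl⟩,
    ?_, ?_⟩) ?_ fun h => ?_
  · simp [Lists, State.init, IExp.eval, lastCol, hI.cols, a, b]
  · simp [CExp.eval, IExp.eval, lastCol, hI.cols, ha, hb, cost_pair c hab]
  · rintro _ ⟨u, v, hu₁, hu₂, hv₁, hv₂, rfl⟩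
    have hu : u = a := Prod.ext (Fin.ext hu₁) (Fin.ext hu₂)
    have hv : v = b := Prod.ext (Fin.ext hv₁) (Fin.ext (by change (v.2 : ℕ) = n - 1; omega))
    subst hu hv
    simp [CExp.eval, IExp.eval, lastCol, hI.cols, ha, hb, cost_pair c hab]
  · simp [CExp.eval, IExp.eval, lastCol, hI.cols, ha, hb] at h

/-- The triples of `sameColumnTriples` whose third vertex lies to the left of the other two. -/
def leftTriples : Family := fun m n _ =>
  {L | ∃ u v w : Vertex m n, (u.1 : ℕ) = 0 ∧ (v.1 : ℕ) + 1 = m ∧ u.2 = v.2 ∧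
    0 < (u.2 : ℕ) ∧ (u.2 : ℕ) + 1 < n ∧ w.2 < u.2 ∧ L = {u, v, w}}

/-- A reflection of the columns exchanges left and right. -/
theorem mem_leftTriples_or {m n : ℕ} {c : Vertex m n → NNRat} {L : Finset (Vertex m n)}
    (h : L ∈ sameColumnTriples m n c) :
    L ∈ leftTriples m n 0 ∨ L.map (flip m n false true).toEmbedding ∈ leftTriples m n 0 := by
  obtain ⟨u, v, w, hu, hv, huv, h₀, h₁, hw, rfl⟩ := h
  rcases lt_or_gt_of_ne hw with hw | hw
  · exact .inl ⟨u, v, w, hu, hv, huv, h₀, h₁, hw, rfl⟩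
  · refine .inr ⟨flip m n false true u, flip m n false true v, flip m n false true w,
      hu, hv, ?_, ?_, ?_, ?_, by simp [Finset.map_insert]⟩
    · simp [flip_apply, huv]
    · simp only [flip_apply, cond_true, Fin.val_rev]
      omega
    · simp only [flip_apply, cond_true, Fin.val_rev]
      omega
    · simpa [flip_apply, Fin.rev_lt_rev] using hw

theorem orientations_leftTriples (m n : ℕ) (c : Vertex m n → NNRat) :
    leftTriples.orientations m n c = sameColumnTriples.orientations m n c := by
  have hsub : ∀ {m n : ℕ} {c c' : Vertex m n → NNRat}, leftTriples m n c ⊆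
      sameColumnTriples m n c' := by
    rintro m n c c' _ ⟨u, v, w, hu, hv, huv, h₀, h₁, hw, rfl⟩
    exact ⟨u, v, w, hu, hv, huv, h₀, h₁, hw.ne, rfl⟩
  ext L
  constructor
  · rintro ⟨r, f, h | h⟩
    exacts [⟨r, f, .inl (hsub h)⟩, ⟨r, f, .inr (hsub h)⟩]
  · rintro ⟨r, f, h | h⟩
    · rcases mem_leftTriples_or h with h | h
      · exact ⟨r, f, .inl h⟩
      · refine ⟨r, !f, .inl ?_⟩
        change _ ∈ leftTriples _ _ 0
        rw [Finset.map_map] at h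
        convert h using 2
        ext x <;> cases f <;> simp [flip_apply]
    · rcases mem_leftTriples_or h with h | h
      · exact ⟨r, f, .inr h⟩
      · refine ⟨!r, f, .inr ?_⟩
        change _ ∈ leftTriples _ _ 0
        rw [Finset.map_map] at h
        convert h using 2
        ext x <;> cases r <;> simp [flip_apply]

/-- The solver for `leftTriples`: the minima of the columns, then for every column the best of
the columns on its left, then the best column of the first two vertices. -/
def leftSolver : Solver where
  find := .seq (fillRow 0 .cols (.lit 0) .rows (.input (.reg 2) (.reg 1))) <|
    .seq (fillRow 1 .cols (.lit 0) (.reg 1) (.arr 0 (.lit 0) (.reg 2))) <|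
    .seq (argmin (.lit 1) lastCol (.add (.add (.input (.lit 0) (.reg 2)) (.input lastRow (.reg 2)))
      (.arr 1 (.lit 0) (.reg 2)))) <|
    .setC 0 (.reg 1)
  print := .ite (.cle .infty (.reg 0)) .skip <|
    .seq (.emit (.lit 0) (.reg 3)) <| .seq (.emit lastRow (.reg 3)) <|
    .emit (.arr 0 (.lit 0) (.arr 1 (.lit 0) (.reg 3))) (.arr 1 (.lit 0) (.reg 3))

theorem findsCost_leftTriples {m n : ℕ} (hm : 2 ≤ m) {c : Vertex m n → NNRat} {I : Input}
    (hI : Describes I m n c) {K P : ℕ → WithTop NNRat} {κ π : ℕ → ℕ} {w : WithTop NNRat} {z : ℕ}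
    (hK : ∀ b < n, IsMin 0 m (fun a => I.entry a b) (K b) (κ b))
    (hP : ∀ z < n, IsMin 0 z K (P z) (π z))
    (hw : IsMin 1 (n - 1) (fun z => I.entry 0 z + I.entry (m - 1) z + P z) w z) :
    FindsCost c (leftTriples m n c) w
      (if w = ⊤ then [] else [(0, z), (m - 1, z), (κ (π z), π z)]) := by
  have hcost : ∀ u v w : Vertex m n, (u.1 : ℕ) = 0 → (v.1 : ℕ) + 1 = m → u.2 = v.2 →
      w.2 < u.2 → cost c {u, v, w} = c u + c v + c w := by
    intro u v w hu hv huv hwu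
    have h₁ : (u.2 : ℕ) = v.2 := congrArg _ huv
    rw [Fin.lt_def] at hwu
    exact cost_triple c (by rintro rfl; omega) (by rintro rfl; omega) (by rintro rfl; omega)
  refine .intro (fun hne => ?_) ?_ fun h => if_pos h
  · obtain ⟨hz₁, hz₂, hz⟩ := hw.attained hne
    have hPz : P z ≠ ⊤ := fun h => hne (by rw [← hz, h, WithTop.add_top])
    obtain ⟨-, hπ, hKπ⟩ := (hP z (by omega)).attained hPz
    obtain ⟨-, hκ, hcκ⟩ := (hK (π z) (by omega)).attained (by rwa [hKπ])
    let u : Vertex m n := (⟨0, by omega⟩, ⟨z, by omega⟩)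
    let v : Vertex m n := (⟨m - 1, by omega⟩, ⟨z, by omega⟩)
    let x : Vertex m n := (⟨κ (π z), hκ⟩, ⟨π z, by omega⟩)
    refine ⟨{u, v, x}, ⟨u, v, x, rfl, by change m - 1 + 1 = m; omega, rfl, by change 0 < z; omega,
      by change z + 1 < n; omega, hπ, rfl⟩, ?_, ?_⟩
    · simp [hne, Lists, u, v, x]
    · rw [hcost u v x rfl (by change m - 1 + 1 = m; omega) rfl hπ]
      push_cast
      rw [← hI.entry, ← hI.entry, ← hI.entry, ← hz, ← hKπ, ← hcκ]
  · rintro _ ⟨u, v, x, hu, hv, huv, h₀, h₁, hxu, rfl⟩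
    rw [hcost u v x hu hv huv hxu]
    refine (hw.le u.2 h₀ (by omega)).trans ?_
    push_cast
    rw [← hI.entry, ← hI.entry, ← hI.entry, hu, ← huv, show m - 1 = (v.1 : ℕ) by omega]
    gcongr
    exact ((hP u.2 (by omega)).le x.2 (Nat.zero_le _) hxu).trans
      ((hK x.2 x.2.2).le x.1 (Nat.zero_le _) x.1.2)

theorem solves_leftSolver :
    leftSolver.Solves leftTriples fun m n => 100 * ((m + n) * (m * n)) := by
  intro m n hm hn c I hI
  have hrows := hI.rows
  have hcols := hI.cols
  have hT : (n * (5 * m + 7) + 2 + (n * (5 * n + 7) + 2 + (5 * (n - 1) + 3 + 1))) + 4 ≤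
      100 * ((m + n) * (m * n)) := by
    obtain ⟨a, rfl⟩ := Nat.exists_eq_add_of_le hm
    obtain ⟨b, rfl⟩ := Nat.exists_eq_add_of_le hn
    rw [show 2 + b - 1 = b + 1 by omega]
    ring_nf
    nlinarith [Nat.zero_le (a * b), Nat.zero_le (a * b * b), Nat.zero_le (a * a * b)]
  refine (Solver.SolvesAt.of_reaches ?_).mono hT
  refine (reaches_fillRow (s := 0) (N := n) (H := m) (l := fun _ => 0) (h := fun _ => m)
    (f := fun d i => I.entry i d) rfl (by omega) (by intro τ _; exact hcols)
    (by intro τ _ _; exact ⟨rfl, hrows, rfl⟩)).seq fun τ₁ ⟨h₁, hK⟩ => ?_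
  refine (reaches_fillRow (s := 0) (N := n) (H := n) (l := fun _ => 0) (h := fun d => d)
    (f := fun _ i => τ₁.carr 0 0 i) h₁.ireg (by omega) (by intro τ _; exact hcols)
    (by intro τ h _; exact ⟨rfl, rfl, h.carr 0 0 _ (by decide)⟩)).seq fun τ₂ ⟨h₂, hP⟩ => ?_
  refine (reaches_argmin (l := 1) (N := n - 1)
    (f := fun z => I.entry 0 z + I.entry (m - 1) z + τ₂.carr 1 0 z) rfl (by omega)
    (fun i a v => by simp [lastCol, IExp.eval, hcols])
    (fun i a v => by
      simp [lastRow, IExp.eval, CExp.eval, hrows, State.scratch])).seq fun τ ⟨w, z, hτ, hw⟩ => ?_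
  subst hτ
  have hout : τ₂.out = [] := h₂.out.trans h₁.out
  have hfind := findsCost_leftTriples hm hI hK hP hw
  refine Reaches.setC ⟨hout, Reaches.ite (T := 3) (fun htop => ?_) fun htop => ?_⟩
  · have hw : w = ⊤ := by simpa [Test.Holds, CExp.eval, State.scratch] using htop
    rw [if_pos hw] at hfind
    refine (Reaches.skip ?_).mono (by omega) fun _ h => h
    simpa [CExp.eval, State.scratch, hout] using hfind
  · have hw : w ≠ ⊤ := by simpa [Test.Holds, CExp.eval, State.scratch] using htop
    rw [if_neg hw] at hfind
    refine (Reaches.emit rfl).seq (T' := 2) fun τ hτ => (Reaches.emit rfl).seq fun τ' hτ' =>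
      Reaches.emit ?_
    subst hτ'
    subst hτ
    have hκ : ∀ i, τ₂.iarr 0 0 i = τ₁.iarr 0 0 i := fun i => h₂.iarr _ _ _ (by decide)
    simpa [CExp.eval, IExp.eval, State.scratch, hout, lastRow, hrows, hκ] using hfind

/-- The solver for `betweenTriples`: for every column the best vertex of the first row on its left
and the best one on its right, then the best column of the vertex in the last row. -/
def betweenSolver : Solver where
  find := .seq (fillRow 0 .cols (.lit 0) (.reg 1) (.input (.lit 0) (.reg 2))) <|
    .seq (fillRow 1 .cols (.add (.reg 1) (.lit 1)) .cols (.input (.lit 0) (.reg 2))) <|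
    .seq (argmin (.lit 0) .cols (.add (.add (.arr 0 (.lit 0) (.reg 2)) (.input lastRow (.reg 2)))
      (.arr 1 (.lit 0) (.reg 2)))) <|
    .setC 0 (.reg 1)
  print := .ite (.cle .infty (.reg 0)) .skip <|
    .seq (.emit (.lit 0) (.arr 0 (.lit 0) (.reg 3))) <| .seq (.emit lastRow (.reg 3)) <|
    .emit (.lit 0) (.arr 1 (.lit 0) (.reg 3))

theorem findsCost_betweenTriples {m n : ℕ} (hm : 2 ≤ m) {c : Vertex m n → NNRat} {I : Input}
    (hI : Describes I m n c) {K P : ℕ → WithTop NNRat} {κ π : ℕ → ℕ} {w : WithTop NNRat} {z : ℕ}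
    (hK : ∀ z < n, IsMin 0 z (fun b => I.entry 0 b) (K z) (κ z))
    (hP : ∀ z < n, IsMin (z + 1) n (fun b => I.entry 0 b) (P z) (π z))
    (hw : IsMin 0 n (fun z => K z + I.entry (m - 1) z + P z) w z) :
    FindsCost c (betweenTriples m n c) w
      (if w = ⊤ then [] else [(0, κ z), (m - 1, z), (0, π z)]) := by
  have hcost : ∀ u v w : Vertex m n, u.2 < v.2 → v.2 < w.2 →
      cost c {u, v, w} = c u + c v + c w := by
    intro u v w huv hvw
    exact cost_triple c (by rintro rfl; exact huv.false)
      (by rintro rfl; exact (huv.trans hvw).false) (by rintro rfl; exact hvw.false)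
  refine .intro (fun hne => ?_) ?_ fun h => if_pos h
  · obtain ⟨-, hz₂, hz⟩ := hw.attained hne
    have hPz : P z ≠ ⊤ := fun h => hne (by rw [← hz, h, WithTop.add_top])
    have hKz : K z ≠ ⊤ := fun h => hne (by rw [← hz, h, WithTop.top_add, WithTop.top_add])
    obtain ⟨-, hκ, hcκ⟩ := (hK z hz₂).attained hKz
    obtain ⟨hπ, hπ', hcπ⟩ := (hP z hz₂).attained hPz
    let u : Vertex m n := (⟨0, by omega⟩, ⟨κ z, by omega⟩)
    let v : Vertex m n := (⟨m - 1, by omega⟩, ⟨z, by omega⟩)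
    let x : Vertex m n := (⟨0, by omega⟩, ⟨π z, by omega⟩)
    refine ⟨{u, v, x}, ⟨u, v, x, rfl, by change m - 1 + 1 = m; omega, rfl, hκ, hπ, rfl⟩, ?_, ?_⟩
    · simp [hne, Lists, u, v, x]
    · rw [hcost u v x hκ hπ]
      push_cast
      rw [← hI.entry, ← hI.entry, ← hI.entry, ← hz, ← hcκ, ← hcπ]
  · rintro _ ⟨u, v, x, hu, hv, hx, huv, hvx, rfl⟩
    rw [hcost u v x huv hvx]
    refine (hw.le v.2 (Nat.zero_le _) v.2.2).trans ?_
    push_cast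
    rw [← hI.entry, ← hI.entry, ← hI.entry, hu, hx, show m - 1 = (v.1 : ℕ) by omega]
    gcongr
    · exact (hK v.2 v.2.2).le u.2 (Nat.zero_le _) huv
    · exact (hP v.2 v.2.2).le x.2 hvx x.2.2

theorem solves_betweenSolver :
    betweenSolver.Solves betweenTriples fun m n => 100 * ((m + n) * (m * n)) := by
  intro m n hm hn c I hI
  have hrows := hI.rows
  have hcols := hI.cols
  have hT : (n * (5 * n + 7) + 2 + (n * (5 * n + 7) + 2 + (5 * n + 3 + 1))) + 4 ≤
      100 * ((m + n) * (m * n)) := by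
    obtain ⟨a, rfl⟩ := Nat.exists_eq_add_of_le hm
    obtain ⟨b, rfl⟩ := Nat.exists_eq_add_of_le hn
    ring_nf
    nlinarith [Nat.zero_le (a * b), Nat.zero_le (a * b * b), Nat.zero_le (a * a * b)]
  refine (Solver.SolvesAt.of_reaches ?_).mono hT
  refine (reaches_fillRow (s := 0) (N := n) (H := n) (l := fun _ => 0) (h := fun d => d)
    (f := fun _ i => I.entry 0 i) rfl (by omega) (by intro τ _; exact hcols)
    (by intro τ _ _; exact ⟨rfl, rfl, rfl⟩)).seq fun τ₁ ⟨h₁, hK⟩ => ?_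
  refine (reaches_fillRow (s := 0) (N := n) (H := n) (l := fun d => d + 1) (h := fun _ => n)
    (f := fun _ i => I.entry 0 i) h₁.ireg (by omega) (by intro τ _; exact hcols)
    (by intro τ _ _; exact ⟨rfl, hcols, rfl⟩)).seq fun τ₂ ⟨h₂, hP⟩ => ?_
  have hK' : ∀ i, τ₂.carr 0 0 i = τ₁.carr 0 0 i := fun i => h₂.carr _ _ _ (by decide)
  have hκ : ∀ i, τ₂.iarr 0 0 i = τ₁.iarr 0 0 i := fun i => h₂.iarr _ _ _ (by decide)
  refine (reaches_argmin (l := 0) (N := n)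
    (f := fun z => τ₁.carr 0 0 z + I.entry (m - 1) z + τ₂.carr 1 0 z) rfl (by omega)
    (fun i a v => by simp [IExp.eval, hcols])
    (fun i a v => by
      simp [lastRow, IExp.eval, CExp.eval, hrows, State.scratch, hK'])).seq
      fun τ ⟨w, z, hτ, hw⟩ => ?_
  subst hτ
  have hout : τ₂.out = [] := h₂.out.trans h₁.out
  have hfind := findsCost_betweenTriples hm hI hK hP hw
  refine Reaches.setC ⟨hout, Reaches.ite (T := 3) (fun htop => ?_) fun htop => ?_⟩
  · have hw : w = ⊤ := by simpa [Test.Holds, CExp.eval, State.scratch] using htop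
    rw [if_pos hw] at hfind
    refine (Reaches.skip ?_).mono (by omega) fun _ h => h
    simpa [CExp.eval, State.scratch, hout] using hfind
  · have hw : w ≠ ⊤ := by simpa [Test.Holds, CExp.eval, State.scratch] using htop
    rw [if_neg hw] at hfind
    refine (Reaches.emit rfl).seq (T' := 2) fun τ hτ => (Reaches.emit rfl).seq fun τ' hτ' =>
      Reaches.emit ?_
    subst hτ'
    subst hτ
    simpa [CExp.eval, IExp.eval, State.scratch, hout, lastRow, hrows, hκ] using hfind

/-! ### Cheapest stairs by dynamic programming -/

theorem IsMin.congr {lo hi : ℕ} {f g : ℕ → WithTop NNRat} {v v' : WithTop NNRat} {a a' : ℕ}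
    (h : IsMin lo hi f v a) (hf : ∀ i, lo ≤ i → i < hi → g i = f i) (hv : v' = v) (ha : a' = a) :
    IsMin lo hi g v' a' := by
  subst hv ha
  refine ⟨fun i h₁ h₂ => by rw [hf i h₁ h₂]; exact h.le i h₁ h₂, fun hne => ?_⟩
  obtain ⟨h₁, h₂, h₃⟩ := h.attained hne
  exact ⟨h₁, h₂, by rw [hf _ h₁ h₂, h₃]⟩

/-- The contents of the tables, each entry with a place where the minimum is attained, up to the
rows `x`, `y`, `z`. For a position `(s, d)`, where `s` is the row of the last `r j` and `d` is the
column of the last `p j` of a stair: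
* `C 0 s d` is the cost of the best `r j`, and `C 1 s d` that of the best `p (j + 1)` if its
  column is `d` and the row of `r j` is `s`;
* `C 2 s d` is the cost of the best stair without its last vertex `r j`;
* `C 3 s d` is the cost of the best stair that ends in row `s` and whose last `p j` is on the left
  of column `d`, and it is `0` in row `0`, where stairs begin;
* `C 4 s d` is the cost of the best stair as for `C 3`, together with a vertex of the last row in
  a column `x ≤ d` such that the last `p j` is on the left of `x`. -/
structure IsTable (I : Input) (m n x y z : ℕ) (C : ℕ → ℕ → ℕ → WithTop NNRat)
    (A : ℕ → ℕ → ℕ → ℕ) : Prop where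
  left : ∀ s < x, ∀ d < n, IsMin 0 (d + 1) (fun i => I.entry s i) (C 0 s d) (A 0 s d)
  up : ∀ s < x, ∀ d < n, IsMin 0 (s + 1) (fun i => I.entry i d) (C 1 s d) (A 1 s d)
  down : ∀ s, 1 ≤ s → s < y → ∀ d < n,
    IsMin 0 s (fun i => C 3 i d + C 1 i d) (C 2 s d) (A 2 s d)
  right : ∀ s, 1 ≤ s → s < y → ∀ d < n,
    IsMin 0 d (fun i => C 2 s i + C 0 s i) (C 3 s d) (A 3 s d)
  start : ∀ d, C 3 0 d = 0
  last : ∀ s, 1 ≤ s → s < z → ∀ d < n,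
    IsMin 0 (d + 1) (fun i => C 3 s i + I.entry (m - 1) i) (C 4 s d) (A 4 s d)

section Math

variable {I : Input} {m n : ℕ} {c : Vertex m n → NNRat} {C : ℕ → ℕ → ℕ → WithTop NNRat}
  {A : ℕ → ℕ → ℕ → ℕ}

theorem IsTable.le_sum (h : IsTable I m n m m m C A) (hI : Describes I m n c) {k : ℕ}
    {p r : ℕ → Vertex m n} (hs : IsStair k p r) {j : ℕ} (hj : j ≤ k) :
    C 2 (r j).1 (p j).2 + C 0 (r j).1 (p j).2 ≤
      ∑ i ∈ Finset.range (j + 1), ((c (p i) : WithTop NNRat) + (c (r i) : WithTop NNRat)) := by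
  have hrow : ∀ j ≤ k, 1 ≤ ((r j).1 : ℕ) := fun j hj => by
    have := hs.p_row_lt hj
    omega
  have hleft : ∀ j ≤ k, C 0 (r j).1 (p j).2 ≤ (c (r j) : WithTop NNRat) := fun j hj => by
    rw [← hI.entry]
    exact (h.left _ (r j).1.2 _ (p j).2.2).le (r j).2 (Nat.zero_le _)
      (Nat.lt_succ_of_le (hs.left j hj))
  induction j with
  | zero =>
    rw [Finset.sum_range_one]
    refine add_le_add ?_ (hleft 0 hj)
    refine ((h.down _ (hrow 0 hj) (r 0).1.2 _ (p 0).2.2).le 0 le_rfl (hrow 0 hj)).trans ?_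
    rw [h.start, zero_add, ← hI.entry, hs.first_row]
    exact (h.up 0 ((Nat.zero_le _).trans_lt (r 0).1.2) _ (p 0).2.2).le 0 le_rfl one_pos
  | succ j ih =>
    rw [Finset.sum_range_succ, ← add_assoc]
    refine add_le_add ?_ (hleft _ hj)
    refine ((h.down _ (hrow _ hj) (r (j + 1)).1.2 _ (p (j + 1)).2.2).le (r j).1 (Nat.zero_le _)
      (hs.down j hj)).trans (add_le_add ?_ ?_)
    · exact ((h.right _ (hrow j (by omega)) (r j).1.2 _ (p (j + 1)).2.2).le (p j).2
        (Nat.zero_le _) (hs.right j hj)).trans (ih (by omega))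
    · rw [← hI.entry]
      exact (h.up _ (r j).1.2 _ (p (j + 1)).2.2).le _ (Nat.zero_le _)
        (Nat.lt_succ_of_le (hs.up j hj))

/-- A stair may be left at the first `p j` that is not to the left of its last vertex. This is why
it is enough to compare the column of the last vertex with that of the preceding `p j`, instead of
that of `p 0`. -/
theorem IsTable.exists_le_cost (h : IsTable I m n m m m C A) (hI : Describes I m n c) {k : ℕ}
    {p r : ℕ → Vertex m n} (hs : IsFullStair k p r) :
    ∃ s, 1 ≤ s ∧ s < m - 1 ∧ ∃ d < n, C 4 s d + C 1 s d ≤ (cost c (stairVertices k p r) : NNRat) := by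
  have hk := hs.pos_length
  have hex : ∃ j, ((r k).2 : ℕ) ≤ (p (j + 1)).2 ∧ j < k :=
    ⟨k - 1, by rw [Nat.sub_add_cancel hk]; exact hs.left k le_rfl, by omega⟩
  classical
  obtain ⟨hj₁, hj₂⟩ := Nat.find_spec hex
  have hmin : ∀ i < Nat.find hex, ¬ (((r k).2 : ℕ) ≤ (p (i + 1)).2 ∧ i < k) := fun i hi =>
    Nat.find_min hex hi
  generalize Nat.find hex = j at hj₁ hj₂ hmin
  have hp : ((p j).2 : ℕ) < (r k).2 := by
    cases j with
    | zero => exact hs.last_col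
    | succ j =>
      have := hmin j (by omega)
      omega
  have hrow : 1 ≤ ((r j).1 : ℕ) := by
    have := hs.p_row_lt hj₂.le
    omega
  have hrow' := hs.r_lt hj₂ le_rfl
  have hlast := hs.last_row
  refine ⟨(r j).1, hrow, by omega, (p (j + 1)).2, (p (j + 1)).2.2, ?_⟩
  calc C 4 (r j).1 (p (j + 1)).2 + C 1 (r j).1 (p (j + 1)).2
      ≤ (∑ i ∈ Finset.range (j + 1), ((c (p i) : WithTop NNRat) + (c (r i) : WithTop NNRat)) +
          c (r k)) + c (p (j + 1)) := by
        refine add_le_add ?_ ?_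
        · refine ((h.last _ hrow (r j).1.2 _ (p (j + 1)).2.2).le (r k).2 (Nat.zero_le _)
            (Nat.lt_succ_of_le hj₁)).trans (add_le_add ?_ ?_)
          · exact ((h.right _ hrow (r j).1.2 _ (r k).2.2).le (p j).2 (Nat.zero_le _) hp).trans
              (h.le_sum hI hs.toIsStair hj₂.le)
          · rw [← hI.entry, show m - 1 = ((r k).1 : ℕ) by omega]
        · rw [← hI.entry]
          exact (h.up _ (r j).1.2 _ (p (j + 1)).2.2).le _ (Nat.zero_le _)
            (Nat.lt_succ_of_le (hs.up j hj₂))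
    _ ≤ ∑ i ∈ Finset.range (k + 1), ((c (p i) : WithTop NNRat) + (c (r i) : WithTop NNRat)) := by
        rcases (Nat.succ_le_of_lt hj₂).lt_or_eq with hjk | hjk
        · rw [Finset.sum_range_succ _ k]
          have hsub : ∑ i ∈ Finset.range (j + 1 + 1),
              ((c (p i) : WithTop NNRat) + (c (r i) : WithTop NNRat)) ≤
              ∑ i ∈ Finset.range k, ((c (p i) : WithTop NNRat) + (c (r i) : WithTop NNRat)) :=
            Finset.sum_le_sum_of_subset (Finset.range_mono hjk)
          rw [Finset.sum_range_succ _ (j + 1)] at hsub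
          refine le_trans ?_ (add_le_add hsub (le_add_of_nonneg_left zero_le))
          rw [add_right_comm]
          gcongr
          exact le_add_of_nonneg_right zero_le
        · subst hjk
          rw [Finset.sum_range_succ _ (j.succ), add_assoc, add_comm (c (r _) : WithTop NNRat)]
    _ = (cost c (stairVertices k p r) : NNRat) := by
        rw [cost, hs.sum_stairVertices]
        push_cast
        rfl

theorem mem_stairVertices_extend {k : ℕ} {p r : ℕ → Vertex m n} {a b x : Vertex m n} :
    x ∈ stairVertices (k + 1) (Function.update p (k + 1) a) (Function.update r (k + 1) b) ↔
      x ∈ stairVertices k p r ∨ x = a ∨ x = b := by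
  simp only [mem_stairVertices]
  constructor
  · rintro ⟨j, hj, h⟩
    rcases hj.lt_or_eq with hj | rfl
    · rw [Function.update_of_ne (by omega), Function.update_of_ne (by omega)] at h
      exact .inl ⟨j, by omega, h⟩
    · simp only [Function.update_self] at h
      exact .inr h
  · rintro (⟨j, hj, h⟩ | h)
    · refine ⟨j, by omega, ?_⟩
      rwa [Function.update_of_ne (by omega), Function.update_of_ne (by omega)]
    · exact ⟨k + 1, le_rfl, by simpa using h⟩

theorem sum_extend {M : Type*} [AddCommMonoid M] {k : ℕ} {p r : ℕ → Vertex m n} {a b : Vertex m n}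
    (g : Vertex m n → M) :
    ∑ i ∈ Finset.range (k + 1 + 1), (g (Function.update p (k + 1) a i) +
      g (Function.update r (k + 1) b i)) =
      ∑ i ∈ Finset.range (k + 1), (g (p i) + g (r i)) + (g a + g b) := by
  rw [Finset.sum_range_succ, Function.update_self, Function.update_self]
  congr 1
  refine Finset.sum_congr rfl fun i hi => ?_
  rw [Finset.mem_range] at hi
  rw [Function.update_of_ne (by omega), Function.update_of_ne (by omega)]

/-- The positions of a set of vertices, as pairs of numbers. -/
def positions (L : Finset (Vertex m n)) : Finset (ℕ × ℕ) :=
  L.image fun v => ((v.1 : ℕ), (v.2 : ℕ))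

/-- Print the vertices of a stair, from the last to the first, where its last row is given in the
index register `3` and its last column in the index register `1`. -/
def trace : Program :=
  .while (.ile (.lit 1) (.reg 3)) <|
    .seq (.emit (.reg 3) (.arr 0 (.reg 3) (.reg 1))) <|
    .seq (.setI 3 (.arr 2 (.reg 3) (.reg 1))) <|
    .seq (.emit (.arr 1 (.reg 3) (.reg 1)) (.reg 1)) <|
    .setI 1 (.arr 3 (.reg 3) (.reg 1))

theorem reaches_trace_step {σ : State} {s d T : ℕ} {Q : State → Prop} (hs : 1 ≤ s)
    (h₃ : σ.ireg 3 = s) (h₁ : σ.ireg 1 = d)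
    (h : ∀ τ : State, τ.iarr = σ.iarr → τ.ireg 3 = σ.iarr 2 s d →
      τ.ireg 1 = σ.iarr 3 (σ.iarr 2 s d) d →
      τ.out = σ.out ++ [(s, σ.iarr 0 s d), (σ.iarr 1 (σ.iarr 2 s d) d, d)] →
      Reaches I trace τ T Q) :
    Reaches I trace σ (T + 5) Q := by
  refine (Reaches.while_true (T := 4) (R := fun τ => τ.iarr = σ.iarr ∧ τ.ireg 3 = σ.iarr 2 s d ∧
    τ.ireg 1 = σ.iarr 3 (σ.iarr 2 s d) d ∧
    τ.out = σ.out ++ [(s, σ.iarr 0 s d), (σ.iarr 1 (σ.iarr 2 s d) d, d)])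
    (by simpa [Test.Holds, IExp.eval, h₃] using hs)
    ((Reaches.emit rfl).seq (T' := 3) fun τ₁ hτ₁ => (Reaches.setI rfl).seq (T' := 2)
      fun τ₂ hτ₂ => (Reaches.emit rfl).seq (T' := 1) fun τ₃ hτ₃ => Reaches.setI ?_)
    fun τ hτ => h τ hτ.1 hτ.2.1 hτ.2.2.1 hτ.2.2.2).mono (by omega) fun _ h => h
  subst hτ₃ hτ₂ hτ₁
  simp [IExp.eval, h₁, h₃]

theorem IsTable.exists_isStair (h : IsTable I m n m m m C A) (hI : Describes I m n c) (s : ℕ) :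
    1 ≤ s → s < m → ∀ d < n, C 2 s d + C 0 s d ≠ ⊤ → ∃ k p r, IsStair (m := m) (n := n) k p r ∧
      ((r k).1 : ℕ) = s ∧ ((p k).2 : ℕ) = d ∧
      ∑ i ∈ Finset.range (k + 1), ((c (p i) : WithTop NNRat) + (c (r i) : WithTop NNRat)) =
        C 2 s d + C 0 s d ∧
      ∀ τ : State, τ.iarr = A → τ.ireg 3 = s → τ.ireg 1 = d → Reaches I trace τ (5 * s + 1)
        fun τ' => τ'.out.toFinset = τ.out.toFinset ∪ positions (stairVertices k p r) := by
  induction s using Nat.strong_induction_on with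
  | _ s ih =>
    intro hs hsm d hd hne
    rw [WithTop.add_ne_top] at hne
    obtain ⟨-, hs₀, hC2⟩ := (h.down s hs hsm d hd).attained hne.1
    obtain ⟨-, hx, hC0⟩ := (h.left s hsm d hd).attained hne.2
    have hne' := hne.1
    rw [← hC2, WithTop.add_ne_top] at hne'
    obtain ⟨-, hb, hC1⟩ := (h.up (A 2 s d) (by omega) d hd).attained hne'.2
    let a : Vertex m n := (⟨A 1 (A 2 s d) d, by omega⟩, ⟨d, hd⟩)
    let b : Vertex m n := (⟨s, hsm⟩, ⟨A 0 s d, by omega⟩)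
    have ha : (c a : WithTop NNRat) = C 1 (A 2 s d) d := (hI.entry a).symm.trans hC1
    have hb' : (c b : WithTop NNRat) = C 0 s d := (hI.entry b).symm.trans hC0
    rcases Nat.eq_zero_or_pos (A 2 s d) with h₀ | h₀
    · refine ⟨0, fun _ => a, fun _ => b, ⟨?_, hs, fun _ _ => Nat.le_of_lt_succ hx,
        fun _ h => by omega, fun _ h => by omega, fun _ h => by omega⟩, rfl, rfl, ?_, ?_⟩
      · change A 1 (A 2 s d) d = 0
        omega
      · rw [Finset.sum_range_one, ha, hb', ← hC2, h₀, h.start, zero_add]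
      · rintro τ rfl h₃ h₁
        refine (reaches_trace_step (T := 1) hs h₃ h₁ fun τ' hA h₃' h₁' ho => ?_).mono
          (by omega) fun _ h => h
        refine Reaches.while_false (by simp [Test.Holds, IExp.eval, h₃', h₀]) ?_
        rw [ho]
        ext y
        simp only [List.mem_toFinset, List.mem_append, Finset.mem_union, positions,
          Finset.mem_image, mem_stairVertices, List.mem_cons, List.not_mem_nil, or_false]
        refine or_congr_right ⟨?_, ?_⟩
        · rintro (rfl | rfl)
          exacts [⟨b, ⟨0, le_rfl, .inr rfl⟩, rfl⟩, ⟨a, ⟨0, le_rfl, .inl rfl⟩, rfl⟩]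
        · rintro ⟨_, ⟨_, _, rfl | rfl⟩, rfl⟩
          exacts [.inr rfl, .inl rfl]
    · obtain ⟨-, hd₀, hC3⟩ := (h.right (A 2 s d) h₀ (by omega) d hd).attained hne'.1
      have hne'' := hne'.1
      rw [← hC3] at hne''
      obtain ⟨k, p, r, hst, hr, hp, hsum, hreach⟩ := ih (A 2 s d) hs₀ h₀ (by omega)
        (A 3 (A 2 s d) d) (by omega) hne''
      refine ⟨k + 1, _, _, hst.extend (a := a) (b := b) (Nat.le_of_lt_succ hx) ?_ ?_ ?_, ?_, ?_,
        ?_, ?_⟩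
      · rw [hr]
        exact hs₀
      · rw [hr]
        exact Nat.le_of_lt_succ hb
      · rw [hp]
        exact hd₀
      · rw [Function.update_self]
      · rw [Function.update_self]
      · rw [sum_extend (fun v => (c v : WithTop NNRat)), hsum, ha, hb', hC3, ← hC2, add_assoc]
      · rintro τ rfl h₃ h₁
        refine (reaches_trace_step (T := 5 * τ.iarr 2 s d + 1) hs h₃ h₁
          fun τ' hA h₃' h₁' ho => (hreach τ' hA h₃' h₁').mono le_rfl fun τ'' h => ?_).mono
          (by omega) fun _ h => h
        rw [h, ho]
        ext y
        simp only [List.mem_toFinset, List.mem_append, Finset.mem_union, positions,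
          Finset.mem_image, mem_stairVertices_extend, List.mem_cons, List.not_mem_nil, or_false]
        constructor
        · rintro ((h | rfl | rfl) | ⟨v, hv, rfl⟩)
          exacts [.inl h, .inr ⟨b, .inr (.inr rfl), rfl⟩, .inr ⟨a, .inr (.inl rfl), rfl⟩,
            .inr ⟨v, .inl hv, rfl⟩]
        · rintro (h | ⟨v, hv | rfl | rfl, rfl⟩)
          exacts [.inl (.inl h), .inr ⟨v, hv, rfl⟩, .inl (.inr (.inr rfl)),
            .inl (.inr (.inl rfl))]

end Math

/-- The first phase: the tables `0` and `1`. -/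
def bestVertices : Program :=
  .seq (.setI 0 (.lit 0)) <| loop 0 .rows <|
    .seq (fillRow 0 .cols (.lit 0) (.add (.reg 1) (.lit 1)) (.input (.reg 0) (.reg 2)))
      (fillRow 1 .cols (.lit 0) (.add (.reg 0) (.lit 1)) (.input (.reg 2) (.reg 1)))

/-- The second phase: the tables `2` and `3`. -/
def bestStairs : Program :=
  .seq (.setI 0 (.lit 1)) <| loop 0 .rows <|
    .seq (fillRow 2 .cols (.lit 0) (.reg 0)
        (.add (.arr 3 (.reg 2) (.reg 1)) (.arr 1 (.reg 2) (.reg 1))))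
      (fillRow 3 .cols (.lit 0) (.reg 1)
        (.add (.arr 2 (.reg 0) (.reg 2)) (.arr 0 (.reg 0) (.reg 2))))

/-- The third phase: the table `4`. -/
def bestEnds : Program :=
  .seq (.setI 0 (.lit 1)) <| loop 0 .rows <|
    fillRow 4 .cols (.lit 0) (.add (.reg 1) (.lit 1))
      (.add (.arr 3 (.reg 0) (.reg 2)) (.input lastRow (.reg 2)))

/-- The solver for the perfect sets, in one orientation. -/
def stairSolver : Solver where
  find := .seq bestVertices <| .seq bestStairs <| .seq bestEnds <| .seq (.setI 0 (.lit 0)) <|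
    .seq (fillRow 5 .rows (.lit 0) .cols
      (.add (.arr 4 (.reg 1) (.reg 2)) (.arr 1 (.reg 1) (.reg 2)))) <|
    .seq (argmin (.lit 1) lastRow (.arr 5 (.lit 0) (.reg 2))) <| .setC 0 (.reg 1)
  print := .ite (.cle .infty (.reg 0)) .skip <|
    .seq (.setI 1 (.arr 5 (.lit 0) (.reg 3))) <|
    .seq (.emit (.arr 1 (.reg 3) (.reg 1)) (.reg 1)) <|
    .seq (.setI 1 (.arr 4 (.reg 3) (.reg 1))) <|
    .seq (.emit lastRow (.reg 1)) <|
    .seq (.setI 1 (.arr 3 (.reg 3) (.reg 1))) trace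

section Phases

variable {I : Input} {m n : ℕ}

/-- The time for one row of a table. -/
def rowTime (m n : ℕ) : ℕ := n * (5 * (m + n) + 7) + 2

theorem reaches_bestVertices (hrows : I.rows = m) (hcols : I.cols = n) :
    Reaches I bestVertices .init (1 + (m * (2 * rowTime m n + 2) + 1)) fun τ =>
      IsTable I m n m 1 1 τ.carr τ.iarr ∧ τ.out = [] := by
  refine (Reaches.setI rfl).seq fun σ hσ => ?_
  refine (Reaches.loop (B := 2 * rowTime m n) (N := m) (fun k τ => τ.ireg 0 = k ∧
    IsTable I m n k 1 1 τ.carr τ.iarr ∧ τ.out = []) (by intro k τ h; exact ⟨h.1, hrows⟩) ?_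
    (Nat.zero_le m) ?_).mono (by rw [Nat.sub_zero]) fun τ h => h.2
  · rintro k τ hk ⟨h₀, hT, ho⟩
    rw [two_mul]
    refine (reaches_fillRow (s := k) (N := n) (H := m + n) (l := fun _ => 0)
      (h := fun d => d + 1) (f := fun _ i => I.entry k i) h₀ (by omega)
      (by intro τ _; exact hcols) ?_).seq fun τ₁ ⟨h₁, hm₁⟩ =>
      Reaches.mono (reaches_fillRow (s := k) (N := n) (H := m + n) (l := fun _ => 0)
      (h := fun _ => k + 1) (f := fun d i => I.entry i d) (h₁.ireg.trans h₀) (by omega)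
      (by intro τ _; exact hcols) ?_) le_rfl ?_
    · intro τ' h' _
      exact ⟨rfl, rfl, by simp only [CExp.eval, IExp.eval, h'.ireg, h₀]⟩
    · intro τ' h' _
      exact ⟨rfl, by simp only [IExp.eval, h'.ireg, h₁.ireg, h₀], rfl⟩
    · rintro τ₂ ⟨h₂, hm₂⟩
      refine ⟨h₂.ireg.trans (h₁.ireg.trans h₀), by simp, ⟨fun s hs d hd => ?_, fun s hs d hd => ?_,
        by omega, by omega, fun d => ?_, by omega⟩, h₂.out.trans (h₁.out.trans ho)⟩
      · rcases (Nat.lt_succ_iff.1 hs).lt_or_eq with hs | rfl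
        · refine (hT.left s hs d hd).congr (fun _ _ _ => rfl) ?_ ?_
          · rw [h₂.carr _ _ _ (by omega), h₁.carr _ _ _ (by omega)]
          · rw [h₂.iarr _ _ _ (by omega), h₁.iarr _ _ _ (by omega)]
        · refine (hm₁ d hd).congr (fun _ _ _ => rfl) ?_ ?_
          · rw [h₂.carr _ _ _ (by omega)]
          · rw [h₂.iarr _ _ _ (by omega)]
      · rcases (Nat.lt_succ_iff.1 hs).lt_or_eq with hs | rfl
        · refine (hT.up s hs d hd).congr (fun _ _ _ => rfl) ?_ ?_
          · rw [h₂.carr _ _ _ (by omega), h₁.carr _ _ _ (by omega)]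
          · rw [h₂.iarr _ _ _ (by omega), h₁.iarr _ _ _ (by omega)]
        · exact hm₂ d hd
      · rw [h₂.carr _ _ _ (by omega), h₁.carr _ _ _ (by omega), hT.start]
  · subst hσ
    exact ⟨rfl, ⟨by omega, by omega, by omega, by omega, fun _ => rfl, by omega⟩, rfl⟩

theorem reaches_bestStairs (hrows : I.rows = m) (hcols : I.cols = n) (hm : 1 ≤ m) {σ : State}
    (h : IsTable I m n m 1 1 σ.carr σ.iarr ∧ σ.out = []) :
    Reaches I bestStairs σ (1 + (m * (2 * rowTime m n + 2) + 1)) fun τ =>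
      IsTable I m n m m 1 τ.carr τ.iarr ∧ τ.out = [] := by
  refine (Reaches.setI rfl).seq fun σ' hσ' => ?_
  refine (Reaches.loop (B := 2 * rowTime m n) (N := m) (fun k τ => τ.ireg 0 = k ∧ 1 ≤ k ∧
    IsTable I m n m k 1 τ.carr τ.iarr ∧ τ.out = []) (by intro k τ h; exact ⟨h.1, hrows⟩) ?_
    hm ?_).mono (by gcongr; omega) fun τ h => h.2.2
  · rintro k τ hk ⟨h₀, hk₁, hT, ho⟩
    rw [two_mul]
    refine (reaches_fillRow (s := k) (N := n) (H := m + n) (l := fun _ => 0)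
      (h := fun _ => k) (f := fun d i => τ.carr 3 i d + τ.carr 1 i d) h₀ (by omega)
      (by intro τ _; exact hcols) ?_).seq fun τ₁ ⟨h₁, hm₁⟩ =>
      Reaches.mono (reaches_fillRow (s := k) (N := n) (H := m + n) (l := fun _ => 0)
      (h := fun d => d) (f := fun _ i => τ₁.carr 2 k i + τ₁.carr 0 k i) (h₁.ireg.trans h₀)
      (by omega) (by intro τ _; exact hcols) ?_) le_rfl ?_
    · intro τ' h' _
      refine ⟨rfl, by simp only [IExp.eval, h'.ireg, h₀], ?_⟩
      simp only [CExp.eval, IExp.eval]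
      rw [h'.carr 3 _ _ (by omega), h'.carr 1 _ _ (by omega)]
    · intro τ' h' _
      refine ⟨rfl, rfl, ?_⟩
      simp only [CExp.eval, IExp.eval]
      rw [h'.carr 2 _ _ (by omega), h'.carr 0 _ _ (by omega), h'.ireg, h₁.ireg, h₀]
    · rintro τ₂ ⟨h₂, hm₂⟩
      refine ⟨h₂.ireg.trans (h₁.ireg.trans h₀), by simp, by omega, ⟨fun s hs d hd => ?_,
        fun s hs d hd => ?_, fun s hs₁ hs d hd => ?_, fun s hs₁ hs d hd => ?_, fun d => ?_,
        by omega⟩, h₂.out.trans (h₁.out.trans ho)⟩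
      · refine (hT.left s hs d hd).congr (fun _ _ _ => rfl) ?_ ?_
        · rw [h₂.carr _ _ _ (by omega), h₁.carr _ _ _ (by omega)]
        · rw [h₂.iarr _ _ _ (by omega), h₁.iarr _ _ _ (by omega)]
      · refine (hT.up s hs d hd).congr (fun _ _ _ => rfl) ?_ ?_
        · rw [h₂.carr _ _ _ (by omega), h₁.carr _ _ _ (by omega)]
        · rw [h₂.iarr _ _ _ (by omega), h₁.iarr _ _ _ (by omega)]
      · rcases (Nat.lt_succ_iff.1 hs).lt_or_eq with hs | rfl
        · refine (hT.down s hs₁ hs d hd).congr (fun i _ _ => ?_) ?_ ?_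
          · rw [h₂.carr 3 _ _ (by omega), h₁.carr 3 _ _ (by omega), h₂.carr 1 _ _ (by omega),
              h₁.carr 1 _ _ (by omega)]
          · rw [h₂.carr _ _ _ (by omega), h₁.carr _ _ _ (by omega)]
          · rw [h₂.iarr _ _ _ (by omega), h₁.iarr _ _ _ (by omega)]
        · refine (hm₁ d hd).congr (fun i _ _ => ?_) ?_ ?_
          · rw [h₂.carr 3 _ _ (by omega), h₁.carr 3 _ _ (by omega), h₂.carr 1 _ _ (by omega),
              h₁.carr 1 _ _ (by omega)]
          · rw [h₂.carr _ _ _ (by omega)]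
          · rw [h₂.iarr _ _ _ (by omega)]
      · rcases (Nat.lt_succ_iff.1 hs).lt_or_eq with hs | rfl
        · refine (hT.right s hs₁ hs d hd).congr (fun i _ _ => ?_) ?_ ?_
          · rw [h₂.carr 2 _ _ (by omega), h₁.carr 2 _ _ (by omega), h₂.carr 0 _ _ (by omega),
              h₁.carr 0 _ _ (by omega)]
          · rw [h₂.carr _ _ _ (by omega), h₁.carr _ _ _ (by omega)]
          · rw [h₂.iarr _ _ _ (by omega), h₁.iarr _ _ _ (by omega)]
        · refine (hm₂ d hd).congr (fun i _ _ => ?_) rfl rfl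
          rw [h₂.carr 2 _ _ (by omega), h₂.carr 0 _ _ (by omega)]
      · rw [h₂.carr _ _ _ (by omega), h₁.carr _ _ _ (by omega), hT.start]
  · subst hσ'
    exact ⟨by simp [IExp.eval], le_rfl, h⟩

theorem reaches_bestEnds (hrows : I.rows = m) (hcols : I.cols = n) (hm : 1 ≤ m) {σ : State}
    (h : IsTable I m n m m 1 σ.carr σ.iarr ∧ σ.out = []) :
    Reaches I bestEnds σ (1 + (m * (rowTime m n + 2) + 1)) fun τ =>
      IsTable I m n m m m τ.carr τ.iarr ∧ τ.out = [] := by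
  refine (Reaches.setI rfl).seq fun σ' hσ' => ?_
  refine (Reaches.loop (B := rowTime m n) (N := m) (fun k τ => τ.ireg 0 = k ∧
    IsTable I m n m m k τ.carr τ.iarr ∧ τ.out = []) (by intro k τ h; exact ⟨h.1, hrows⟩) ?_
    hm ?_).mono (by gcongr; omega) fun τ h => h.2
  · rintro k τ hk ⟨h₀, hT, ho⟩
    refine Reaches.mono (reaches_fillRow (s := k) (N := n) (H := m + n) (l := fun _ => 0)
      (h := fun d => d + 1) (f := fun _ i => τ.carr 3 k i + I.entry (m - 1) i) h₀ (by omega)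
      (by intro τ _; exact hcols) ?_) le_rfl ?_
    · intro τ' h' _
      refine ⟨rfl, rfl, ?_⟩
      simp only [CExp.eval, IExp.eval, lastRow, hrows]
      rw [h'.carr 3 _ _ (by omega), h'.ireg, h₀]
    · rintro τ₁ ⟨h₁, hm₁⟩
      refine ⟨h₁.ireg.trans h₀, by simp, ⟨fun s hs d hd => ?_,
        fun s hs d hd => ?_, fun s hs₁ hs d hd => ?_, fun s hs₁ hs d hd => ?_, fun d => ?_,
        fun s hs₁ hs d hd => ?_⟩, h₁.out.trans ho⟩
      · exact (hT.left s hs d hd).congr (fun _ _ _ => rfl) (h₁.carr _ _ _ (by omega))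
          (h₁.iarr _ _ _ (by omega))
      · exact (hT.up s hs d hd).congr (fun _ _ _ => rfl) (h₁.carr _ _ _ (by omega))
          (h₁.iarr _ _ _ (by omega))
      · refine (hT.down s hs₁ hs d hd).congr (fun i _ _ => ?_) (h₁.carr _ _ _ (by omega))
          (h₁.iarr _ _ _ (by omega))
        rw [h₁.carr 3 _ _ (by omega), h₁.carr 1 _ _ (by omega)]
      · refine (hT.right s hs₁ hs d hd).congr (fun i _ _ => ?_) (h₁.carr _ _ _ (by omega))
          (h₁.iarr _ _ _ (by omega))
        rw [h₁.carr 2 _ _ (by omega), h₁.carr 0 _ _ (by omega)]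
      · rw [h₁.carr _ _ _ (by omega), hT.start]
      · rcases (Nat.lt_succ_iff.1 hs).lt_or_eq with hs | rfl
        · refine (hT.last s hs₁ hs d hd).congr (fun i _ _ => ?_) (h₁.carr _ _ _ (by omega))
            (h₁.iarr _ _ _ (by omega))
          rw [h₁.carr 3 _ _ (by omega)]
        · refine (hm₁ d hd).congr (fun i _ _ => ?_) rfl rfl
          rw [h₁.carr 3 _ _ (by omega)]
  · subst hσ'
    exact ⟨by simp [IExp.eval], h⟩

end Phases

theorem findsCost_perfectSets {m n : ℕ} {c : Vertex m n → NNRat} {w : WithTop NNRat}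
    {o : List (ℕ × ℕ)} (h : FindsCost c (stairSets m n c) w o) :
    FindsCost c (perfectSets m n c) w o := by
  rcases h with ⟨L, hL, ho, hw⟩ | ⟨hF, ho, hw⟩
  · exact .inl ⟨L, ⟨mem_perfectSets_of_isCheapest hL,
      fun L' hL' => hL.2 L' (mem_stairSets_of_mem_perfectSets hL')⟩, ho, hw⟩
  · exact .inr ⟨Set.eq_empty_of_forall_notMem fun L hL => by
      have := mem_stairSets_of_mem_perfectSets hL
      rwa [hF] at this, ho, hw⟩

/-- The tables determine the cost of a cheapest stair, and printing its last two vertices and then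
following the places where the minima are attained produces such a stair. -/
theorem reaches_stairSolver_print {I : Input} {m n : ℕ} (hm : 2 ≤ m) {c : Vertex m n → NNRat}
    (hI : Describes I m n c) {σ : State} (hT : IsTable I m n m m m σ.carr σ.iarr)
    (hH : ∀ s < m, IsMin 0 n (fun i => σ.carr 4 s i + σ.carr 1 s i) (σ.carr 5 0 s) (σ.iarr 5 0 s))
    (hw : IsMin 1 (m - 1) (σ.carr 5 0) (σ.creg 0) (σ.ireg 3)) (ho : σ.out = []) :
    Reaches I stairSolver.print σ (5 * m + 7) fun τ =>
      FindsCost c (stairSets m n c) (σ.creg 0) τ.out := by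
  have hle : ∀ L ∈ stairSets m n c, σ.creg 0 ≤ (cost c L : NNRat) := by
    rintro _ ⟨k, p, r, hs, rfl⟩
    obtain ⟨s, hs₁, hs₂, d, hd, h⟩ := hT.exists_le_cost hI hs
    exact (hw.le s hs₁ hs₂).trans (((hH s (by omega)).le d (Nat.zero_le _) hd).trans h)
  refine Reaches.ite (T := 5 * m + 6) (fun htop => ?_) fun htop => ?_
  · have htop : σ.creg 0 = ⊤ := by simpa [Test.Holds, CExp.eval] using htop
    exact (Reaches.skip (.intro (fun h => absurd htop h) hle fun _ => ho)).mono (by omega)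
      fun _ h => h
  have hne : σ.creg 0 ≠ ⊤ := by simpa [Test.Holds, CExp.eval] using htop
  obtain ⟨hs₁, hs₂, hs⟩ := hw.attained hne
  generalize hsd : σ.ireg 3 = s at *
  obtain ⟨-, hd, hd'⟩ := (hH s (by omega)).attained (by rwa [hs])
  generalize hdd : σ.iarr 5 0 s = d at *
  have hne₁ : σ.carr 4 s d + σ.carr 1 s d ≠ ⊤ := by rwa [hd', hs]
  rw [WithTop.add_ne_top] at hne₁
  obtain ⟨-, hx, hx'⟩ := (hT.last s hs₁ (by omega) d hd).attained hne₁.1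
  obtain ⟨-, hb, hb'⟩ := (hT.up s (by omega) d hd).attained hne₁.2
  generalize hxx : σ.iarr 4 s d = x at *
  have hne₂ := hne₁.1
  rw [← hx', WithTop.add_ne_top] at hne₂
  obtain ⟨-, hd₀, hd₀'⟩ := (hT.right s hs₁ (by omega) x (by omega)).attained hne₂.1
  have hne₃ := hne₂.1
  rw [← hd₀'] at hne₃
  obtain ⟨k, p, r, hst, hr, hp, hsum, hreach⟩ := hT.exists_isStair hI s hs₁ (by omega)
    (σ.iarr 3 s x) (by omega) hne₃
  let a : Vertex m n := (⟨σ.iarr 1 s d, by omega⟩, ⟨d, hd⟩)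
  let b : Vertex m n := (⟨m - 1, by omega⟩, ⟨x, by omega⟩)
  have ha : (c a : WithTop NNRat) = σ.carr 1 s d := (hI.entry a).symm.trans hb'
  have hbx : (c b : WithTop NNRat) = I.entry (m - 1) x := (hI.entry b).symm
  have hext := hst.extend (a := a) (b := b) (Nat.le_of_lt_succ hx) (by rw [hr]; exact hs₂)
    (by rw [hr]; exact Nat.le_of_lt_succ hb) (by rw [hp]; change _ < d; omega)
  have hfull : IsFullStair (k + 1) (Function.update p (k + 1) a) (Function.update r (k + 1) b) := by
    refine ⟨hext, ?_, ?_⟩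
    · rw [Function.update_self]
      change m - 1 + 1 = m
      omega
    · rw [Function.update_self, Function.update_of_ne (by omega)]
      change _ < x
      rcases Nat.eq_zero_or_pos k with rfl | hk
      · omega
      · have := hst.p_lt hk le_rfl
        omega
  have hcost : σ.creg 0 = (cost c (stairVertices (k + 1) (Function.update p (k + 1) a)
      (Function.update r (k + 1) b)) : NNRat) := by
    rw [cost, hext.sum_stairVertices, sum_extend]
    push_cast
    rw [hsum, ha, hbx, hd₀', ← hs, ← hd', ← hx', add_assoc, add_comm (I.entry _ _)]
  refine Reaches.mono (T := 1 + (1 + (1 + (1 + (1 + (5 * s + 1)))))) ?_ (by omega) fun _ h => h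
  refine (Reaches.setI rfl).seq fun τ₁ hτ₁ => (Reaches.emit rfl).seq fun τ₂ hτ₂ =>
    (Reaches.setI rfl).seq fun τ₃ hτ₃ => (Reaches.emit rfl).seq fun τ₄ hτ₄ =>
    (Reaches.setI rfl).seq fun τ₅ hτ₅ => (hreach τ₅ ?_ ?_ ?_).mono le_rfl fun τ hτ =>
      FindsCost.intro (fun _ => ⟨_, ⟨k + 1, _, _, hfull, rfl⟩, ?_, hcost⟩) hle
        fun h => absurd h hne
  · subst hτ₅ hτ₄ hτ₃ hτ₂ hτ₁
    rfl
  · subst hτ₅ hτ₄ hτ₃ hτ₂ hτ₁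
    simp [IExp.eval, hsd]
  · subst hτ₅ hτ₄ hτ₃ hτ₂ hτ₁
    simp [IExp.eval, hsd, hdd, hxx]
  · have hout : τ₅.out = [(σ.iarr 1 s d, d), (m - 1, x)] := by
      subst hτ₅ hτ₄ hτ₃ hτ₂ hτ₁
      simp [IExp.eval, hsd, hdd, hxx, ho, lastRow, hI.rows]
    rw [Lists, hτ, hout]
    ext y
    simp only [List.mem_toFinset, Finset.mem_union, positions,
      Finset.mem_image, mem_stairVertices_extend, List.mem_cons, List.not_mem_nil, or_false]
    constructor
    · rintro ((rfl | rfl) | ⟨v, hv, rfl⟩)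
      exacts [⟨a, .inr (.inl rfl), rfl⟩, ⟨b, .inr (.inr rfl), rfl⟩, ⟨v, .inl hv, rfl⟩]
    · rintro ⟨v, hv | rfl | rfl, rfl⟩
      exacts [.inr ⟨v, hv, rfl⟩, .inl (.inl rfl), .inl (.inr rfl)]

theorem solves_stairSolver :
    stairSolver.Solves perfectSets fun m n => 500 * ((m + n) * (m * n)) := by
  intro m n hm hn c I hI
  have hrows := hI.rows
  have hcols := hI.cols
  have hT : (1 + (m * (2 * rowTime m n + 2) + 1)) + ((1 + (m * (2 * rowTime m n + 2) + 1)) +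
      ((1 + (m * (rowTime m n + 2) + 1)) + (1 + ((m * (5 * n + 7) + 2) +
      ((5 * (m - 1) + 3) + 1))))) + (5 * m + 7) ≤ 500 * ((m + n) * (m * n)) := by
    obtain ⟨a, rfl⟩ := Nat.exists_eq_add_of_le hm
    obtain ⟨b, rfl⟩ := Nat.exists_eq_add_of_le hn
    rw [show 2 + a - 1 = a + 1 by omega, rowTime]
    ring_nf
    nlinarith [Nat.zero_le (a * b), Nat.zero_le (a * b * b), Nat.zero_le (a * a * b)]
  refine (Solver.SolvesAt.of_reaches ?_).mono hT
  refine (reaches_bestVertices hrows hcols).seq fun σ₁ h₁ =>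
    (reaches_bestStairs hrows hcols (by omega) h₁).seq fun σ₂ h₂ =>
    (reaches_bestEnds hrows hcols (by omega) h₂).seq fun σ₃ ⟨h₃, ho₃⟩ =>
    (Reaches.setI rfl).seq fun σ₄ hσ₄ => ?_
  have h₄ : σ₄.ireg 0 = 0 := by
    rw [← hσ₄]
    simp [IExp.eval]
  have hc₄ : σ₄.carr = σ₃.carr := by rw [← hσ₄]
  have ha₄ : σ₄.iarr = σ₃.iarr := by rw [← hσ₄]
  have ho₄ : σ₄.out = [] := by rw [← hσ₄, ho₃]
  rw [← hc₄, ← ha₄] at h₃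
  refine (reaches_fillRow (I := I) (s := 0) (N := m) (H := n) (l := fun _ => 0)
    (h := fun _ => n) (f := fun s i => σ₄.carr 4 s i + σ₄.carr 1 s i) h₄ (by omega)
    (by intro τ _; exact hrows) ?_).seq fun σ₅ ⟨h₅, hH⟩ => ?_
  · intro τ h _
    refine ⟨rfl, hcols, ?_⟩
    simp only [CExp.eval, IExp.eval]
    rw [h.carr 4 _ _ (by omega), h.carr 1 _ _ (by omega)]
  have hc₅ : ∀ B i j, B ≠ 5 → σ₅.carr B i j = σ₄.carr B i j := fun B i j hB =>
    h₅.carr _ _ _ fun h => hB h.1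
  have ha₅ : ∀ B i j, B ≠ 5 → σ₅.iarr B i j = σ₄.iarr B i j := fun B i j hB =>
    h₅.iarr _ _ _ fun h => hB h.1
  refine (reaches_argmin (l := 1) (N := m - 1) (f := σ₅.carr 5 0) rfl (by omega)
    (fun i a v => by simp [lastRow, IExp.eval, hrows])
    (fun i a v => by simp [IExp.eval, CExp.eval, State.scratch])).seq fun τ ⟨w, z, hτ, hw⟩ => ?_
  subst hτ
  refine Reaches.setC ⟨h₅.out.trans ho₄, (reaches_stairSolver_print hm hI ?_ ?_ ?_ ?_).mono le_rfl
    fun τ hτ => findsCost_perfectSets hτ⟩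
  · refine ⟨fun s hs d hd => ?_, fun s hs d hd => ?_, fun s hs₁ hs d hd => ?_,
      fun s hs₁ hs d hd => ?_, fun d => ?_, fun s hs₁ hs d hd => ?_⟩
    · exact (h₃.left s hs d hd).congr (fun i _ _ => rfl) (hc₅ _ _ _ (by decide))
        (ha₅ _ _ _ (by decide))
    · exact (h₃.up s hs d hd).congr (fun i _ _ => rfl) (hc₅ _ _ _ (by decide))
        (ha₅ _ _ _ (by decide))
    · exact (h₃.down s hs₁ hs d hd).congr (fun i _ _ => congrArg₂ _ (hc₅ _ _ _ (by decide))
        (hc₅ _ _ _ (by decide))) (hc₅ _ _ _ (by decide)) (ha₅ _ _ _ (by decide))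
    · exact (h₃.right s hs₁ hs d hd).congr (fun i _ _ => congrArg₂ _ (hc₅ _ _ _ (by decide))
        (hc₅ _ _ _ (by decide))) (hc₅ _ _ _ (by decide)) (ha₅ _ _ _ (by decide))
    · exact (hc₅ _ _ _ (by decide)).trans (h₃.start d)
    · exact (h₃.last s hs₁ hs d hd).congr (fun i _ _ => congrArg₂ _ (hc₅ _ _ _ (by decide))
        rfl) (hc₅ _ _ _ (by decide)) (ha₅ _ _ _ (by decide))
  · exact fun s hs => (hH s hs).congr (fun i _ _ => congrArg₂ _ (hc₅ _ _ _ (by decide))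
        (hc₅ _ _ _ (by decide))) rfl rfl
  · simpa [CExp.eval, State.scratch] using hw
  · exact h₅.out.trans ho₄

/-! ### Cheapest landmark sets -/

/-- Among the cheapest landmark sets, one with the fewest vertices. -/
theorem exists_minimal_isCheapest (m n : ℕ) (hm : 2 ≤ m) (hn : 2 ≤ n) (c : Vertex m n → NNRat) :
    ∃ L, Minimal (IsLandmarkSet (grid m n)) L ∧ IsCheapest c (landmarkSets m n) L := by
  have huniv : IsLandmarkSet (grid m n) Finset.univ := by
    rw [isLandmarkSet_iff hm hn]
    refine ⟨fun i j hi hj => ⟨(⟨i, by omega⟩, ⟨j, by omega⟩), Finset.mem_univ _, by simp⟩,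
      fun i j hi hj => ⟨(⟨i, by omega⟩, ⟨j + 1, hj⟩), Finset.mem_univ _, by simp⟩,
      fun p hp hp' => ⟨(⟨0, by omega⟩, ⟨0, by omega⟩), Finset.mem_univ _, hp.ne⟩,
      fun p hp hp' => ⟨(⟨0, by omega⟩, ⟨0, by omega⟩), Finset.mem_univ _, hp.ne⟩⟩
  obtain ⟨L₀, hL₀, hmin₀⟩ := Set.exists_min_image (landmarkSets m n) (cost c)
    (Set.toFinite _) ⟨_, huniv⟩
  obtain ⟨L, hL, hmin⟩ := Set.exists_min_image {L | IsCheapest c (landmarkSets m n) L}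
    Finset.card (Set.toFinite _) ⟨L₀, hL₀, hmin₀⟩
  refine ⟨L, ⟨hL.1, fun S hS hSL => ?_⟩, hL⟩
  have hcost : cost c S ≤ cost c L := Finset.sum_le_sum_of_subset hSL
  have := hmin S ⟨hS, fun L' hL' => hcost.trans (hL.2 L' hL')⟩
  exact (Finset.eq_of_subset_of_card_le hSL this).ge

theorem mem_zigzagSets_of_isCheapest {m n : ℕ} (hm : 2 ≤ m) (hn : 2 ≤ n) {c : Vertex m n → NNRat}
    {L : Finset (Vertex m n)} (h : L ∈ stairSets.orientations m n c)
    (hL : IsCheapest c (landmarkSets m n) L) : L ∈ zigzagSets m n c := by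
  have key : ∀ {m' n' : ℕ} (e : Vertex m n ≃ Vertex m' n'), 2 ≤ m' → 2 ≤ n' →
      (∀ u v, (grid m' n').dist (e u) (e v) = (grid m n).dist u v) →
      L.map e.toEmbedding ∈ stairSets m' n' (c ∘ e.symm) →
      L.map e.toEmbedding ∈ perfectSets m' n' (c ∘ e.symm) := by
    intro m' n' e hm' hn' he hLe
    refine mem_perfectSets_of_isCheapest ⟨hLe, fun S hS => ?_⟩
    have hmap : (S.map e.symm.toEmbedding).map e.toEmbedding = S := by
      ext x
      simp only [Finset.mem_map_equiv, Equiv.symm_symm, Equiv.apply_symm_apply]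
    have hS' := (isLandmarkSet_stairSets m' n' hm' hn' _ S hS).1
    rw [← hmap, isLandmarkSet_map e he] at hS'
    rw [cost_map, ← hmap, cost_map]
    exact hL.2 _ hS'
  obtain ⟨r, f, h | h⟩ := h
  · exact ⟨r, f, .inl (key _ hm hn (dist_flip m n r f) h)⟩
  · exact ⟨r, f, .inr (key _ hn hm (fun u v =>
      (dist_prodComm m n (flip m n r f u) (flip m n r f v)).trans (dist_flip m n r f u v)) h)⟩

theorem isLandmarkSet_of_mem_families {m n : ℕ} (hm : 2 ≤ m) (hn : 2 ≤ n)
    {c : Vertex m n → NNRat} {S : Finset (Vertex m n)}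
    (h : S ∈ adjacentCornerPairs m n ∨ S ∈ triples m n c ∨ S ∈ stairSets.orientations m n c) :
    IsLandmarkSet (grid m n) S := by
  rcases h with h | h | h
  · exact (isLandmarkSet_adjacentCornerPairs hm hn S h).1
  · exact (isLandmarkSet_triples hm hn c S h).1
  · exact (Family.isLandmarkSet_of_mem_orientations (P := (4 ≤ ·)) isLandmarkSet_stairSets
      hm hn c S h).1

theorem mem_families_of_minimal {m n : ℕ} (hm : 2 ≤ m) (hn : 2 ≤ n) (c : Vertex m n → NNRat)
    {L : Finset (Vertex m n)} (hL : Minimal (IsLandmarkSet (grid m n)) L) :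
    L ∈ adjacentCornerPairs m n ∨ L ∈ triples m n c ∨ L ∈ stairSets.orientations m n c := by
  obtain ⟨S, hS, h⟩ := exists_subset_mem_families hm hn c hL.1
  obtain rfl : S = L := hS.antisymm (hL.2 (isLandmarkSet_of_mem_families hm hn h) hS)
  exact h

theorem card_stairSets_orientations {m n : ℕ} (hm : 2 ≤ m) (hn : 2 ≤ n) {c : Vertex m n → NNRat}
    {L : Finset (Vertex m n)} (h : L ∈ stairSets.orientations m n c) : 4 ≤ L.card :=
  (Family.isLandmarkSet_of_mem_orientations (P := (4 ≤ ·)) isLandmarkSet_stairSets hm hn c L h).2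

/-- A cheapest member of the three families is a cheapest landmark set, since an inclusion-minimal
cheapest landmark set belongs to one of the families. -/
theorem IsCheapest.landmarkSets {m n : ℕ} (hm : 2 ≤ m) (hn : 2 ≤ n) {c : Vertex m n → NNRat}
    {L : Finset (Vertex m n)}
    (h : IsCheapest c (adjacentCornerPairs m n ∪ (triples m n c ∪ zigzagSets m n c)) L) :
    IsCheapest c (landmarkSets m n) L := by
  obtain ⟨M, hM, hM'⟩ := exists_minimal_isCheapest m n hm hn c
  refine ⟨?_, fun L' hL' => (h.2 M ?_).trans (hM'.2 L' hL')⟩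
  · rcases h.1 with h | h | h
    · exact (isLandmarkSet_adjacentCornerPairs hm hn L h).1
    · exact (isLandmarkSet_triples hm hn c L h).1
    · exact (isLandmarkSet_zigzagSets hm hn c L h).1
  · rcases mem_families_of_minimal hm hn c hM with h | h | h
    exacts [.inl h, .inr (.inl h), .inr (.inr (mem_zigzagSets_of_isCheapest hm hn h hM'))]

/-- The solver for pairs of adjacent corners. -/
def cornerSolver : Solver := pairSolver.allOrientations

/-- The solver for triples. -/
def tripleSolver : Solver := leftSolver.allOrientations.select betweenSolver.allOrientations

/-- The solver for the vertex sets of perfect sequences. -/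
def zigzagSolver : Solver := stairSolver.allOrientations

theorem solvesAt_cornerSolver {m n : ℕ} (hm : 2 ≤ m) (hn : 2 ≤ n) (c : Vertex m n → NNRat) :
    cornerSolver.SolvesAt (Input.ofGrid m n c) c (adjacentCornerPairs m n) 45 := by
  have := solves_pairSolver.allOrientations (fun _ _ => rfl) m n hm hn c _ (describes_ofGrid m n c)
  rwa [orientations_topCornerPair hm hn] at this

theorem solvesAt_tripleSolver {m n : ℕ} (hm : 2 ≤ m) (hn : 2 ≤ n) (c : Vertex m n → NNRat) :
    tripleSolver.SolvesAt (Input.ofGrid m n c) c (triples m n c)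
      (1600 * ((m + n) * (m * n)) + 45) := by
  have h₁ := solves_leftSolver.allOrientations (fun _ _ => by ring) m n hm hn c _
    (describes_ofGrid m n c)
  have h₂ := solves_betweenSolver.allOrientations (fun _ _ => by ring) m n hm hn c _
    (describes_ofGrid m n c)
  rw [orientations_leftTriples] at h₁
  exact (h₁.select h₂).mono (by ring_nf; rfl)

theorem solvesAt_zigzagSolver {m n : ℕ} (hm : 2 ≤ m) (hn : 2 ≤ n) (c : Vertex m n → NNRat) :
    zigzagSolver.SolvesAt (Input.ofGrid m n c) c (zigzagSets m n c)
      (4000 * ((m + n) * (m * n)) + 21) :=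
  (solves_stairSolver.allOrientations (fun _ _ => by ring) m n hm hn c _
    (describes_ofGrid m n c)).mono (by ring_nf; rfl)

end WeightedGrid

theorem mainTheorem2 :
    (∀ m n : ℕ, 2 ≤ m → 2 ≤ n → ∀ c : WeightedGrid.Vertex m n → NNRat,
      (∀ L : Finset (WeightedGrid.Vertex m n),
        (WeightedGrid.IsLandmarkSet (WeightedGrid.grid m n) L ∧ L.card = 2) ↔
          L ∈ WeightedGrid.adjacentCornerPairs m n) ∧
      (∀ L ∈ WeightedGrid.triples m n c,
        WeightedGrid.IsLandmarkSet (WeightedGrid.grid m n) L ∧ L.card = 3) ∧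
      (∀ L : Finset (WeightedGrid.Vertex m n),
        Minimal (WeightedGrid.IsLandmarkSet (WeightedGrid.grid m n)) L → L.card = 3 →
          L ∈ WeightedGrid.triples m n c) ∧
      (∀ L ∈ WeightedGrid.zigzagSets m n c,
        WeightedGrid.IsLandmarkSet (WeightedGrid.grid m n) L ∧ 4 ≤ L.card) ∧
      (∀ L : Finset (WeightedGrid.Vertex m n),
        Minimal (WeightedGrid.IsLandmarkSet (WeightedGrid.grid m n)) L →
        WeightedGrid.IsCheapest c (WeightedGrid.landmarkSets m n) L → 4 ≤ L.card →
          L ∈ WeightedGrid.zigzagSets m n c)) ∧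
    ∃ (P₂ P₃ P₄ P : WeightedGrid.Program) (C : ℕ),
      ∀ m n : ℕ, 2 ≤ m → 2 ≤ n → ∀ c : WeightedGrid.Vertex m n → NNRat,
        ∃ (t₂ t₃ t₄ t : ℕ) (o₂ o₃ o₄ o : List (ℕ × ℕ)),
          (WeightedGrid.Runs P₂ c t₂ o₂ ∧ t₂ ≤ C ∧
            WeightedGrid.Finds c (WeightedGrid.adjacentCornerPairs m n) o₂) ∧
          (WeightedGrid.Runs P₃ c t₃ o₃ ∧ t₃ ≤ C * ((m + n) * (m * n)) ∧
            WeightedGrid.Finds c (WeightedGrid.triples m n c) o₃) ∧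
          (WeightedGrid.Runs P₄ c t₄ o₄ ∧ t₄ ≤ C * ((m + n) * (m * n)) ∧
            WeightedGrid.Finds c (WeightedGrid.zigzagSets m n c) o₄) ∧
          (WeightedGrid.Runs P c t o ∧ t ≤ C * ((m + n) * (m * n)) ∧ t ≤ C * (m * n) ^ 2 ∧
            (o = o₂ ∨ o = o₃ ∨ o = o₄) ∧
            ∃ L, WeightedGrid.IsCheapest c (WeightedGrid.landmarkSets m n) L ∧
              WeightedGrid.Lists o L) := by

  refine ⟨fun m n hm hn c => ⟨fun L => ⟨fun ⟨hL, hcard⟩ => ?_,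
    WeightedGrid.isLandmarkSet_adjacentCornerPairs hm hn L⟩,
    WeightedGrid.isLandmarkSet_triples hm hn c, fun L hL hcard => ?_,
    WeightedGrid.isLandmarkSet_zigzagSets hm hn c, fun L hL hmin hcard => ?_⟩,
    WeightedGrid.cornerSolver.program, WeightedGrid.tripleSolver.program,
    WeightedGrid.zigzagSolver.program,
    (WeightedGrid.cornerSolver.select
      (WeightedGrid.tripleSolver.select WeightedGrid.zigzagSolver)).program,
    6000, fun m n hm hn c => ?_⟩
  · obtain ⟨S, hS, h⟩ := WeightedGrid.exists_subset_mem_families hm hn c hL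
    have hle := Finset.card_le_card hS
    rcases h with h | h | h
    · have := (WeightedGrid.isLandmarkSet_adjacentCornerPairs hm hn S h).2
      rwa [← Finset.eq_of_subset_of_card_le hS (by omega)]
    · have := (WeightedGrid.isLandmarkSet_triples hm hn c S h).2
      omega
    · have := WeightedGrid.card_stairSets_orientations hm hn h
      omega
  · rcases WeightedGrid.mem_families_of_minimal hm hn c hL with h | h | h
    · have := (WeightedGrid.isLandmarkSet_adjacentCornerPairs hm hn L h).2
      omega
    · exact h
    · have := WeightedGrid.card_stairSets_orientations hm hn h
      omega
  · rcases WeightedGrid.mem_families_of_minimal hm hn c hL with h | h | h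
    · have := (WeightedGrid.isLandmarkSet_adjacentCornerPairs hm hn L h).2
      omega
    · have := (WeightedGrid.isLandmarkSet_triples hm hn c L h).2
      omega
    · exact WeightedGrid.mem_zigzagSets_of_isCheapest hm hn h hmin
  · obtain ⟨w₂, o₂, hy₂, hf₂⟩ := WeightedGrid.solvesAt_cornerSolver hm hn c
    obtain ⟨w₃, o₃, hy₃, hf₃⟩ := WeightedGrid.solvesAt_tripleSolver hm hn c
    obtain ⟨w₄, o₄, hy₄, hf₄⟩ := WeightedGrid.solvesAt_zigzagSolver hm hn c
    obtain ⟨t₂, ht₂, hr₂⟩ := hy₂.runs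
    obtain ⟨t₃, ht₃, hr₃⟩ := hy₃.runs
    obtain ⟨t₄, ht₄, hr₄⟩ := hy₄.runs
    obtain ⟨t, ht, hr⟩ := (hy₂.select (hy₃.select hy₄)).runs
    have hmn : m + n ≤ m * n := by nlinarith
    have hX : 1 ≤ (m + n) * (m * n) := Nat.mul_pos (by omega) (Nat.mul_pos (by omega) (by omega))
    have hX' : (m + n) * (m * n) ≤ (m * n) ^ 2 := by
      rw [sq]
      exact Nat.mul_le_mul_right _ hmn
    refine ⟨t₂, t₃, t₄, t, o₂, o₃, o₄, _, ⟨hr₂, by omega, hf₂.finds⟩, ⟨hr₃, by omega, hf₃.finds⟩,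
      ⟨hr₄, by omega, hf₄.finds⟩, hr, by omega, by omega, ?_, ?_⟩
    · split_ifs <;> simp
    · rcases hf₂.select (hf₃.select hf₄) with ⟨L, hL, ho, -⟩ | ⟨hempty, -, -⟩
      · exact ⟨L, hL.landmarkSets hm hn, ho⟩
      · -- A minimal cheapest landmark set belongs to one of the families, which are not all empty.
        obtain ⟨M, hM, hM'⟩ := WeightedGrid.exists_minimal_isCheapest m n hm hn c
        exfalso
        rw [Set.union_empty_iff, Set.union_empty_iff] at hempty
        rcases WeightedGrid.mem_families_of_minimal hm hn c hM with h | h | h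
        · rwa [hempty.1] at h
        · rwa [hempty.2.1] at h
        · have := WeightedGrid.mem_zigzagSets_of_isCheapest hm hn h hM'
          rwa [hempty.2.2] at this
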